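/- Let $d\ge 1$, let $Z=\mathbb C^d$ with scalar product $(z|w)=\sum_i z_i\overline{w_i}$, let $D\subset Z$ be the open unit ball, and put $p=d+1$, $\Delta_{z,w}=1-(z|w)$, $B_{z,w}\zeta=(1-(z|w))(\zeta-(\zeta|w)z)$, $\zeta^{w}=\zeta/(1-(\zeta|w))$. Let $P_kZ$ be the space of $k$-homogeneous polynomials on $Z$ and $P^nZ=\bigoplus_{k\le n}P_kZ$ the space of polynomials of degree at most $n$. Let $(\varphi|\psi)_F=\pi^{-d}\int_Z e^{-(\omega|\omega)}\overline{\varphi(\omega)}\psi(\omega)\,d\omega$ be the Fischer–Fock inner product, and let $(\cdot|\cdot)$ be any $U(d)$-invariant inner product on $P^nZ$. Let $0\le\lambda\le n$ be integers and $\nu>d$ a real number (so that the following spaces contain all polynomial maps). The space $H^2_\nu(D,P_\lambda Z)$ consists of the holomorphic maps $z\mapsto\Phi_z$ from $D$ to $P_\lambda Z$ that are square-integrable for $$(\Phi|\Psi)=\int_D \Delta_{x,x}^{\nu-p}\,(\Phi_x\,|\,\Psi_x\circ B_{x,x})_F\,dx ,$$ and $H^2_\nu(D,P^nZ)$ consists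 of the holomorphic maps $z\mapsto\Phi_z$ from $D$ to $P^nZ$ that are square-integrable for $$(\Phi|\Psi)=\int_D \Delta_{x,x}^{\nu-p}\,\bigl(\Delta_{\zeta,-x}^n\Phi_x(B_{x,x}^{1/2}\zeta^{-x})\,\big|\,\Delta_{\zeta,-x}^n\Psi_x(B_{x,x}^{1/2}\zeta^{-x})\bigr)\,dx ,$$ where the entries of the inner product under the integral are polynomials in $\zeta$ of degree at most $n$. For a biholomorphic automorphism $g$ of $D$ and a holomorphic branch of $\log\det(\partial_z g)$ on $D$, used for all powers of the Jacobian, put $$(g^{-\alpha_\nu}\Phi)_z(\zeta)=\det(\partial_z g)^{\nu/p}\,\Phi_{g(z)}((\partial_z g)\zeta),$$ $$(g^{-\beta_\nu}\Phi)_z(\zeta)=\det(\partial_z g)^{(\nu+n)/p}\det(\partial_{z+\zeta}g)^{-n/p}\,\Phi_{g(z)}(g(z+\zeta)-g(z)),$$ the second formula being read as an identity of polynomials in $\zeta$, for $z,z+\zeta\in D$. Write $(a)_k=a(a+1)\cdots(a+k-1)$, and let $(\zeta|\bar\partial)=\sum_{i=1}^d\zeta_i\,\partial/\partial z_i$, where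 the derivatives act on the variable $z$ of $\Phi_z(\zeta)$ with $\zeta$ held fixed. **Theorem.** The operator $$I_\lambda=\sum_{k=0}^{n-\lambda}\frac{(-1)^k}{(2\lambda+\nu)_k}\binom{n-\lambda}{k}(\zeta|\bar\partial)^k=\sum_{k=0}^{n-\lambda}\frac{(\lambda-n)_k}{(2\lambda+\nu)_k}\frac{(\zeta|\bar\partial)^k}{k!}=\sum_{k=0}^{n-\lambda}\frac{(\lambda-n)_k}{(2\lambda+\nu)_k}E^k(\zeta,\bar\partial)$$ (these three expressions agree on all holomorphic maps $D\to P_\lambda Z$) is an intertwiner $H^2_\nu(D,P_\lambda Z)\to H^2_\nu(D,P^nZ)$, i.e. a bounded linear operator between these spaces with $I_\lambda\,g^{-\alpha_\nu}\Phi=g^{-\beta_\nu}I_\lambda\Phi$ for every biholomorphic automorphism $g$ of $D$ and every $\Phi\in H^2_\nu(D,P_\lambda Z)$. Here $E^k(\zeta,w)=\sum_j p_j(\zeta)\overline{p_j(w)}$ is the reproducing kernel of $P_kZ$ for $(\cdot|\cdot)_F$, where $(p_j)$ is any orthonormal basis of $P_kZ$, and $E^k(\zeta,\bar\partial)$ is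 the constant coefficient differential operator in $z$ obtained from it by replacing each $\overline{w_i}$ by $\partial/\partial z_i$. -/

import Mathlib

open MeasureTheory Topology

noncomputable section

namespace BallBundle

/-- The Hermitian Jordan triple `Z = ℂ^d` of rank one. -/
abbrev Z (d : ℕ) : Type := EuclideanSpace ℂ (Fin d)

/-- The unit ball `D` of `ℂ^d`. -/
abbrev D (d : ℕ) : Set (Z d) := Metric.ball 0 1

/-- The scalar product `(z|w)` of `ℂ^d`, linear in `z` and conjugate-linear in `w`. -/
def sp {d : ℕ} (z w : Z d) : ℂ := inner ℂ w z

/-- The genus `p = d + 1` of the unit ball. -/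
def genus (d : ℕ) : ℝ := (d : ℝ) + 1

/-! ### Jordan theoretic data of the ball -/

/-- The Jordan triple product, `2 {u v* w} = (u|v) w + (w|v) u`. -/
def triple {d : ℕ} (u v w : Z d) : Z d := (2⁻¹ : ℂ) • (sp u v • w + sp w v • u)

/-- The Bergman operator `B_{u,v} = I - 2 u □ v* + Q_u Q_v`, where `Q_u z = {u z* u}`. -/
def bergman {d : ℕ} (u v ζ : Z d) : Z d :=
  ζ - (2 : ℂ) • triple u v ζ + triple u (triple v ζ v) u

/-- The quasi-determinant `Δ_{z,w} = 1 - (z|w)`. -/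
def quasiDet {d : ℕ} (z w : Z d) : ℂ := 1 - sp z w

/-- The quasi-inverse `z^w = z / (1 - (z|w))` (for `Δ_{z,w} ≠ 0`). -/
def quasiInv {d : ℕ} (z w : Z d) : Z d := (quasiDet z w)⁻¹ • z

/-- The positive square root `B_{x,x}^{1/2}` for `x ∈ D`: it is multiplication by `s` on the
orthogonal complement of `x` and by `s ^ 2` on `ℂ x`, where `s = √(1 - (x|x))`. -/
def bergmanSqrt {d : ℕ} (x ζ : Z d) : Z d :=
  ((Real.sqrt (1 - ‖x‖ ^ 2) : ℝ) : ℂ) •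
    (ζ - (sp ζ x / (1 + (Real.sqrt (1 - ‖x‖ ^ 2) : ℝ))) • x)

theorem bergman_apply {d : ℕ} (u v ζ : Z d) :
    bergman u v ζ = quasiDet u v • (ζ - sp ζ v • u) := by
  ext i
  simp only [bergman, triple, quasiDet, sp, inner_smul_left, inner_add_left, PiLp.add_apply,
    PiLp.sub_apply, PiLp.smul_apply, smul_eq_mul, map_inv₀, map_ofNat, inner_conj_symm]
  ring

theorem bergman_quasiInv {d : ℕ} (z w : Z d) (h : quasiDet z w ≠ 0) :
    bergman z w (quasiInv z w) = z - triple z w z := by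
  have h' : 1 - inner ℂ w z ≠ 0 := h
  rw [bergman_apply]
  ext i
  simp only [quasiInv, triple, quasiDet, sp, inner_smul_right, PiLp.add_apply,
    PiLp.sub_apply, PiLp.smul_apply, smul_eq_mul]
  field_simp
  ring

theorem bergmanSqrt_bergmanSqrt {d : ℕ} (x ζ : Z d) (hx : x ∈ D d) :
    bergmanSqrt x (bergmanSqrt x ζ) = bergman x x ζ := by
  have hx1 : ‖x‖ < 1 := by simpa using hx
  have hn : 0 ≤ 1 - ‖x‖ ^ 2 := by nlinarith [norm_nonneg x]
  have hs2 := Real.sq_sqrt hn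
  have hs0 := Real.sqrt_nonneg (1 - ‖x‖ ^ 2)
  rw [bergman_apply]
  set s := Real.sqrt (1 - ‖x‖ ^ 2) with hs
  have hxx : inner ℂ x x = 1 - (s : ℂ) ^ 2 := by
    rw [inner_self_eq_norm_sq_to_K]
    have h : ((‖x‖ ^ 2 : ℝ) : ℂ) = ((1 - s ^ 2 : ℝ) : ℂ) := by
      rw [show ‖x‖ ^ 2 = 1 - s ^ 2 by linarith]
    simpa using h
  have hne : (1 + (s : ℂ)) ≠ 0 := by
    have : (1 + s) ≠ 0 := by positivity
    exact_mod_cast this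
  ext i
  simp only [bergmanSqrt, quasiDet, sp, inner_smul_right, inner_sub_right,
    PiLp.sub_apply, PiLp.smul_apply, smul_eq_mul, ← hs, hxx]
  field_simp
  ring

theorem inner_bergmanSqrt_nonneg {d : ℕ} (x ζ : Z d) (hx : x ∈ D d) :
    0 ≤ (inner ℂ ζ (bergmanSqrt x ζ)).re ∧ (inner ℂ ζ (bergmanSqrt x ζ)).im = 0 := by
  have hx1 : ‖x‖ < 1 := by simpa using hx
  have hs0 := Real.sqrt_nonneg (1 - ‖x‖ ^ 2)
  set s := Real.sqrt (1 - ‖x‖ ^ 2) with hs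
  have key : inner ℂ ζ (bergmanSqrt x ζ) =
      ((s * (‖ζ‖ ^ 2 - ‖inner ℂ x ζ‖ ^ 2 / (1 + s)) : ℝ) : ℂ) := by
    have h1 : inner ℂ x ζ * inner ℂ ζ x = ((‖inner ℂ x ζ‖ ^ 2 : ℝ) : ℂ) := by
      rw [← inner_conj_symm ζ x, Complex.mul_conj, Complex.normSq_eq_norm_sq]
    have h2 : inner ℂ ζ ζ = ((‖ζ‖ ^ 2 : ℝ) : ℂ) := by
      rw [inner_self_eq_norm_sq_to_K]; norm_cast
    simp only [bergmanSqrt, sp, inner_smul_right, inner_sub_right, ← hs, h2]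
    rw [div_mul_eq_mul_div, h1]
    push_cast
    ring
  rw [key]
  refine ⟨?_, Complex.ofReal_im _⟩
  rw [Complex.ofReal_re]
  have h3 : ‖inner ℂ x ζ‖ ≤ ‖ζ‖ :=
    (norm_inner_le_norm x ζ).trans (by nlinarith [norm_nonneg ζ])
  have h4 : ‖inner ℂ x ζ‖ ^ 2 / (1 + s) ≤ ‖ζ‖ ^ 2 := by
    rw [div_le_iff₀ (by positivity)]
    nlinarith [norm_nonneg ζ, norm_nonneg (inner ℂ x ζ), mul_nonneg hs0 (sq_nonneg ‖ζ‖)]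
  exact mul_nonneg hs0 (by linarith)

/-! ### Polynomials on `Z` -/

/-- The polynomial function on `ℂ^d` defined by a polynomial in the coordinates. -/
def polyFun (d : ℕ) : MvPolynomial (Fin d) ℂ →ₗ[ℂ] (Z d → ℂ) where
  toFun p := fun ζ => MvPolynomial.eval (fun i => ζ i) p
  map_add' p q := by ext ζ; simp
  map_smul' c p := by ext ζ; simp [MvPolynomial.smul_eval]

/-- `P_k Z`: for the ball, the `k`-homogeneous polynomials on `Z`. -/
def homPoly (d k : ℕ) : Submodule ℂ (Z d → ℂ) :=
  (MvPolynomial.homogeneousSubmodule (Fin d) ℂ k).map (polyFun d)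

/-- `P^n Z`, the direct sum of the `P_k Z` for `k ≤ n`: the polynomials of degree at most `n`. -/
def polyLE (d n : ℕ) : Submodule ℂ (Z d → ℂ) :=
  (MvPolynomial.restrictTotalDegree (Fin d) ℂ n).map (polyFun d)

/-- The Fischer-Fock inner product
`(φ|ψ)_F = π^{-d} ∫ exp(-(ω|ω)) conj(φ(ω)) ψ(ω) dω`. -/
def fischer {d : ℕ} (φ ψ : Z d → ℂ) : ℂ :=
  ∫ ω : Z d, ((Real.exp (-‖ω‖ ^ 2) / Real.pi ^ d : ℝ) : ℂ) * (starRingEnd ℂ (φ ω) * ψ ω)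

/-- `H` restricts to a `K`-invariant inner product on `P^n Z`, conjugate-linear in the first
variable, where `K = U(d)` is the stabiliser of `0`. Every inner product on `P^n Z` is such a
restriction, and only the restriction is ever used. -/
structure IsInvariantInner (d n : ℕ) (H : (Z d → ℂ) →ₗ⋆[ℂ] (Z d → ℂ) →ₗ[ℂ] ℂ) : Prop where
  conj_symm : ∀ φ ∈ polyLE d n, ∀ ψ ∈ polyLE d n, starRingEnd ℂ (H ψ φ) = H φ ψ
  pos : ∀ φ ∈ polyLE d n, φ ≠ 0 → 0 < (H φ φ).re
  invariant : ∀ k : Z d ≃ₗᵢ[ℂ] Z d, ∀ φ ∈ polyLE d n, ∀ ψ ∈ polyLE d n,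
    H (φ ∘ k) (ψ ∘ k) = H φ ψ

/-! ### Little and big Hilbert spaces

A map `z ↦ Φ_z` from `D` to polynomials on `Z` is a function `Φ : Z → Z → ℂ`, `Φ z ζ = Φ_z(ζ)`,
whose values for `z ∉ D` play no role. -/

/-- `Φ` is a holomorphic map from `D` to the space of polynomials `V` (which is finite
dimensional in all uses, so that holomorphy may be tested on point evaluations). -/
def IsHolomorphicMap {d : ℕ} (V : Submodule ℂ (Z d → ℂ)) (Φ : Z d → Z d → ℂ) : Prop :=
  (∀ z ∈ D d, Φ z ∈ V) ∧ ∀ ζ : Z d, DifferentiableOn ℂ (fun z => Φ z ζ) (D d)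

/-- The density `Δ_{x,x}^ν Δ_{x,x}^{-p}` of `Δ_{x,x}^ν dμ(x)` with respect to Lebesgue measure,
where `dμ` is the invariant measure of `D`. -/
def weight {d : ℕ} (ν : ℝ) (x : Z d) : ℂ := (((1 - ‖x‖ ^ 2) ^ (ν - genus d) : ℝ) : ℂ)

/-- The integrand `Δ_{x,x}^{ν-p} (Φ_x | Ψ_x ∘ B_{x,x})_F` of the little inner product. -/
def littleIntegrand {d : ℕ} (ν : ℝ) (Φ Ψ : Z d → Z d → ℂ) (x : Z d) : ℂ :=
  weight ν x * fischer (Φ x) (fun ω => Ψ x (bergman x x ω))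

/-- The inner product of the little Hilbert space. -/
def littleInner {d : ℕ} (ν : ℝ) (Φ Ψ : Z d → Z d → ℂ) : ℂ :=
  ∫ x in D d, littleIntegrand ν Φ Ψ x

/-- The norm of the little Hilbert space. -/
def littleNorm {d : ℕ} (ν : ℝ) (Φ : Z d → Z d → ℂ) : ℝ :=
  Real.sqrt (littleInner ν Φ Φ).re

/-- Membership in the little Hilbert space `H²_ν(D, P_l Z)`. -/
structure MemLittle {d : ℕ} (ν : ℝ) (l : ℕ) (Φ : Z d → Z d → ℂ) : Prop where
  holo : IsHolomorphicMap (homPoly d l) Φ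
  sq_int : IntegrableOn (littleIntegrand ν Φ Φ) (D d)

/-- For `φ ∈ P^n Z`, the polynomial `ζ ↦ Δ_{ζ,-x}^n φ(B_{x,x}^{1/2} ζ^{-x})`. The formula is
meaningful where `Δ_{ζ,-x} ≠ 0`, and is extended by continuity to all of `Z`. -/
def transport {d : ℕ} (n : ℕ) (x : Z d) (φ : Z d → ℂ) : Z d → ℂ :=
  extendFrom {ζ : Z d | quasiDet ζ (-x) ≠ 0}
    (fun ζ => quasiDet ζ (-x) ^ n * φ (bergmanSqrt x (quasiInv ζ (-x))))

/-- The integrand of the big inner product, for the inner product `H` on `P^n Z`. -/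
def bigIntegrand {d : ℕ} (ν : ℝ) (n : ℕ) (H : (Z d → ℂ) →ₗ⋆[ℂ] (Z d → ℂ) →ₗ[ℂ] ℂ)
    (Φ Ψ : Z d → Z d → ℂ) (x : Z d) : ℂ :=
  weight ν x * H (transport n x (Φ x)) (transport n x (Ψ x))

/-- The inner product of the big Hilbert space. -/
def bigInner {d : ℕ} (ν : ℝ) (n : ℕ) (H : (Z d → ℂ) →ₗ⋆[ℂ] (Z d → ℂ) →ₗ[ℂ] ℂ)
    (Φ Ψ : Z d → Z d → ℂ) : ℂ :=
  ∫ x in D d, bigIntegrand ν n H Φ Ψ x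

/-- The norm of the big Hilbert space. -/
def bigNorm {d : ℕ} (ν : ℝ) (n : ℕ) (H : (Z d → ℂ) →ₗ⋆[ℂ] (Z d → ℂ) →ₗ[ℂ] ℂ)
    (Φ : Z d → Z d → ℂ) : ℝ :=
  Real.sqrt (bigInner ν n H Φ Φ).re

/-- Membership in the big Hilbert space `H²_ν(D, P^n Z)`. -/
structure MemBig {d : ℕ} (ν : ℝ) (n : ℕ) (H : (Z d → ℂ) →ₗ⋆[ℂ] (Z d → ℂ) →ₗ[ℂ] ℂ)
    (Φ : Z d → Z d → ℂ) : Prop where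
  holo : IsHolomorphicMap (polyLE d n) Φ
  sq_int : IntegrableOn (bigIntegrand ν n H Φ Φ) (D d)

/-! ### The group and its actions -/

/-- The biholomorphic automorphisms of `D` (a connected group for the ball); the values of the
two functions outside `D` play no role. -/
structure BallAut (d : ℕ) where
  toFun : Z d → Z d
  invFun : Z d → Z d
  mapsTo : Set.MapsTo toFun (D d) (D d)
  mapsTo_inv : Set.MapsTo invFun (D d) (D d)
  left_inv : Set.LeftInvOn invFun toFun (D d)
  right_inv : Set.RightInvOn invFun toFun (D d)
  holo : DifferentiableOn ℂ toFun (D d)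
  holo_inv : DifferentiableOn ℂ invFun (D d)

/-- `L` is a holomorphic branch on `D` of `z ↦ log det(∂_z g)`. With it,
`det(∂_z g)^s = exp(s L(z))`; another branch changes the actions below by a constant phase. -/
structure IsLogJacobian {d : ℕ} (g : BallAut d) (L : Z d → ℂ) : Prop where
  holo : DifferentiableOn ℂ L (D d)
  exp_eq : ∀ z ∈ D d, Complex.exp (L z) = (fderiv ℂ g.toFun z).det

/-- The action on the little space of the inverse of `g`:
`Φ ↦ det(∂_z g)^{ν/p} Φ_{g(z)}((∂_z g) ζ)`. -/
def littleAction {d : ℕ} (ν : ℝ) (g : BallAut d) (L : Z d → ℂ) (Φ : Z d → Z d → ℂ) :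
    Z d → Z d → ℂ := fun z ζ =>
  Complex.exp (((ν / genus d : ℝ) : ℂ) * L z) * Φ (g.toFun z) (fderiv ℂ g.toFun z ζ)

/-- The action on the big space of the inverse of `g`:
`Φ ↦ det(∂_z g)^{(ν+n)/p} det(∂_{z+ζ} g)^{-n/p} Φ_{g(z)}(g(z+ζ) - g(z))`. The formula is used for
`z` and `z + ζ` in `D`; for each `z ∈ D` these `ζ` form a non-empty open set, on which a
polynomial in `ζ` is determined. -/
def bigAction {d : ℕ} (ν : ℝ) (n : ℕ) (g : BallAut d) (L : Z d → ℂ) (Φ : Z d → Z d → ℂ) :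
    Z d → Z d → ℂ := fun z ζ =>
  Complex.exp ((((ν + n) / genus d : ℝ) : ℂ) * L z) *
    Complex.exp (((-(n : ℝ) / genus d : ℝ) : ℂ) * L (z + ζ)) *
    Φ (g.toFun z) (g.toFun (z + ζ) - g.toFun z)

/-- `I` is an intertwiner `H²_ν(D, P_l Z) → H²_ν(D, P^n Z)`: a bounded linear operator between
these spaces which commutes with the actions of the automorphism group of `D`. -/
structure IsIntertwiner {d : ℕ} (ν : ℝ) (l n : ℕ)
    (H : (Z d → ℂ) →ₗ⋆[ℂ] (Z d → ℂ) →ₗ[ℂ] ℂ)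
    (I : (Z d → Z d → ℂ) → (Z d → Z d → ℂ)) : Prop where
  mem : ∀ Φ, MemLittle ν l Φ → MemBig ν n H (I Φ)
  map_add : ∀ Φ Ψ, MemLittle ν l Φ → MemLittle ν l Ψ →
    ∀ z ∈ D d, I (Φ + Ψ) z = I Φ z + I Ψ z
  map_smul : ∀ (c : ℂ) (Φ), MemLittle ν l Φ → ∀ z ∈ D d, I (c • Φ) z = c • I Φ z
  bounded : ∃ C : ℝ, ∀ Φ, MemLittle ν l Φ → bigNorm ν n H (I Φ) ≤ C * littleNorm ν Φ
  equivariant : ∀ (g : BallAut d) (L : Z d → ℂ), IsLogJacobian g L →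
    ∀ Φ, MemLittle ν l Φ → ∀ z ∈ D d, ∀ ζ : Z d, z + ζ ∈ D d →
      I (littleAction ν g L Φ) z ζ = bigAction ν n g L (I Φ) z ζ

/-! ### The differential operators -/

/-- The partial derivative of a holomorphic function in the `i`-th coordinate direction. -/
def partialD {d : ℕ} (i : Fin d) (f : Z d → ℂ) : Z d → ℂ :=
  fun z => fderiv ℂ f z (EuclideanSpace.single i 1)

/-- The operator `(ζ|∂̄) = ∑ i, ζ_i ∂/∂z_i`; the derivatives are those of `z ↦ Φ_z(ζ)`. -/
def shiftD {d : ℕ} (Φ : Z d → Z d → ℂ) : Z d → Z d → ℂ :=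
  fun z ζ => ∑ i : Fin d, ζ i * partialD i (fun w => Φ w ζ) z

/-- The Pochhammer symbol `(a)_k = a (a + 1) ⋯ (a + k - 1)`. -/
def poch (a : ℂ) (k : ℕ) : ℂ := (ascPochhammer ℂ k).eval a

/-- `∑_{k=0}^{n-l} ((l-n)_k / (2l+ν)_k) (ζ|∂̄)^k / k!` -/
def ballOp {d : ℕ} (ν : ℝ) (l n : ℕ) (Φ : Z d → Z d → ℂ) : Z d → Z d → ℂ := fun z ζ =>
  ∑ k ∈ Finset.range (n - l + 1),
    poch ((l : ℂ) - n) k / poch (2 * (l : ℂ) + ν) k * ((shiftD^[k] Φ) z ζ / (k.factorial : ℂ))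

/-- `∑_{k=0}^{n-l} ((-1)^k / (2l+ν)_k) (n-l choose k) (ζ|∂̄)^k` -/
def ballOpBinom {d : ℕ} (ν : ℝ) (l n : ℕ) (Φ : Z d → Z d → ℂ) : Z d → Z d → ℂ := fun z ζ =>
  ∑ k ∈ Finset.range (n - l + 1),
    (-1) ^ k / poch (2 * (l : ℂ) + ν) k * ((n - l).choose k : ℂ) * (shiftD^[k] Φ) z ζ

/-- The iterated partial derivative `∂^m`. -/
def multiD {d : ℕ} (m : Fin d →₀ ℕ) (f : Z d → ℂ) : Z d → ℂ :=
  (List.finRange d).foldr (fun i h => (partialD i)^[m i] h) f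

/-- The constant coefficient differential operator `q(∂/∂z_1, …, ∂/∂z_d)`. -/
def constCoeffOp {d : ℕ} (q : MvPolynomial (Fin d) ℂ) (f : Z d → ℂ) : Z d → ℂ :=
  fun z => ∑ m ∈ q.support, q.coeff m * multiD m f z

/-- `b` is an orthonormal basis of `P_k Z` for the Fischer-Fock inner product. -/
structure IsFischerBasis (d k : ℕ) (b : Finset (MvPolynomial (Fin d) ℂ)) : Prop where
  orthonormal : ∀ p ∈ b, fischer (polyFun d p) (polyFun d p) = 1 ∧
    ∀ q ∈ b, p ≠ q → fischer (polyFun d p) (polyFun d q) = 0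
  span : Submodule.span ℂ (b : Set (MvPolynomial (Fin d) ℂ)) =
    MvPolynomial.homogeneousSubmodule (Fin d) ℂ k

/-- `E^k(ζ, ∂̄)`, for the reproducing kernel `E^k(ζ,w) = ∑_{p ∈ b} p(ζ) conj(p(w))` of `P_k Z`
written in an orthonormal basis `b`: the variables `conj(w_i)` are replaced by `∂/∂z_i`. -/
def kernelOp {d : ℕ} (b : Finset (MvPolynomial (Fin d) ℂ)) (Φ : Z d → Z d → ℂ) :
    Z d → Z d → ℂ := fun z ζ =>
  ∑ p ∈ b, polyFun d p ζ *
    constCoeffOp (MvPolynomial.map (starRingEnd ℂ) p) (fun w => Φ w ζ) z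

/-- `∑_{k=0}^{n-l} ((l-n)_k / (2l+ν)_k) E^k(ζ, ∂̄)` -/
def ballOpKernel {d : ℕ} (ν : ℝ) (l n : ℕ) (b : ℕ → Finset (MvPolynomial (Fin d) ℂ))
    (Φ : Z d → Z d → ℂ) : Z d → Z d → ℂ := fun z ζ =>
  ∑ k ∈ Finset.range (n - l + 1),
    poch ((l : ℂ) - n) k / poch (2 * (l : ℂ) + ν) k * kernelOp (b k) Φ z ζ

end BallBundle

end

noncomputable section

namespace BallBundle

/-! ### Holomorphic functions of several variables -/

/-! Equivariance is a computation in one variable. By Schwarz and Cartan an automorphism is `g =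
transv a ∘ U` with `U` a linear isometry, so it is fractional linear with denominator `j(z) = 1 +
(Uz|a)`. Hence `det g'` is a constant times `j^{-(d+1)}`, `g(z+ζ) - g(z) = (j(z)/j(z+ζ)) g'(z)ζ` and
`g'(z+tζ)ζ = (j(z)/j(z+tζ))² g'(z)ζ`. Write `j(z+tζ) = j(z)(1+rt)`, `η = g'(z)ζ`, `μ = 2l+ν`, `N =
n-l`. On the line `t ↦ z+tζ` the transformed map, evaluated at `ζ`, is `c (1+rt)^{-μ} F(t/(1+rt))`
with `F(u) = Φ_{g(z)+uη}(η)`, and `(ζ|∂̄)^k` is the `k`-th derivative in `t`. `line_derivatives`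
expands it at `t = 0` in the `F^{(m)}(0)`; the weights `(-1)^k C(N,k)/(μ)_k` are those for which the
double sum collapses by the binomial theorem to multiples of `(1+r)^{N-m} F^{(m)}(0)`
(`sum_lineCoeff`). In the big action the Jacobians contribute `(1+r)^n` and homogeneity of degree
`l+m` contributes `(1+r)^{-l-m}`, the same power.

Boundedness is a local estimate at hyperbolic scale. After transport, `I_l Φ` at `x` is a
combination of the polynomials `(1+(ζ|x))^{N-k} ((ζ|∂̄)^k Φ)_x(B_{x,x}^{1/2}ζ)`
(`transport_ballOp`), and the form on `P^n Z` is controlled by finitely many point values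
(`exists_inner_bound`). In the chart `w ↦ x + B_{x,x}^{1/2}w`, `‖w‖ < 1/4`, the derivatives are
bounded by Cauchy's estimate and the sub-mean value property; the weights and the operators
`B^{1/2}` at the two points are comparable (`Near`), so what appears is the little density averaged
over the chart. Averaging over charts is bounded on `L¹` by Tonelli, because the relation between
`x` and `y` is symmetric up to constants (`lintegral_lintegral_bergmanSqrt_le`).

The kernel form of the operator rests on `E^k(ζ,w) = (ζ|w)^k / k!`, obtained from the adjointness of
multiplication and differentiation for the Fischer-Fock product. -/

open Metric in
theorem differentiableOn_fderiv_apply {d : ℕ} {U : Set (Z d)} (hU : IsOpen U) {f : Z d → ℂ}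
    (hf : DifferentiableOn ℂ f U) (ζ : Z d) :
    DifferentiableOn ℂ (fun z => fderiv ℂ f z ζ) U := by
  intro z₀ hz₀
  apply DifferentiableAt.differentiableWithinAt
  -- a ball on which `f` oscillates by at most one
  obtain ⟨R, hR, hRU, hR1⟩ : ∃ R > 0, ball z₀ R ⊆ U ∧ ∀ z ∈ ball z₀ R, dist (f z) (f z₀) < 1 := by
    have hc := (hf.differentiableAt (hU.mem_nhds hz₀)).continuousAt
    have h1 : ∀ᶠ z in 𝓝 z₀, dist (f z) (f z₀) < 1 :=
      hc.eventually (ball_mem_nhds (f z₀) one_pos)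
    obtain ⟨R, hR, h⟩ := Metric.eventually_nhds_iff_ball.1 (h1.and (hU.mem_nhds hz₀))
    exact ⟨R, hR, fun z hz => (h z hz).2, fun z hz => (h z hz).1⟩
  set r : ℝ := R / (4 * (‖ζ‖ + 1)) with hr
  have hr0 : 0 < r := by positivity
  have hrζ : r * ‖ζ‖ < R / 4 := by
    have : r * (‖ζ‖ + 1) = R / 4 := by rw [hr]; field_simp
    nlinarith
  have hmem : ∀ z ∈ ball z₀ (R / 4), ∀ t : ℂ, ‖t‖ ≤ r → z + t • ζ ∈ ball z₀ (R / 2) := by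
    intro z hz t ht
    rw [mem_ball, dist_eq_norm] at hz ⊢
    calc ‖z + t • ζ - z₀‖ = ‖(z - z₀) + t • ζ‖ := by congr 1; abel
      _ ≤ ‖z - z₀‖ + ‖t‖ * ‖ζ‖ := (norm_add_le _ _).trans (by rw [norm_smul])
      _ < R / 2 := by
        have := mul_le_mul_of_nonneg_right ht (norm_nonneg ζ)
        linarith
  have hhalf : ball z₀ (R / 2) ⊆ U := (ball_subset_ball (by linarith)).trans hRU
  -- All values on `ball z₀ R` lie within one of `f z₀`, hence within two of each other; this gives
  -- the uniform domination needed below.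
  have hbound : ∀ w ∈ ball z₀ (R / 2), ‖fderiv ℂ f w‖ ≤ 2 / (R / 2) := by
    intro w hw
    have hsub : ball w (R / 2) ⊆ ball z₀ R := by
      apply ball_subset_ball'
      rw [mem_ball] at hw; linarith
    refine Complex.norm_fderiv_le_div_of_mapsTo_ball (hf.mono (hsub.trans hRU)) ?_ (by positivity)
    intro v hv
    rw [mem_closedBall]
    have h1 := hR1 v (hsub hv)
    have h2 := hR1 w (ball_subset_ball (by linarith) hw)
    have := dist_triangle_right (f v) (f w) (f z₀)
    linarith
  -- Cauchy's formula on the complex line through `z` in direction `ζ`. Now `z` enters only through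
  -- values of `f`, so differentiating under the integral needs only the first derivative of `f`.
  have hcauchy : ∀ z ∈ ball z₀ (R / 4), fderiv ℂ f z ζ =
      (2 * Real.pi * Complex.I : ℂ)⁻¹ • ∮ t in C(0, r), ((t - 0) ^ 2)⁻¹ • f (z + t • ζ) := by
    intro z hz
    have hline : ∀ t : ℂ, HasDerivAt (fun t : ℂ => z + t • ζ) ζ t := fun t => by
      simpa using ((hasDerivAt_id t).smul_const ζ).const_add z
    have hV : IsOpen ((fun t : ℂ => z + t • ζ) ⁻¹' U) := hU.preimage (by fun_prop)
    have hd : DifferentiableOn ℂ (fun t : ℂ => f (z + t • ζ)) ((fun t : ℂ => z + t • ζ) ⁻¹' U) :=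
      fun t ht => ((hf.differentiableAt (hU.mem_nhds ht)).comp t
        (hline t).differentiableAt).differentiableWithinAt
    rw [Complex.two_pi_I_inv_smul_circleIntegral_sub_sq_inv_smul_of_differentiable hV
      (fun t ht => hhalf (hmem z hz t (by simpa using ht))) hd (by simpa using hr0)]
    have hz' : z ∈ U := hhalf (ball_subset_ball (by linarith) hz)
    have h0 : HasFDerivAt f (fderiv ℂ f z) (z + (0 : ℂ) • ζ) := by
      simpa using (hf.differentiableAt (hU.mem_nhds hz')).hasFDerivAt
    exact (h0.comp_hasDerivAt (0 : ℂ) (hline 0)).deriv.symm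
  have hnhds : ball z₀ (R / 4) ∈ 𝓝 z₀ := ball_mem_nhds _ (by positivity)
  refine DifferentiableAt.congr_of_eventuallyEq ?_
    (Filter.eventually_of_mem hnhds fun z hz => hcauchy z hz)
  refine DifferentiableAt.fun_const_smul ?_ _
  simp only [circleIntegral, sub_zero]
  have hcm : ∀ θ : ℝ, ‖circleMap 0 r θ‖ ≤ r := fun θ => by simp [abs_of_pos hr0]
  have hcne : ∀ θ : ℝ, circleMap 0 r θ ≠ 0 := fun θ => by simp [circleMap, hr0.ne']
  have hderiv : ∀ θ : ℝ, ∀ z ∈ ball z₀ (R / 4), HasFDerivAt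
      (fun z => deriv (circleMap 0 r) θ • ((circleMap 0 r θ) ^ 2)⁻¹ • f (z + circleMap 0 r θ • ζ))
      (deriv (circleMap 0 r) θ • ((circleMap 0 r θ) ^ 2)⁻¹ •
        fderiv ℂ f (z + circleMap 0 r θ • ζ)) z := by
    intro θ z hz
    refine HasFDerivAt.fun_const_smul (HasFDerivAt.fun_const_smul ?_ _) _
    have h1 := (hf.differentiableAt (hU.mem_nhds (hhalf (hmem z hz _ (hcm θ))))).hasFDerivAt
    have h2 : HasFDerivAt (fun z : Z d => z + circleMap 0 r θ • ζ)
        (ContinuousLinearMap.id ℂ (Z d)) z := (hasFDerivAt_id z).add_const _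
    exact (h1.comp z h2).congr_fderiv (by ext; simp)
  have hcont : ∀ z ∈ ball z₀ (R / 4), Continuous fun θ : ℝ =>
      deriv (circleMap 0 r) θ • ((circleMap 0 r θ) ^ 2)⁻¹ • f (z + circleMap 0 r θ • ζ) := by
    intro z hz
    have hc0 : Continuous (circleMap 0 r) := continuous_circleMap 0 r
    have hf' : Continuous fun θ : ℝ => f (z + circleMap 0 r θ • ζ) :=
      hf.continuousOn.comp_continuous (by fun_prop) fun θ => hhalf (hmem z hz _ (hcm θ))
    have hd' : Continuous fun θ : ℝ => deriv (circleMap 0 r) θ := by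
      simp only [deriv_circleMap]; fun_prop
    exact hd'.smul (((hc0.pow 2).inv₀ fun θ => pow_ne_zero 2 (hcne θ)).smul hf')
  refine (intervalIntegral.hasFDerivAt_integral_of_dominated_of_fderiv_le
    (F' := fun z θ => deriv (circleMap 0 r) θ • ((circleMap 0 r θ) ^ 2)⁻¹ •
        fderiv ℂ f (z + circleMap 0 r θ • ζ)) (bound := fun _ => r * ((r ^ 2)⁻¹ * (2 / (R / 2))))
    hnhds ?_ ?_ ?_ ?_ ?_ ?_).differentiableAt
  · filter_upwards [hnhds] with z hz
    exact (hcont z hz).aestronglyMeasurable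
  · exact (hcont z₀ (mem_ball_self (by positivity))).intervalIntegrable _ _
  · have hc0 : Continuous (circleMap 0 r) := continuous_circleMap 0 r
    have hd' : Continuous fun θ : ℝ => deriv (circleMap 0 r) θ := by
      simp only [deriv_circleMap]; fun_prop
    have hm : Measurable fun θ : ℝ => fderiv ℂ f (z₀ + circleMap 0 r θ • ζ) :=
      (measurable_fderiv ℂ f).comp (Continuous.measurable (by fun_prop))
    have hi : Continuous fun θ : ℝ => ((circleMap 0 r θ) ^ 2)⁻¹ :=
      (hc0.pow 2).inv₀ fun θ => pow_ne_zero 2 (hcne θ)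
    exact (hd'.measurable.smul (hi.measurable.smul hm)).aestronglyMeasurable
  · refine Filter.Eventually.of_forall fun θ _ z hz => ?_
    rw [norm_smul, norm_smul]
    have e1 : ‖deriv (circleMap 0 r) θ‖ = r := by simp [deriv_circleMap, abs_of_pos hr0]
    have e2 : ‖((circleMap 0 r θ) ^ 2)⁻¹‖ = (r ^ 2)⁻¹ := by simp
    rw [e1, e2]
    gcongr
    exact hbound _ (hmem z hz _ (hcm θ))
  · exact intervalIntegrable_const
  · exact Filter.Eventually.of_forall fun θ _ z hz => hderiv θ z hz

theorem fderiv_apply_eq_sum {d : ℕ} (f : Z d → ℂ) (z ζ : Z d) :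
    fderiv ℂ f z ζ = ∑ i : Fin d, ζ i * fderiv ℂ f z (EuclideanSpace.single i 1) := by
  have h : ζ = ∑ i : Fin d, ζ i • EuclideanSpace.single i (1 : ℂ) := by
    ext j
    simp [Finset.sum_apply, Pi.single_apply]
  conv_lhs => rw [h]
  simp

theorem differentiableOn_fderiv {d : ℕ} {U : Set (Z d)} (hU : IsOpen U) {f : Z d → ℂ}
    (hf : DifferentiableOn ℂ f U) : DifferentiableOn ℂ (fderiv ℂ f) U := by
  have h : fderiv ℂ f = fun z => ∑ i : Fin d, fderiv ℂ f z (EuclideanSpace.single i 1) •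
      (EuclideanSpace.proj i : Z d →L[ℂ] ℂ) := by
    funext z
    ext v
    rw [fderiv_apply_eq_sum]
    simp [mul_comm]
  rw [h]
  exact DifferentiableOn.fun_sum fun i _ =>
    (differentiableOn_fderiv_apply hU hf _).smul_const _

/-- The directional derivative. -/
def dirD {d : ℕ} (ζ : Z d) (f : Z d → ℂ) : Z d → ℂ := fun z => fderiv ℂ f z ζ

theorem isOpen_D (d : ℕ) : IsOpen (D d) := Metric.isOpen_ball

theorem D_mem_nhds {d : ℕ} {z : Z d} (hz : z ∈ D d) : D d ∈ 𝓝 z := (isOpen_D d).mem_nhds hz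

theorem differentiableOn_dirD {d : ℕ} {f : Z d → ℂ} (hf : DifferentiableOn ℂ f (D d)) (ζ : Z d) :
    DifferentiableOn ℂ (dirD ζ f) (D d) := differentiableOn_fderiv_apply (isOpen_D d) hf ζ

theorem differentiableOn_dirD_iterate {d : ℕ} {f : Z d → ℂ} (hf : DifferentiableOn ℂ f (D d))
    (ζ : Z d) (k : ℕ) : DifferentiableOn ℂ ((dirD ζ)^[k] f) (D d) := by
  induction k with
  | zero => exact hf
  | succ k ih => rw [Function.iterate_succ_apply']; exact differentiableOn_dirD ih ζ

theorem dirD_congr {d : ℕ} {f g : Z d → ℂ} (h : Set.EqOn f g (D d)) (ζ : Z d) :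
    Set.EqOn (dirD ζ f) (dirD ζ g) (D d) := fun z hz => by
  unfold dirD
  rw [(Filter.eventuallyEq_of_mem (D_mem_nhds hz) h).fderiv_eq]

theorem dirD_iterate_congr {d : ℕ} {f g : Z d → ℂ} (h : Set.EqOn f g (D d)) (ζ : Z d) (k : ℕ) :
    Set.EqOn ((dirD ζ)^[k] f) ((dirD ζ)^[k] g) (D d) := by
  induction k with
  | zero => exact h
  | succ k ih => simp only [Function.iterate_succ_apply']; exact dirD_congr ih ζ

theorem dirD_add {d : ℕ} {f g : Z d → ℂ} (hf : DifferentiableOn ℂ f (D d))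
    (hg : DifferentiableOn ℂ g (D d)) (ζ : Z d) :
    Set.EqOn (dirD ζ (f + g)) (dirD ζ f + dirD ζ g) (D d) := fun z hz => by
  simp [dirD, fderiv_add (hf.differentiableAt (D_mem_nhds hz))
    (hg.differentiableAt (D_mem_nhds hz))]

theorem dirD_iterate_add {d : ℕ} {f g : Z d → ℂ} (hf : DifferentiableOn ℂ f (D d))
    (hg : DifferentiableOn ℂ g (D d)) (ζ : Z d) (k : ℕ) :
    Set.EqOn ((dirD ζ)^[k] (f + g)) ((dirD ζ)^[k] f + (dirD ζ)^[k] g) (D d) := by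
  induction k with
  | zero => exact fun _ _ => rfl
  | succ k ih =>
    simp only [Function.iterate_succ_apply']
    exact (dirD_congr ih ζ).trans (dirD_add (differentiableOn_dirD_iterate hf ζ k)
      (differentiableOn_dirD_iterate hg ζ k) ζ)

theorem dirD_smul {d : ℕ} (c : ℂ) (f : Z d → ℂ) (ζ : Z d) : dirD ζ (c • f) = c • dirD ζ f := by
  funext z
  simp [dirD, fderiv_const_smul_field]

theorem dirD_iterate_smul {d : ℕ} (c : ℂ) (f : Z d → ℂ) (ζ : Z d) (k : ℕ) :
    (dirD ζ)^[k] (c • f) = c • (dirD ζ)^[k] f := by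
  induction k with
  | zero => rfl
  | succ k ih => simp only [Function.iterate_succ_apply', ih, dirD_smul]

/-- Both sides are values of the second Fréchet derivative, which is symmetric. -/
theorem dirD_comm {d : ℕ} {f : Z d → ℂ} (hf : DifferentiableOn ℂ f (D d)) (v w : Z d) :
    Set.EqOn (dirD v (dirD w f)) (dirD w (dirD v f)) (D d) := fun z hz => by
  have h2 := (differentiableOn_fderiv (isOpen_D d) hf).differentiableAt (D_mem_nhds hz)
  have key : ∀ v w : Z d, dirD v (dirD w f) z = fderiv ℂ (fderiv ℂ f) z v w := fun v w => by
    unfold dirD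
    rw [fderiv_clm_apply h2 (differentiableAt_const _)]
    simp
  rw [key, key]
  refine second_derivative_symmetric_of_eventually (f := f) (f' := fderiv ℂ f) ?_ h2.hasFDerivAt v w
  filter_upwards [D_mem_nhds hz] with y hy
  exact (hf.differentiableAt (D_mem_nhds hy)).hasFDerivAt

theorem hasDerivAt_comp_line {d : ℕ} {f : Z d → ℂ} (hf : DifferentiableOn ℂ f (D d))
    (z ζ : Z d) (t : ℂ) (ht : z + t • ζ ∈ D d) :
    HasDerivAt (fun t : ℂ => f (z + t • ζ)) (dirD ζ f (z + t • ζ)) t := by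
  have h1 : HasDerivAt (fun t : ℂ => z + t • ζ) ζ t := by
    simpa using ((hasDerivAt_id t).smul_const ζ).const_add z
  exact (hf.differentiableAt (D_mem_nhds ht)).hasFDerivAt.comp_hasDerivAt t h1

theorem dirD_eq_sum {d : ℕ} (ζ : Z d) (f : Z d → ℂ) (z : Z d) :
    dirD ζ f z = ∑ i : Fin d, ζ i * partialD i f z := by
  simp only [dirD, partialD]
  exact fderiv_apply_eq_sum f z ζ

/-- The coefficients `ζ i` are constants for the derivatives in `z`, so powers of the operator are
iterated derivatives in one fixed direction. This is the bridge to functions of one variable. -/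
theorem shiftD_iterate {d : ℕ} (Φ : Z d → Z d → ℂ) (k : ℕ) (z ζ : Z d) :
    (shiftD^[k] Φ) z ζ = (dirD ζ)^[k] (fun w => Φ w ζ) z := by
  induction k generalizing z with
  | zero => rfl
  | succ k ih =>
    rw [Function.iterate_succ_apply', Function.iterate_succ_apply', dirD_eq_sum]
    simp only [shiftD]
    have : (fun w => (shiftD^[k] Φ) w ζ) = (dirD ζ)^[k] (fun w => Φ w ζ) := funext ih
    rw [this]

/-! ### Polynomial functions -/

theorem polyFun_apply {d : ℕ} (p : MvPolynomial (Fin d) ℂ) (ζ : Z d) :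
    polyFun d p ζ = MvPolynomial.eval (fun i => ζ i) p := rfl

theorem polyFun_mul {d : ℕ} (p q : MvPolynomial (Fin d) ℂ) :
    polyFun d (p * q) = polyFun d p * polyFun d q := by
  ext ζ; simp [polyFun_apply]

theorem differentiable_polyFun {d : ℕ} (p : MvPolynomial (Fin d) ℂ) :
    Differentiable ℂ (polyFun d p) := by
  induction p using MvPolynomial.induction_on with
  | C a => 
    have : polyFun d (MvPolynomial.C a) = fun _ => a := by ext ζ; simp [polyFun_apply]
    rw [this]
    exact differentiable_const a
  | add p q hp hq => rw [map_add]; exact hp.add hq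
  | mul_X p i hp =>
    rw [polyFun_mul]
    refine hp.mul ?_
    have : polyFun d (MvPolynomial.X i) = (EuclideanSpace.proj i : Z d →L[ℂ] ℂ) := by
      ext ζ; simp [polyFun_apply]
    rw [this]
    exact ContinuousLinearMap.differentiable _

theorem homPoly_le_polyLE {d k n : ℕ} (h : k ≤ n) : homPoly d k ≤ polyLE d n := by
  apply Submodule.map_mono
  intro p hp
  rw [MvPolynomial.mem_restrictTotalDegree]
  exact ((MvPolynomial.mem_homogeneousSubmodule _ _).1 hp).totalDegree_le.trans h

theorem polyLE_mono {d k n : ℕ} (h : k ≤ n) : polyLE d k ≤ polyLE d n := by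
  apply Submodule.map_mono
  intro p hp
  rw [MvPolynomial.mem_restrictTotalDegree] at hp ⊢
  exact hp.trans h

instance finiteDimensional_polyLE (d n : ℕ) : FiniteDimensional ℂ (polyLE d n) := by
  unfold polyLE; infer_instance

instance finiteDimensional_homPoly (d n : ℕ) : FiniteDimensional ℂ (homPoly d n) :=
  Submodule.finiteDimensional_of_le (homPoly_le_polyLE le_rfl)

theorem polyLE_mul {d m n : ℕ} {φ ψ : Z d → ℂ} (hφ : φ ∈ polyLE d m) (hψ : ψ ∈ polyLE d n) :
    φ * ψ ∈ polyLE d (m + n) := by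
  obtain ⟨p, hp, rfl⟩ := hφ
  obtain ⟨q, hq, rfl⟩ := hψ
  refine ⟨p * q, ?_, polyFun_mul p q⟩
  simp only [SetLike.mem_coe, MvPolynomial.mem_restrictTotalDegree] at hp hq ⊢
  exact (MvPolynomial.totalDegree_mul p q).trans (add_le_add hp hq)

theorem homPoly_mul {d m n : ℕ} {φ ψ : Z d → ℂ} (hφ : φ ∈ homPoly d m) (hψ : ψ ∈ homPoly d n) :
    φ * ψ ∈ homPoly d (m + n) := by
  obtain ⟨p, hp, rfl⟩ := hφ
  obtain ⟨q, hq, rfl⟩ := hψ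
  exact ⟨p * q, MvPolynomial.IsHomogeneous.mul hp hq, polyFun_mul p q⟩

theorem coord_mem_homPoly {d : ℕ} (i : Fin d) : (fun ζ : Z d => ζ i) ∈ homPoly d 1 :=
  ⟨MvPolynomial.X i, MvPolynomial.isHomogeneous_X _ _, by ext; simp [polyFun_apply]⟩

theorem homPoly_smul_apply {d k : ℕ} {φ : Z d → ℂ} (hφ : φ ∈ homPoly d k) (c : ℂ) (ζ : Z d) :
    φ (c • ζ) = c ^ k * φ ζ := by
  obtain ⟨p, hp, rfl⟩ := hφ
  simp only [polyFun_apply, MvPolynomial.eval_eq]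
  rw [Finset.mul_sum]
  refine Finset.sum_congr rfl fun m hm => ?_
  have hdeg : ∑ i ∈ m.support, m i = k := by
    rw [← ((MvPolynomial.mem_homogeneousSubmodule _ _).1 hp) (MvPolynomial.mem_support_iff.1 hm)]
    simp [Finsupp.weight_apply, Finsupp.sum]
  simp only [PiLp.smul_apply, smul_eq_mul, mul_pow, Finset.prod_mul_distrib,
    Finset.prod_pow_eq_pow_sum]
  rw [hdeg]
  ring

/-- The identity theorem on the complex line through `0` and `ζ`. -/
theorem eq_zero_of_eqOn_ball {d n : ℕ} {φ : Z d → ℂ} (hφ : φ ∈ polyLE d n)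
    (h : ∀ ζ ∈ D d, φ ζ = 0) : φ = 0 := by
  obtain ⟨p, -, rfl⟩ := hφ
  funext ζ
  have hd : Differentiable ℂ (fun t : ℂ => polyFun d p (t • ζ)) :=
    (differentiable_polyFun p).comp (by fun_prop)
  have h0 : (fun t : ℂ => polyFun d p (t • ζ)) =ᶠ[𝓝 0] fun _ => 0 := by
    have hc : ContinuousAt (fun t : ℂ => t • ζ) 0 := by fun_prop
    have : ∀ᶠ t in 𝓝 (0 : ℂ), t • ζ ∈ D d := hc.eventually (by
      simp only [zero_smul]
      exact D_mem_nhds (by simp))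
    filter_upwards [this] with t ht using h _ ht
  have := AnalyticOnNhd.eq_of_eventuallyEq (fun t _ => hd.analyticAt t)
    (fun t _ => analyticAt_const) h0
  simpa using congrFun this 1

/-- Finitely many point evaluations determine the elements of a finite dimensional space of
functions. -/
theorem exists_interpolation {X : Type*} (S : Set X) (V : Submodule ℂ (X → ℂ))
    [FiniteDimensional ℂ V] (hS : ∀ v ∈ V, (∀ s ∈ S, v s = 0) → v = 0) :
    ∃ (m : ℕ) (x : Fin m → X) (e : Fin m → X → ℂ), (∀ i, x i ∈ S) ∧ (∀ i, e i ∈ V) ∧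
      ∀ v ∈ V, v = ∑ i, v (x i) • e i := by
  obtain ⟨N, hN⟩ : ∃ N, Module.finrank ℂ V = N := ⟨_, rfl⟩
  induction N using Nat.strong_induction_on generalizing V with
  | _ N ih =>
  by_cases hV : V = ⊥
  · subst hV
    refine ⟨0, Fin.elim0, Fin.elim0, fun i => i.elim0, fun i => i.elim0, fun v hv => ?_⟩
    simpa using hv
  obtain ⟨v₀, hv₀, hne⟩ := Submodule.exists_mem_ne_zero_of_ne_bot hV
  obtain ⟨s, hs, hs0⟩ : ∃ s ∈ S, v₀ s ≠ 0 := by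
    by_contra! hcon
    exact hne (hS v₀ hv₀ hcon)
  -- Induction on the dimension: the elements vanishing at `s` form a smaller space, and subtracting
  -- a multiple of `v₀` brings any `v` into it.
  set W : Submodule ℂ (X → ℂ) := V ⊓ LinearMap.ker (LinearMap.proj s : (X → ℂ) →ₗ[ℂ] ℂ) with hW
  have hlt : W < V := lt_of_le_of_ne inf_le_left fun h => hs0 (by
    have : v₀ ∈ W := h ▸ hv₀
    simpa using this.2)
  have : FiniteDimensional ℂ W := Submodule.finiteDimensional_of_le hlt.le
  obtain ⟨m, x, e, hx, he, hrep⟩ := ih _ (hN ▸ Submodule.finrank_lt_finrank_of_lt hlt) W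
    (fun v hv => hS v hv.1) rfl
  set a : X → ℂ := (v₀ s)⁻¹ • (v₀ - ∑ i, v₀ (x i) • e i) with ha
  refine ⟨m + 1, Fin.cons s x, Fin.cons a e, fun i => ?_, fun i => ?_, fun v hv => ?_⟩
  · refine Fin.cases hs (fun i => ?_) i
    simpa using hx i
  · refine Fin.cases ?_ (fun i => ?_) i
    · exact V.smul_mem _ (V.sub_mem hv₀ (V.sum_mem fun i _ => V.smul_mem _ (he i).1))
    · simpa using (he i).1
  · have hw : v - (v s * (v₀ s)⁻¹) • v₀ ∈ W :=
      ⟨V.sub_mem hv (V.smul_mem _ hv₀), by simp [hs0]⟩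
    have hr := hrep _ hw
    simp only [Pi.sub_apply, Pi.smul_apply, sub_smul, Finset.sum_sub_distrib, smul_eq_mul,
      mul_smul, ← Finset.smul_sum] at hr
    rw [Fin.sum_univ_succ]
    simp only [Fin.cons_zero, Fin.cons_succ]
    rw [ha, smul_sub, smul_sub]
    linear_combination (exp := 1) hr

/-- Interpolation separates the variables: the coefficients are point evaluations `z ↦ Φ z (x j)`,
which are holomorphic by hypothesis. -/
theorem IsHolomorphicMap.exists_sum {d : ℕ} {V : Submodule ℂ (Z d → ℂ)} [FiniteDimensional ℂ V]
    {Φ : Z d → Z d → ℂ} (h : IsHolomorphicMap V Φ) :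
    ∃ (m : ℕ) (f : Fin m → Z d → ℂ) (e : Fin m → Z d → ℂ),
      (∀ j, DifferentiableOn ℂ (f j) (D d)) ∧ (∀ j, e j ∈ V) ∧
      ∀ z ∈ D d, ∀ ζ, Φ z ζ = ∑ j, f j z * e j ζ := by
  obtain ⟨m, x, e, -, he, hrep⟩ := exists_interpolation Set.univ V
    (fun v _ hv => funext fun s => hv s trivial)
  refine ⟨m, fun j z => Φ z (x j), e, fun j => h.2 _, he, fun z hz ζ => ?_⟩
  have := congrFun (hrep _ (h.1 z hz)) ζ
  simpa using this

theorem IsHolomorphicMap.shiftD {d k : ℕ} {Φ : Z d → Z d → ℂ}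
    (h : IsHolomorphicMap (homPoly d k) Φ) :
    IsHolomorphicMap (homPoly d (k + 1)) (BallBundle.shiftD Φ) := by
  obtain ⟨m, f, e, hf, he, hΦ⟩ := h.exists_sum
  refine ⟨fun z hz => ?_, fun ζ => ?_⟩
  · have : BallBundle.shiftD Φ z = ∑ j, ∑ i, partialD i (f j) z • ((fun ζ : Z d => ζ i) * e j) := by
      funext ζ
      have h1 := dirD_congr (f := fun w => Φ w ζ) (fun w hw => hΦ w hw ζ) ζ hz
      rw [dirD_eq_sum] at h1
      refine h1.trans ?_
      have h2 : fderiv ℂ (fun w => ∑ j, f j w * e j ζ) z = ∑ j, e j ζ • fderiv ℂ (f j) z := by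
        rw [fderiv_fun_sum fun j _ => ((hf j).differentiableAt (D_mem_nhds hz)).mul_const _]
        refine Finset.sum_congr rfl fun j _ => ?_
        rw [fderiv_mul_const ((hf j).differentiableAt (D_mem_nhds hz))]
      simp only [dirD, h2, sum_apply, Finset.sum_apply, Pi.smul_apply,
        Pi.mul_apply, smul_apply, smul_eq_mul]
      refine Finset.sum_congr rfl fun j _ => ?_
      rw [fderiv_apply_eq_sum, Finset.mul_sum]
      refine Finset.sum_congr rfl fun i _ => ?_
      simp only [partialD]; ring
    rw [this]
    refine Submodule.sum_mem _ fun j _ => Submodule.sum_mem _ fun i _ => Submodule.smul_mem _ _ ?_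
    rw [add_comm]
    exact homPoly_mul (coord_mem_homPoly i) (he j)
  · have : (fun z => BallBundle.shiftD Φ z ζ) = dirD ζ (fun w => Φ w ζ) := by
      funext z; rw [dirD_eq_sum]; rfl
    rw [this]
    exact differentiableOn_dirD (h.2 ζ) ζ

theorem IsHolomorphicMap.shiftD_iterate {d l : ℕ} {Φ : Z d → Z d → ℂ}
    (h : IsHolomorphicMap (homPoly d l) Φ) (k : ℕ) :
    IsHolomorphicMap (homPoly d (l + k)) (BallBundle.shiftD^[k] Φ) := by
  induction k with
  | zero => exact h
  | succ k ih => rw [Function.iterate_succ_apply']; exact ih.shiftD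

theorem IsHolomorphicMap.continuousOn {d n : ℕ} {Φ : Z d → Z d → ℂ}
    (h : IsHolomorphicMap (homPoly d n) Φ) :
    ContinuousOn (fun x : Z d × Z d => Φ x.1 x.2) (D d ×ˢ Set.univ) := by
  obtain ⟨m, f, e, hf, he, hΦ⟩ := h.exists_sum
  refine ContinuousOn.congr (f := fun x : Z d × Z d => ∑ j, f j x.1 * e j x.2) ?_
    fun x hx => hΦ x.1 hx.1 x.2
  refine continuousOn_finsetSum _ fun j _ => ContinuousOn.mul ?_ ?_
  · exact (hf j).continuousOn.comp continuousOn_fst fun x hx => hx.1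
  · obtain ⟨p, -, hp⟩ := he j
    rw [← hp]
    exact ((differentiable_polyFun p).continuous.comp continuous_snd).continuousOn

theorem IsHolomorphicMap.comp_smul {d n : ℕ} {Φ : Z d → Z d → ℂ}
    (h : IsHolomorphicMap (homPoly d n) Φ) {z : Z d} (hz : z ∈ D d) (c : ℂ) (ζ : Z d) :
    Φ z (c • ζ) = c ^ n * Φ z ζ := homPoly_smul_apply (h.1 z hz) c ζ

theorem isHolomorphicMap_ballOp {d l n : ℕ} (hl : l ≤ n) (ν : ℝ) {Φ : Z d → Z d → ℂ}
    (h : IsHolomorphicMap (homPoly d l) Φ) :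
    IsHolomorphicMap (polyLE d n) (ballOp ν l n Φ) := by
  refine ⟨fun z hz => ?_, fun ζ => ?_⟩
  · have : ballOp ν l n Φ z = ∑ k ∈ Finset.range (n - l + 1),
        (poch ((l : ℂ) - n) k / poch (2 * (l : ℂ) + ν) k / (k.factorial : ℂ)) •
          (BallBundle.shiftD^[k] Φ) z := by
      funext ζ
      simp only [ballOp, Finset.sum_apply, Pi.smul_apply, smul_eq_mul]
      exact Finset.sum_congr rfl fun k _ => by ring
    rw [this]
    refine Submodule.sum_mem _ fun k hk => Submodule.smul_mem _ _ ?_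
    rw [Finset.mem_range] at hk
    exact homPoly_le_polyLE (by omega) ((h.shiftD_iterate k).1 z hz)
  · simp only [ballOp, div_eq_mul_inv]
    exact DifferentiableOn.fun_sum fun k _ =>
      (((h.shiftD_iterate k).2 ζ).mul_const _).const_mul _

theorem ballOp_add {d l n : ℕ} (ν : ℝ) {V : Submodule ℂ (Z d → ℂ)} {Φ Ψ : Z d → Z d → ℂ}
    (hΦ : IsHolomorphicMap V Φ) (hΨ : IsHolomorphicMap V Ψ) {z : Z d} (hz : z ∈ D d) :
    ballOp ν l n (Φ + Ψ) z = ballOp ν l n Φ z + ballOp ν l n Ψ z := by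
  funext ζ
  simp only [ballOp, Pi.add_apply, ← Finset.sum_add_distrib]
  refine Finset.sum_congr rfl fun k _ => ?_
  simp only [shiftD_iterate]
  have := dirD_iterate_add (hΦ.2 ζ) (hΨ.2 ζ) ζ k hz
  rw [Pi.add_apply] at this
  rw [← mul_add, ← add_div, ← this]
  rfl

theorem ballOp_smul {d l n : ℕ} (ν : ℝ) (c : ℂ) (Φ : Z d → Z d → ℂ) (z : Z d) :
    ballOp ν l n (c • Φ) z = c • ballOp ν l n Φ z := by
  funext ζ
  simp only [ballOp, Pi.smul_apply, smul_eq_mul, Finset.mul_sum]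
  refine Finset.sum_congr rfl fun k _ => ?_
  simp only [shiftD_iterate]
  have := congrFun (dirD_iterate_smul c (fun w => Φ w ζ) ζ k) z
  rw [Pi.smul_apply, smul_eq_mul] at this
  have h' : (dirD ζ)^[k] (fun w => (c • Φ) w ζ) z = c * (dirD ζ)^[k] (fun w => Φ w ζ) z := this
  rw [h']
  ring

/-! ### Gaussian moments and the Fischer-Fock inner product -/

theorem norm_gauss_monomial (a b : ℕ) (z : ℂ) :
    ‖((Real.exp (-‖z‖ ^ 2) / Real.pi : ℝ) : ℂ) * (starRingEnd ℂ z ^ a * z ^ b)‖ =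
      Real.pi⁻¹ * (‖z‖ ^ ((a + b : ℕ) : ℝ) * Real.exp (-‖z‖ ^ (2 : ℝ))) := by
  rw [norm_mul, norm_mul, norm_pow, norm_pow, Complex.norm_conj, Complex.norm_real,
    Real.norm_of_nonneg (by positivity), Real.rpow_natCast, pow_add]
  norm_num
  ring

theorem integral_gauss_norm (k : ℕ) :
    ∫ z : ℂ, Real.pi⁻¹ * (‖z‖ ^ (k : ℝ) * Real.exp (-‖z‖ ^ (2 : ℝ))) =
      Real.Gamma ((k + 2) / 2) := by
  rw [integral_const_mul, Complex.integral_rpow_mul_exp_neg_rpow one_le_two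
    (by linarith [(Nat.cast_nonneg k : (0 : ℝ) ≤ k)])]
  have := Real.pi_ne_zero
  field_simp

theorem integrable_gauss_monomial (a b : ℕ) :
    Integrable fun z : ℂ =>
      ((Real.exp (-‖z‖ ^ 2) / Real.pi : ℝ) : ℂ) * (starRingEnd ℂ z ^ a * z ^ b) := by
  have hc : Continuous fun z : ℂ =>
      ((Real.exp (-‖z‖ ^ 2) / Real.pi : ℝ) : ℂ) * (starRingEnd ℂ z ^ a * z ^ b) := by
    have h : Continuous fun z : ℂ => starRingEnd ℂ z := Complex.continuous_conj
    fun_prop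
  refine (integrable_norm_iff hc.aestronglyMeasurable).1 ?_
  simp only [norm_gauss_monomial]
  -- A non-integrable function has Bochner integral `0`, whereas the closed formula gives a positive
  -- Gamma value.
  by_contra hcon
  have h1 := integral_gauss_norm (a + b)
  rw [integral_undef hcon] at h1
  exact (Real.Gamma_pos_of_pos (by positivity)).ne h1

theorem integral_gauss_monomial (a b : ℕ) :
    ∫ z : ℂ, ((Real.exp (-‖z‖ ^ 2) / Real.pi : ℝ) : ℂ) * (starRingEnd ℂ z ^ a * z ^ b) =
      if a = b then (a.factorial : ℂ) else 0 := by
  split_ifs with hab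
  · subst hab
    have h : ∀ z : ℂ, ((Real.exp (-‖z‖ ^ 2) / Real.pi : ℝ) : ℂ) * (starRingEnd ℂ z ^ a * z ^ a) =
        ((Real.pi⁻¹ * (‖z‖ ^ ((a + a : ℕ) : ℝ) * Real.exp (-‖z‖ ^ (2 : ℝ))) : ℝ) : ℂ) := by
      intro z
      rw [← mul_pow, Complex.conj_mul', Real.rpow_natCast, ← two_mul, pow_mul]
      norm_num
      ring
    simp only [h]
    rw [integral_complex_ofReal, integral_gauss_norm]
    have : (((a + a : ℕ) : ℝ) + 2) / 2 = a + 1 := by push_cast; ring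
    rw [this, Real.Gamma_nat_eq_factorial]
    simp
  · -- rotate by an angle which is not resonant
    set c : ℂ := Complex.exp (Complex.I) with hc
    have hcn : ‖c‖ = 1 := by simp [hc, Complex.norm_exp]
    set I := ∫ z : ℂ, ((Real.exp (-‖z‖ ^ 2) / Real.pi : ℝ) : ℂ) * (starRingEnd ℂ z ^ a * z ^ b)
    let u : Circle := ⟨c, by simp [Submonoid.unitSphere, hcn]⟩
    have h1 : ∫ z : ℂ, ((Real.exp (-‖rotation u z‖ ^ 2) / Real.pi : ℝ) : ℂ) *
        (starRingEnd ℂ (rotation u z) ^ a * (rotation u z) ^ b) = I :=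
      (rotation u).measurePreserving.integral_comp
        (rotation u).toHomeomorph.measurableEmbedding
        (fun z => ((Real.exp (-‖z‖ ^ 2) / Real.pi : ℝ) : ℂ) * (starRingEnd ℂ z ^ a * z ^ b))
    have h2 : (starRingEnd ℂ c ^ a * c ^ b) * I = I := by
      conv_rhs => rw [← h1]
      rw [← integral_const_mul]
      refine integral_congr_ae (Filter.Eventually.of_forall fun z => ?_)
      beta_reduce
      rw [LinearIsometryEquiv.norm_map]
      simp only [rotation_apply, map_mul, mul_pow]
      change _ = _ * ((starRingEnd ℂ c) ^ a * _ * (c ^ b * _))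
      ring
    -- The rotation is by one radian, so equality for `a ≠ b` would make `π` rational.
    have h3 : starRingEnd ℂ c ^ a * c ^ b ≠ 1 := by
      have : starRingEnd ℂ c ^ a * c ^ b = Complex.exp (((b : ℝ) - a : ℝ) * Complex.I) := by
        rw [hc, ← Complex.exp_conj, ← Complex.exp_nat_mul, ← Complex.exp_nat_mul,
          ← Complex.exp_add]
        congr 1
        push_cast
        rw [Complex.conj_I]; ring
      rw [this]
      intro h
      obtain ⟨n, hn⟩ := Complex.exp_eq_one_iff.1 h
      have hn' : ((b : ℝ) - a) = n * (2 * Real.pi) := by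
        have : (((b : ℝ) - a : ℝ) : ℂ) = ((n * (2 * Real.pi) : ℝ) : ℂ) := by
          have hI := Complex.I_ne_zero
          apply mul_right_cancel₀ hI
          rw [hn]; push_cast; ring
        exact_mod_cast this
      have hn0 : n ≠ 0 := by
        rintro rfl
        apply hab
        have : (b : ℝ) = a := by simpa [sub_eq_zero] using hn'
        exact_mod_cast this.symm
      refine irrational_pi ⟨((b : ℚ) - a) / (2 * n), ?_⟩
      have : (n : ℝ) ≠ 0 := by exact_mod_cast hn0
      push_cast
      rw [hn']
      field_simp
    have h4 : (starRingEnd ℂ c ^ a * c ^ b - 1) * I = 0 := by rw [sub_mul, h2]; ring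
    exact (mul_eq_zero.1 h4).resolve_left (sub_ne_zero.2 h3)

/-- Lebesgue measure on the Hermitian space and the product measure are both Haar measures, hence
proportional. -/
theorem exists_integral_eq_pi (d : ℕ) : ∃ c : ℝ, ∀ F : (Fin d → ℂ) → ℂ,
    (Integrable F → Integrable fun ω : Z d => F ω) ∧
    ∫ ω : Z d, F ω = c * ∫ x, F x := by
  let e : Z d ≃L[ℝ] (Fin d → ℂ) := PiLp.continuousLinearEquiv 2 ℝ fun _ : Fin d => ℂ
  have he : MeasurableEmbedding e := e.toHomeomorph.measurableEmbedding
  have : ((volume : Measure (Z d)).map e).IsAddHaarMeasure := e.isAddHaarMeasure_map volume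
  have hm := Measure.isAddLeftInvariant_eq_smul ((volume : Measure (Z d)).map e) volume
  refine ⟨Measure.addHaarScalarFactor ((volume : Measure (Z d)).map e) volume, fun F => ⟨?_, ?_⟩⟩
  · intro hF
    have h1 : Integrable F ((volume : Measure (Z d)).map e) := by
      rw [hm]
      exact hF.smul_measure_nnreal
    exact (he.integrable_map_iff).1 h1
  · have h1 : ∫ ω : Z d, F (e ω) = _ := (he.integral_map (μ := volume) F).symm
    rw [hm, integral_smul_nnreal_measure] at h1
    exact h1

theorem gauss_eq_prod {d : ℕ} (ω : Z d) :
    ((Real.exp (-‖ω‖ ^ 2) / Real.pi ^ d : ℝ) : ℂ) =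
      ∏ i, ((Real.exp (-‖ω i‖ ^ 2) / Real.pi : ℝ) : ℂ) := by
  rw [← Complex.ofReal_prod, Finset.prod_div_distrib, EuclideanSpace.norm_sq_eq,
    ← Finset.sum_neg_distrib, Real.exp_sum]
  simp

theorem integral_gauss (d : ℕ) :
    ∫ ω : Z d, ((Real.exp (-‖ω‖ ^ 2) / Real.pi ^ d : ℝ) : ℂ) = 1 := by
  have h := GaussianFourier.integral_rexp_neg_mul_sq_norm (V := Z d) one_pos
  have hr : Module.finrank ℝ (Z d) = 2 * d := by
    rw [← Module.finrank_mul_finrank ℝ ℂ (Z d)]; simp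
  rw [integral_complex_ofReal, integral_div]
  simp only [neg_mul, one_mul, div_one] at h
  rw [h, hr]
  have : (((2 * d : ℕ) : ℝ) / 2) = d := by push_cast; ring
  rw [this, Real.rpow_natCast, div_self (by positivity)]
  simp

/-- The proportionality constant is found by testing on the normalised Gaussian, which has integral
one for both measures. -/
theorem integral_eq_pi (d : ℕ) (F : (Fin d → ℂ) → ℂ) :
    (Integrable F → Integrable fun ω : Z d => F ω) ∧ ∫ ω : Z d, F ω = ∫ x, F x := by
  obtain ⟨c, hc⟩ := exists_integral_eq_pi d
  have h1 := (hc fun x => ∏ i, ((Real.exp (-‖x i‖ ^ 2) / Real.pi : ℝ) : ℂ)).2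
  have h2 : ∫ z : ℂ, ((Real.exp (-‖z‖ ^ 2) / Real.pi : ℝ) : ℂ) = 1 := by
    simpa using integral_gauss_monomial 0 0
  rw [volume_pi, integral_fintype_prod_eq_prod
    (fun _ (z : ℂ) => ((Real.exp (-‖z‖ ^ 2) / Real.pi : ℝ) : ℂ))] at h1
  simp only [← gauss_eq_prod, integral_gauss, h2, Finset.prod_const_one, mul_one] at h1
  refine ⟨(hc F).1, ?_⟩
  rw [(hc F).2, ← h1, one_mul]

theorem polyFun_monomial {d : ℕ} (m : Fin d →₀ ℕ) (a : ℂ) (ω : Z d) :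
    polyFun d (MvPolynomial.monomial m a) ω = a * ∏ i, ω i ^ m i := by
  rw [polyFun_apply, MvPolynomial.eval_monomial, Finsupp.prod_fintype _ _ (by simp)]

theorem fischer_integrand_monomial {d : ℕ} (m m' : Fin d →₀ ℕ) (a b : ℂ) (ω : Z d) :
    ((Real.exp (-‖ω‖ ^ 2) / Real.pi ^ d : ℝ) : ℂ) *
      (starRingEnd ℂ (polyFun d (MvPolynomial.monomial m a) ω) *
        polyFun d (MvPolynomial.monomial m' b) ω) =
      starRingEnd ℂ a * b * ∏ i, (((Real.exp (-‖ω i‖ ^ 2) / Real.pi : ℝ) : ℂ) *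
        (starRingEnd ℂ (ω i) ^ m i * ω i ^ m' i)) := by
  rw [gauss_eq_prod, polyFun_monomial, polyFun_monomial, map_mul, map_prod,
    Finset.prod_mul_distrib, Finset.prod_mul_distrib]
  simp only [map_pow]
  ring

theorem integrable_fischer {d : ℕ} (p q : MvPolynomial (Fin d) ℂ) :
    Integrable fun ω : Z d => ((Real.exp (-‖ω‖ ^ 2) / Real.pi ^ d : ℝ) : ℂ) *
      (starRingEnd ℂ (polyFun d p ω) * polyFun d q ω) := by
  induction p using MvPolynomial.induction_on' with
  | monomial m a =>
    induction q using MvPolynomial.induction_on' with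
    | monomial m' b =>
      simp only [fischer_integrand_monomial]
      refine Integrable.const_mul ((integral_eq_pi d fun x => ∏ i,
        (((Real.exp (-‖x i‖ ^ 2) / Real.pi : ℝ) : ℂ) *
          (starRingEnd ℂ (x i) ^ m i * x i ^ m' i))).1 ?_) _
      exact Integrable.fintype_prod (f := fun i (z : ℂ) =>
        ((Real.exp (-‖z‖ ^ 2) / Real.pi : ℝ) : ℂ) * (starRingEnd ℂ z ^ m i * z ^ m' i))
        fun i => integrable_gauss_monomial _ _
    | add q₁ q₂ h₁ h₂ =>
      refine (h₁.add h₂).congr (Filter.Eventually.of_forall fun ω => ?_)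
      simp only [map_add, Pi.add_apply, mul_add]
  | add p₁ p₂ h₁ h₂ =>
    refine (h₁.add h₂).congr (Filter.Eventually.of_forall fun ω => ?_)
    simp only [map_add, Pi.add_apply, mul_add, add_mul]

theorem fischer_monomial {d : ℕ} (m m' : Fin d →₀ ℕ) (a b : ℂ) :
    fischer (polyFun d (MvPolynomial.monomial m a)) (polyFun d (MvPolynomial.monomial m' b)) =
      if m = m' then starRingEnd ℂ a * b * ∏ i, ((m i).factorial : ℂ) else 0 := by
  unfold fischer
  simp only [fischer_integrand_monomial]
  rw [integral_const_mul, (integral_eq_pi d fun x => ∏ i,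
        (((Real.exp (-‖x i‖ ^ 2) / Real.pi : ℝ) : ℂ) *
          (starRingEnd ℂ (x i) ^ m i * x i ^ m' i))).2, volume_pi, integral_fintype_prod_eq_prod
        (fun i (z : ℂ) =>
        ((Real.exp (-‖z‖ ^ 2) / Real.pi : ℝ) : ℂ) * (starRingEnd ℂ z ^ m i * z ^ m' i))]
  simp only [integral_gauss_monomial]
  split_ifs with h
  · subst h; simp
  · obtain ⟨i, hi⟩ : ∃ i, m i ≠ m' i := by
      by_contra! hcon
      exact h (Finsupp.ext hcon)
    rw [Finset.prod_eq_zero (Finset.mem_univ i) (by simp [hi]), mul_zero]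

/-- The Fischer-Fock inner product as a sesquilinear form on polynomials. -/
def fischerForm (d : ℕ) :
    MvPolynomial (Fin d) ℂ →ₗ⋆[ℂ] MvPolynomial (Fin d) ℂ →ₗ[ℂ] ℂ :=
  LinearMap.mk₂'ₛₗ (starRingEnd ℂ) (RingHom.id ℂ)
    (fun p q => fischer (polyFun d p) (polyFun d q))
    (fun p₁ p₂ q => by
      unfold fischer
      rw [← integral_add (integrable_fischer p₁ q) (integrable_fischer p₂ q)]
      simp only [map_add, Pi.add_apply, mul_add, add_mul])
    (fun c p q => by
      unfold fischer
      rw [smul_eq_mul, ← integral_const_mul]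
      simp only [map_smul, Pi.smul_apply, smul_eq_mul, map_mul]
      congr 1; funext ω; ring)
    (fun p q₁ q₂ => by
      unfold fischer
      rw [← integral_add (integrable_fischer p q₁) (integrable_fischer p q₂)]
      simp only [map_add, Pi.add_apply, mul_add])
    (fun c p q => by
      unfold fischer
      rw [smul_eq_mul, ← integral_const_mul]
      simp only [map_smul, Pi.smul_apply, smul_eq_mul, RingHom.id_apply]
      congr 1; funext ω; ring)

/-! ### Adjoints for the Fischer-Fock form. -/

theorem fischerForm_apply {d : ℕ} (p q : MvPolynomial (Fin d) ℂ) :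
    fischerForm d p q = fischer (polyFun d p) (polyFun d q) := rfl

/-- On monomials, which are orthogonal with squared norms `m!`, the identity is `m! = m_i (m -
e_i)!`. -/
theorem fischerForm_mul_X {d : ℕ} (i : Fin d) (p q : MvPolynomial (Fin d) ℂ) :
    fischerForm d p (q * MvPolynomial.X i) = fischerForm d (MvPolynomial.pderiv i p) q := by
  induction p using MvPolynomial.induction_on' with
  | add p₁ p₂ h₁ h₂ => simp only [map_add, LinearMap.add_apply, h₁, h₂]
  | monomial m a =>
    induction q using MvPolynomial.induction_on' with
    | add q₁ q₂ h₁ h₂ => simp only [map_add, add_mul, h₁, h₂]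
    | monomial m' b =>
      rw [MvPolynomial.X, MvPolynomial.monomial_mul, MvPolynomial.pderiv_monomial,
        fischerForm_apply, fischerForm_apply, fischer_monomial, fischer_monomial, mul_one]
      by_cases h0 : m i = 0
      · rw [if_neg (fun h => by rw [h] at h0; simp at h0)]
        simp [h0]
      · by_cases h : m = m' + Finsupp.single i 1
        · rw [if_pos h, if_pos (by rw [h]; simp)]
          have h1 : ∏ j, ((m j).factorial : ℂ) =
              m i * ∏ j, (((m - Finsupp.single i 1 : Fin d →₀ ℕ) j).factorial : ℂ) := by
            rw [← Finset.mul_prod_erase _ _ (Finset.mem_univ i),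
              ← Finset.mul_prod_erase _ _ (Finset.mem_univ i), ← mul_assoc]
            congr 1
            · simp only [Finsupp.coe_tsub, Pi.sub_apply, Finsupp.single_eq_same]
              rw [← Nat.mul_factorial_pred h0]; push_cast; rfl
            · refine Finset.prod_congr rfl fun j hj => ?_
              simp [Finsupp.single_eq_of_ne (Finset.ne_of_mem_erase hj)]
          rw [h1]
          simp only [map_mul, Complex.conj_natCast]
          ring
        · rw [if_neg h, if_neg]
          intro h'
          apply h
          rw [← h']
          ext j
          by_cases hj : j = i
          · subst hj; simp; omega
          · simp [Finsupp.single_eq_of_ne hj]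

theorem fischerForm_C {d : ℕ} (p : MvPolynomial (Fin d) ℂ) (a : ℂ) :
    fischerForm d p (MvPolynomial.C a) = starRingEnd ℂ (MvPolynomial.eval 0 p) * a := by
  induction p using MvPolynomial.induction_on' with
  | add p₁ p₂ h₁ h₂ => simp only [map_add, LinearMap.add_apply, h₁, h₂, add_mul]
  | monomial m b =>
    rw [MvPolynomial.C_apply, fischerForm_apply, fischer_monomial, MvPolynomial.eval_monomial]
    split_ifs with h
    · subst h; simp
    · obtain ⟨i, hi⟩ : ∃ i, m i ≠ 0 := by
        by_contra! hcon
        exact h (Finsupp.ext hcon)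
      rw [Finsupp.prod, Finset.prod_eq_zero (i := i) (by simpa using hi) (by simp [hi])]
      simp

/-- Substitution of a linear map, given by its matrix, into a polynomial. -/
def linSubst {d : ℕ} (A : Matrix (Fin d) (Fin d) ℂ) :
    MvPolynomial (Fin d) ℂ →ₐ[ℂ] MvPolynomial (Fin d) ℂ :=
  MvPolynomial.aeval fun i => ∑ j, MvPolynomial.C (A i j) * MvPolynomial.X j

theorem eval_linSubst {d : ℕ} (A : Matrix (Fin d) (Fin d) ℂ) (p : MvPolynomial (Fin d) ℂ)
    (x : Fin d → ℂ) :
    MvPolynomial.eval x (linSubst A p) = MvPolynomial.eval (A.mulVec x) p := by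
  induction p using MvPolynomial.induction_on with
  | C a => simp [linSubst]
  | add p q hp hq => simp only [map_add, hp, hq]
  | mul_X p i hp =>
    rw [map_mul, map_mul, map_mul, hp]
    congr 1
    simp [linSubst, Matrix.mulVec, dotProduct]

theorem pderiv_linSubst {d : ℕ} (A : Matrix (Fin d) (Fin d) ℂ) (i : Fin d)
    (p : MvPolynomial (Fin d) ℂ) :
    MvPolynomial.pderiv i (linSubst A p) =
      ∑ j, A j i • linSubst A (MvPolynomial.pderiv j p) := by
  induction p using MvPolynomial.induction_on with
  | C a => simp [linSubst]
  | add p q hp hq => simp only [map_add, hp, hq, smul_add, Finset.sum_add_distrib]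
  | mul_X p k hp =>
    have hX : MvPolynomial.pderiv i (linSubst A (MvPolynomial.X k)) = MvPolynomial.C (A k i) := by
      simp [linSubst, MvPolynomial.pderiv_X, Pi.single_apply]
    simp only [map_mul, Derivation.leibniz, hp, hX, map_add, smul_eq_mul, smul_add,
      Finset.sum_add_distrib, MvPolynomial.pderiv_X]
    congr 1
    · simp [Pi.single_apply, MvPolynomial.smul_eq_C_mul]
      ring
    · rw [Finset.mul_sum]
      refine Finset.sum_congr rfl fun j _ => ?_
      rw [mul_smul_comm]

/-- Induction on `q`, one variable at a time: the substituted variable `∑ A i j X_j` has adjoint `∑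
conj (A i j) ∂_j`, which is what the chain rule produces when `∂_i` is applied after substituting
the conjugate transpose. -/
theorem fischerForm_linSubst {d : ℕ} (A : Matrix (Fin d) (Fin d) ℂ)
    (p q : MvPolynomial (Fin d) ℂ) :
    fischerForm d p (linSubst A q) = fischerForm d (linSubst A.conjTranspose p) q := by
  induction q using MvPolynomial.induction_on generalizing p with
  | C a =>
    have : linSubst A (MvPolynomial.C a) = MvPolynomial.C a := by simp [linSubst]
    rw [this, fischerForm_C, fischerForm_C, eval_linSubst, Matrix.mulVec_zero]
  | add q₁ q₂ h₁ h₂ => simp only [map_add, h₁, h₂]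
  | mul_X q i hq =>
    have hX : linSubst A (MvPolynomial.X i) = ∑ j, A i j • MvPolynomial.X j := by
      simp [linSubst, MvPolynomial.smul_eq_C_mul]
    rw [map_mul, hX, Finset.mul_sum, map_sum, fischerForm_mul_X, pderiv_linSubst, map_sum,
      LinearMap.sum_apply]
    refine Finset.sum_congr rfl fun j _ => ?_
    rw [mul_smul_comm, map_smul, fischerForm_mul_X, hq]
    simp

/-- The reproducing property up to `k!`. The `k`-th power is `X_{i₀}^k` after a rank one
substitution whose only non-zero row is the conjugate of `ζ`; the adjoint substitution turns `p`
into `p(ζ) X_{i₀}^k`, and `X_{i₀}^k` has squared norm `k!`. Any coordinate can serve as `i₀`. -/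
theorem fischerForm_pow {d k : ℕ} (ζ : Fin d → ℂ) (i₀ : Fin d) {p : MvPolynomial (Fin d) ℂ}
    (hp : p.IsHomogeneous k) :
    fischerForm d p ((∑ i, MvPolynomial.C (starRingEnd ℂ (ζ i)) * MvPolynomial.X i) ^ k) =
      k.factorial * starRingEnd ℂ (MvPolynomial.eval ζ p) := by
  set A : Matrix (Fin d) (Fin d) ℂ :=
    Matrix.of fun i j => if i = i₀ then starRingEnd ℂ (ζ j) else 0 with hA
  have h1 : (∑ i, MvPolynomial.C (starRingEnd ℂ (ζ i)) * MvPolynomial.X i) ^ k =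
      linSubst A (MvPolynomial.X i₀ ^ k) := by
    simp [linSubst, hA]
  have h2 : linSubst A.conjTranspose p =
      MvPolynomial.monomial (Finsupp.single i₀ k) (MvPolynomial.eval ζ p) := by
    have hs : ∀ i, ∑ j, MvPolynomial.C (A.conjTranspose i j) * MvPolynomial.X j =
        MvPolynomial.C (ζ i) * (MvPolynomial.X i₀ : MvPolynomial (Fin d) ℂ) := by
      intro i
      rw [Finset.sum_eq_single i₀]
      · simp [hA]
      · intro j _ hj; simp [hA, hj]
      · simp
    rw [linSubst, MvPolynomial.aeval_def, MvPolynomial.eval₂_eq]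
    simp only [hs, MvPolynomial.algebraMap_eq]
    rw [MvPolynomial.eval_eq, map_sum]
    refine Finset.sum_congr rfl fun m hm => ?_
    have hdeg : ∑ i ∈ m.support, m i = k := by
      rw [← hp (MvPolynomial.mem_support_iff.1 hm)]
      simp [Finsupp.weight_apply, Finsupp.sum]
    simp only [mul_pow, Finset.prod_mul_distrib, Finset.prod_pow_eq_pow_sum]
    rw [hdeg, ← MvPolynomial.C_mul_X_pow_eq_monomial, map_mul, map_prod]
    simp only [map_pow, mul_assoc]
  rw [h1, fischerForm_linSubst, h2, fischerForm_apply, ← MvPolynomial.C_mul_X_pow_eq_monomial,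
    MvPolynomial.X_pow_eq_monomial, MvPolynomial.C_mul_monomial, fischer_monomial, if_pos rfl,
    Finset.prod_eq_single i₀]
  · simp; ring
  · intro j _ hj; simp [Finsupp.single_eq_of_ne hj]
  · simp

/-! ### The three forms of the operator -/

/-- This is `E^k(ζ,w) = (ζ|w)^k / k!` at the level of symbols: expand `(·|ζ)^k` in the orthonormal
basis, where `fischerForm_pow` gives the coefficients, and conjugate. -/
theorem sum_kernel_eq {d k : ℕ} (hd : 1 ≤ d) {b : Finset (MvPolynomial (Fin d) ℂ)}
    (hb : IsFischerBasis d k b) (ζ : Fin d → ℂ) :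
    ∑ p ∈ b, MvPolynomial.eval ζ p • MvPolynomial.map (starRingEnd ℂ) p =
      (k.factorial : ℂ)⁻¹ • (∑ i, MvPolynomial.C (ζ i) * MvPolynomial.X i) ^ k := by
  set q : MvPolynomial (Fin d) ℂ :=
    (∑ i, MvPolynomial.C (starRingEnd ℂ (ζ i)) * MvPolynomial.X i) ^ k with hq
  have hqh : q ∈ MvPolynomial.homogeneousSubmodule (Fin d) ℂ k := by
    rw [MvPolynomial.mem_homogeneousSubmodule, hq]
    have h1 : (∑ i, MvPolynomial.C (starRingEnd ℂ (ζ i)) * MvPolynomial.X i :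
        MvPolynomial (Fin d) ℂ).IsHomogeneous 1 :=
      MvPolynomial.IsHomogeneous.sum _ _ _ fun i _ => MvPolynomial.isHomogeneous_C_mul_X _ _
    simpa using h1.pow k
  rw [← hb.span, Submodule.mem_span_finset] at hqh
  obtain ⟨c, -, hc⟩ := hqh
  have hcp : ∀ p ∈ b, c p = k.factorial * starRingEnd ℂ (MvPolynomial.eval ζ p) := by
    intro p hp
    have hph : p.IsHomogeneous k := by
      rw [← MvPolynomial.mem_homogeneousSubmodule, ← hb.span]
      exact Submodule.subset_span hp
    rw [← fischerForm_pow ζ ⟨0, hd⟩ hph, ← hq, ← hc, map_sum, Finset.sum_eq_single p]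
    · rw [map_smul, fischerForm_apply, (hb.orthonormal p hp).1]; simp
    · intro p' hp' hne
      rw [map_smul, fischerForm_apply, (hb.orthonormal p hp).2 p' hp' hne.symm, smul_zero]
    · exact fun h => absurd hp h
  have hmap : MvPolynomial.map (starRingEnd ℂ) q =
      (∑ i, MvPolynomial.C (ζ i) * MvPolynomial.X i) ^ k := by
    simp [hq]
  rw [← hmap, ← hc, map_sum, Finset.smul_sum]
  refine Finset.sum_congr rfl fun p hp => ?_
  have hk : (k.factorial : ℂ) ≠ 0 := by exact_mod_cast k.factorial_ne_zero
  rw [hcp p hp, MvPolynomial.smul_eq_C_mul, MvPolynomial.smul_eq_C_mul, MvPolynomial.smul_eq_C_mul,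
    map_mul (MvPolynomial.map (starRingEnd ℂ)), MvPolynomial.map_C, ← mul_assoc, ← map_mul]
  congr 2
  simp only [map_mul, Complex.conj_natCast, Complex.conj_conj]
  field_simp

/-! ### Symbol calculus of constant coefficient operators. -/

theorem differentiableOn_partialD_iterate {d : ℕ} {f : Z d → ℂ}
    (hf : DifferentiableOn ℂ f (D d)) (i : Fin d) (k : ℕ) :
    DifferentiableOn ℂ ((partialD i)^[k] f) (D d) :=
  differentiableOn_dirD_iterate hf (EuclideanSpace.single i 1) k

theorem partialD_iterate_comm {d : ℕ} {f : Z d → ℂ} (hf : DifferentiableOn ℂ f (D d))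
    (i j : Fin d) (k : ℕ) :
    Set.EqOn ((partialD j)^[k] (partialD i f)) (partialD i ((partialD j)^[k] f)) (D d) := by
  induction k with
  | zero => exact fun _ _ => rfl
  | succ k ih =>
    simp only [Function.iterate_succ_apply']
    exact (dirD_congr ih _).trans (dirD_comm (differentiableOn_partialD_iterate hf j k) _ _)

theorem differentiableOn_foldr_partialD {d : ℕ} {f : Z d → ℂ} (hf : DifferentiableOn ℂ f (D d))
    (m : Fin d →₀ ℕ) (L : List (Fin d)) :
    DifferentiableOn ℂ (L.foldr (fun i h => (partialD i)^[m i] h) f) (D d) := by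
  induction L with
  | nil => exact hf
  | cons j L ih => exact differentiableOn_partialD_iterate ih j _

/-- The list has no repetitions, so the extra derivative appears at most once; it is commuted
outwards past the partial derivatives that precede it in the list. -/
theorem foldr_partialD_add_single {d : ℕ} {f : Z d → ℂ} (hf : DifferentiableOn ℂ f (D d))
    (m : Fin d →₀ ℕ) (i : Fin d) (L : List (Fin d)) (hL : L.Nodup) :
    (i ∉ L → L.foldr (fun j h => (partialD j)^[(m + Finsupp.single i 1 : Fin d →₀ ℕ) j] h) f =
      L.foldr (fun j h => (partialD j)^[m j] h) f) ∧
    (i ∈ L → Set.EqOn (L.foldr (fun j h => (partialD j)^[(m + Finsupp.single i 1 : Fin d →₀ ℕ) j] h) f)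
      (partialD i (L.foldr (fun j h => (partialD j)^[m j] h) f)) (D d)) := by
  induction L with
  | nil => simp
  | cons j L ih =>
    have ih := ih (List.nodup_cons.1 hL).2
    refine ⟨fun h => ?_, fun h => ?_⟩
    · rw [List.mem_cons, not_or] at h
      rw [List.foldr_cons, List.foldr_cons, ih.1 h.2]
      simp [Finsupp.single_eq_of_ne (Ne.symm h.1)]
    · rw [List.foldr_cons, List.foldr_cons]
      by_cases hij : i = j
      · subst hij
        rw [ih.1 (List.nodup_cons.1 hL).1]
        simp only [Finsupp.add_apply, Finsupp.single_eq_same, Function.iterate_succ_apply']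
        exact fun _ _ => rfl
      · have hi : i ∈ L := (List.mem_cons.1 h).resolve_left hij
        have hm : (m + Finsupp.single i 1 : Fin d →₀ ℕ) j = m j := by
          simp [Finsupp.single_eq_of_ne (Ne.symm hij)]
        rw [hm]
        exact (dirD_iterate_congr (ih.2 hi) _ _).trans
          (partialD_iterate_comm (differentiableOn_foldr_partialD hf m L) i j _)

theorem differentiableOn_multiD {d : ℕ} {f : Z d → ℂ} (hf : DifferentiableOn ℂ f (D d))
    (m : Fin d →₀ ℕ) : DifferentiableOn ℂ (multiD m f) (D d) :=
  differentiableOn_foldr_partialD hf m _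

theorem multiD_add_single {d : ℕ} {f : Z d → ℂ} (hf : DifferentiableOn ℂ f (D d))
    (m : Fin d →₀ ℕ) (i : Fin d) :
    Set.EqOn (multiD (m + Finsupp.single i 1) f) (partialD i (multiD m f)) (D d) :=
  (foldr_partialD_add_single hf m i _ (List.nodup_finRange d)).2 (List.mem_finRange i)

/-- `q ↦ q(∂)f(z)` as a linear map. -/
def constCoeffLin {d : ℕ} (f : Z d → ℂ) (z : Z d) : MvPolynomial (Fin d) ℂ →ₗ[ℂ] ℂ :=
  (MvPolynomial.basisMonomials (Fin d) ℂ).constr ℂ fun m => multiD m f z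

theorem constCoeffLin_monomial {d : ℕ} (f : Z d → ℂ) (z : Z d) (m : Fin d →₀ ℕ) (a : ℂ) :
    constCoeffLin f z (MvPolynomial.monomial m a) = a * multiD m f z := by
  have h : MvPolynomial.monomial m a = a • MvPolynomial.basisMonomials (Fin d) ℂ m := by
    rw [MvPolynomial.coe_basisMonomials, MvPolynomial.smul_monomial, smul_eq_mul, mul_one]
  rw [h, map_smul, constCoeffLin, Module.Basis.constr_basis, smul_eq_mul]

theorem constCoeffOp_eq {d : ℕ} (q : MvPolynomial (Fin d) ℂ) (f : Z d → ℂ) (z : Z d) :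
    constCoeffOp q f z = constCoeffLin f z q := by
  conv_rhs => rw [q.as_sum, map_sum]
  simp only [constCoeffLin_monomial]
  rfl

theorem differentiableOn_constCoeffLin {d : ℕ} {f : Z d → ℂ} (hf : DifferentiableOn ℂ f (D d))
    (q : MvPolynomial (Fin d) ℂ) : DifferentiableOn ℂ (fun z => constCoeffLin f z q) (D d) := by
  simp only [← constCoeffOp_eq]
  exact DifferentiableOn.fun_sum fun m _ => (differentiableOn_multiD hf m).const_mul _

/-- By linearity the symbol may be a monomial, and there `multiD_add_single` applies to each
variable of the linear form. -/
theorem constCoeffLin_mul_linear {d : ℕ} {f : Z d → ℂ} (hf : DifferentiableOn ℂ f (D d))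
    (ζ : Z d) (q : MvPolynomial (Fin d) ℂ) :
    Set.EqOn (fun z => constCoeffLin f z (q * ∑ i, MvPolynomial.C (ζ i) * MvPolynomial.X i))
      (dirD ζ fun z => constCoeffLin f z q) (D d) := by
  induction q using MvPolynomial.induction_on' with
  | add p q hp hq =>
    intro z hz
    have hp' := hp hz
    have hq' := hq hz
    have h := dirD_add (differentiableOn_constCoeffLin hf p)
      (differentiableOn_constCoeffLin hf q) ζ hz
    simp only [add_mul, map_add] at hp' hq' ⊢
    rw [hp', hq']
    exact h.symm
  | monomial m a =>
    intro z hz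
    have h : (fun z => constCoeffLin f z (MvPolynomial.monomial m a)) = a • multiD m f := by
      funext w; exact constCoeffLin_monomial f w m a
    rw [h, dirD_smul, Pi.smul_apply, dirD_eq_sum]
    simp only [Finset.mul_sum, map_sum, Finset.smul_sum]
    refine Finset.sum_congr rfl fun i _ => ?_
    rw [MvPolynomial.C_mul_X_eq_monomial, MvPolynomial.monomial_mul, constCoeffLin_monomial,
      multiD_add_single hf m i hz, smul_eq_mul, mul_assoc]

theorem constCoeffLin_linear_pow {d : ℕ} {f : Z d → ℂ} (hf : DifferentiableOn ℂ f (D d))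
    (ζ : Z d) (k : ℕ) :
    Set.EqOn (fun z => constCoeffLin f z ((∑ i, MvPolynomial.C (ζ i) * MvPolynomial.X i) ^ k))
      ((dirD ζ)^[k] f) (D d) := by
  induction k with
  | zero =>
    intro z _
    have h1 : (1 : MvPolynomial (Fin d) ℂ) = MvPolynomial.monomial 0 1 := rfl
    have h2 : ∀ L : List (Fin d), L.foldr (fun i h => (partialD i)^[(0 : Fin d →₀ ℕ) i] h) f = f :=
      fun L => by induction L with
        | nil => rfl
        | cons j L => simp
    simp only [pow_zero, h1, constCoeffLin_monomial, one_mul, multiD, h2]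
    rfl
  | succ k ih =>
    simp only [pow_succ]
    rw [Function.iterate_succ_apply']
    exact (constCoeffLin_mul_linear hf ζ _).trans (dirD_congr ih ζ)

theorem kernelOp_eq {d k : ℕ} (hd : 1 ≤ d) {b : Finset (MvPolynomial (Fin d) ℂ)}
    (hb : IsFischerBasis d k b) {V : Submodule ℂ (Z d → ℂ)} {Φ : Z d → Z d → ℂ}
    (hΦ : IsHolomorphicMap V Φ) {z : Z d} (hz : z ∈ D d) (ζ : Z d) :
    kernelOp b Φ z ζ = (shiftD^[k] Φ) z ζ / (k.factorial : ℂ) := by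
  have h := congrArg (constCoeffLin (fun w => Φ w ζ) z) (sum_kernel_eq hd hb fun i => ζ i)
  rw [map_sum, map_smul] at h
  have h2 := constCoeffLin_linear_pow (hΦ.2 ζ) ζ k hz
  simp only at h2
  rw [h2] at h
  rw [shiftD_iterate, div_eq_inv_mul, ← smul_eq_mul, ← h]
  unfold kernelOp
  refine Finset.sum_congr rfl fun p _ => ?_
  rw [map_smul, smul_eq_mul, constCoeffOp_eq]
  rfl

theorem ballOpKernel_eq {d l n : ℕ} (hd : 1 ≤ d) (ν : ℝ) {V : Submodule ℂ (Z d → ℂ)}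
    {Φ : Z d → Z d → ℂ} (hΦ : IsHolomorphicMap V Φ) {z : Z d} (hz : z ∈ D d) (ζ : Z d)
    {b : ℕ → Finset (MvPolynomial (Fin d) ℂ)} (hb : ∀ k, IsFischerBasis d k (b k)) :
    ballOpKernel ν l n b Φ z ζ = ballOp ν l n Φ z ζ :=
  Finset.sum_congr rfl fun k _ => by rw [kernelOp_eq hd (hb k) hΦ hz ζ]

theorem poch_neg_div_factorial {l n k : ℕ} (hl : l ≤ n) :
    poch ((l : ℂ) - n) k / (k.factorial : ℂ) = (-1) ^ k * ((n - l).choose k : ℂ) := by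
  have h1 : (l : ℂ) - n = -((n - l : ℕ) : ℂ) := by push_cast [hl]; ring
  rw [poch, h1, ascPochhammer_eval_neg_eq_descPochhammer, descPochhammer_eval_eq_descFactorial,
    Nat.descFactorial_eq_factorial_mul_choose]
  have hk : (k.factorial : ℂ) ≠ 0 := by exact_mod_cast k.factorial_ne_zero
  push_cast
  field_simp

theorem ballOpBinom_eq {d l n : ℕ} (hl : l ≤ n) (ν : ℝ) (Φ : Z d → Z d → ℂ) (z ζ : Z d) :
    ballOpBinom ν l n Φ z ζ = ballOp ν l n Φ z ζ :=
  Finset.sum_congr rfl fun k _ => by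
    have := poch_neg_div_factorial (k := k) hl
    calc _ = (-1) ^ k * ((n - l).choose k : ℂ) / poch (2 * (l : ℂ) + ν) k * (shiftD^[k] Φ) z ζ := by
          ring
      _ = _ := by rw [← this]; ring

/-! ### Automorphisms of the ball -/

theorem norm_lt_one_of_mem {d : ℕ} {z : Z d} (hz : z ∈ D d) : ‖z‖ < 1 := by simpa using hz

/-- The scalar `√(1 - (x|x))`. -/
def defect {d : ℕ} (x : Z d) : ℝ := Real.sqrt (1 - ‖x‖ ^ 2)

theorem defect_pos {d : ℕ} {x : Z d} (hx : x ∈ D d) : 0 < defect x := by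
  have := norm_lt_one_of_mem hx
  exact Real.sqrt_pos.2 (by nlinarith [norm_nonneg x])

theorem defect_sq {d : ℕ} {x : Z d} (hx : x ∈ D d) : defect x ^ 2 = 1 - ‖x‖ ^ 2 := by
  have := norm_lt_one_of_mem hx
  exact Real.sq_sqrt (by nlinarith [norm_nonneg x])

theorem one_add_defect_ne_zero {d : ℕ} (x : Z d) : (1 + (defect x : ℂ)) ≠ 0 := by
  have : (1 + defect x) ≠ 0 := by unfold defect; positivity
  exact_mod_cast this

theorem inner_self_eq_defect {d : ℕ} {x : Z d} (hx : x ∈ D d) :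
    inner ℂ x x = 1 - (defect x : ℂ) ^ 2 := by
  rw [inner_self_eq_norm_sq_to_K]
  have h : ((‖x‖ ^ 2 : ℝ) : ℂ) = ((1 - defect x ^ 2 : ℝ) : ℂ) := by
    rw [defect_sq hx]; norm_num
  simpa using h

theorem bergmanSqrt_eq {d : ℕ} (x ζ : Z d) :
    bergmanSqrt x ζ = (defect x : ℂ) • (ζ - (inner ℂ x ζ / (1 + (defect x : ℂ))) • x) := rfl

/-- `B_{x,x}^{1/2}` as a linear map. -/
def bergmanSqrtL {d : ℕ} (x : Z d) : Z d →L[ℂ] Z d :=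
  LinearMap.toContinuousLinearMap
  { toFun := bergmanSqrt x
    map_add' := fun u v => by
      simp only [bergmanSqrt_eq, inner_add_right, add_div, add_smul]
      module
    map_smul' := fun c u => by
      simp only [bergmanSqrt_eq, inner_smul_right, RingHom.id_apply, mul_div_assoc, mul_smul]
      module }

@[simp] theorem bergmanSqrtL_apply {d : ℕ} (x ζ : Z d) : bergmanSqrtL x ζ = bergmanSqrt x ζ := rfl

theorem bergmanSqrt_smul {d : ℕ} (x : Z d) (c : ℂ) (ζ : Z d) :
    bergmanSqrt x (c • ζ) = c • bergmanSqrt x ζ := (bergmanSqrtL x).map_smul c ζ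

theorem bergmanSqrt_neg_left {d : ℕ} (x ζ : Z d) : bergmanSqrt (-x) ζ = bergmanSqrt x ζ := by
  simp [bergmanSqrt_eq, defect, neg_div]

theorem inner_bergmanSqrt_left {d : ℕ} (x v w : Z d) :
    inner ℂ (bergmanSqrt x v) w = inner ℂ v (bergmanSqrt x w) := by
  simp only [bergmanSqrt_eq, inner_smul_left, inner_smul_right, inner_sub_left, inner_sub_right,
    map_div₀, map_add, map_one, Complex.conj_ofReal, inner_conj_symm]
  ring

theorem bergmanSqrt_self {d : ℕ} {x : Z d} (hx : x ∈ D d) :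
    bergmanSqrt x x = ((defect x : ℂ) ^ 2) • x := by
  have h := one_add_defect_ne_zero x
  rw [bergmanSqrt_eq, inner_self_eq_defect hx]
  match_scalars
  field_simp
  ring

theorem bergman_self_apply {d : ℕ} {x : Z d} (hx : x ∈ D d) (ζ : Z d) :
    bergman x x ζ = ((defect x : ℂ) ^ 2) • (ζ - inner ℂ x ζ • x) := by
  rw [bergman_apply, quasiDet, sp, inner_self_eq_defect hx, sub_sub_cancel]
  rfl

theorem inner_bergmanSqrt_bergmanSqrt {d : ℕ} {x : Z d} (hx : x ∈ D d) (v w : Z d) :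
    inner ℂ (bergmanSqrt x v) (bergmanSqrt x w) =
      (defect x : ℂ) ^ 2 * (inner ℂ v w - inner ℂ x w * inner ℂ v x) := by
  rw [inner_bergmanSqrt_left, bergmanSqrt_bergmanSqrt x w hx, bergman_self_apply hx]
  simp only [inner_smul_right, inner_sub_right]

theorem inner_bergmanSqrt_right_self {d : ℕ} {x : Z d} (hx : x ∈ D d) (v : Z d) :
    inner ℂ x (bergmanSqrt x v) = (defect x : ℂ) ^ 2 * inner ℂ x v := by
  rw [← inner_bergmanSqrt_left, bergmanSqrt_self hx, inner_smul_left]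
  simp

/-- The transvection of the ball which moves `0` to `a`. -/
def transv {d : ℕ} (a z : Z d) : Z d := a + (1 + inner ℂ a z)⁻¹ • bergmanSqrt a z

theorem one_add_inner_ne_zero {d : ℕ} {a z : Z d} (ha : a ∈ D d) (hz : z ∈ D d) :
    1 + inner ℂ a z ≠ 0 := by
  intro h
  have h1 : ‖inner ℂ a z‖ = 1 := by
    rw [eq_neg_of_add_eq_zero_right h]; simp
  have h2 := norm_inner_le_norm (𝕜 := ℂ) a z
  nlinarith [norm_lt_one_of_mem ha, norm_lt_one_of_mem hz, norm_nonneg a, norm_nonneg z]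

theorem neg_mem_D {d : ℕ} {a : Z d} (ha : a ∈ D d) : -a ∈ D d := by simpa using ha

/-- With `j = 1 + (z|a)`, the numerator satisfies `‖j a + B_{a,a}^{1/2} z‖² = |j|² -
(1-‖a‖²)(1-‖z‖²)`, which is less than `|j|²`. -/
theorem transv_mem {d : ℕ} {a z : Z d} (ha : a ∈ D d) (hz : z ∈ D d) : transv a z ∈ D d := by
  have hj := one_add_inner_ne_zero ha hz
  set j := 1 + inner ℂ a z with hj'
  have hs := defect_pos ha
  have e1 : transv a z = j⁻¹ • (j • a + bergmanSqrt a z) := by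
    rw [smul_add, smul_smul, inv_mul_cancel₀ hj, one_smul, transv]
  have hconj : inner ℂ z a = starRingEnd ℂ (inner ℂ a z) := (inner_conj_symm z a).symm
  have e2 : inner ℂ (j • a + bergmanSqrt a z) (j • a + bergmanSqrt a z) =
      starRingEnd ℂ j * j - (defect a : ℂ) ^ 2 * (1 - inner ℂ z z) := by
    simp only [inner_add_left, inner_add_right, inner_smul_left, inner_smul_right,
      inner_bergmanSqrt_bergmanSqrt ha, inner_bergmanSqrt_right_self ha, inner_self_eq_defect ha,
      inner_bergmanSqrt_left, bergmanSqrt_self ha, hconj, hj', map_add, map_one]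
    ring
  have e3 : ‖j • a + bergmanSqrt a z‖ ^ 2 = ‖j‖ ^ 2 - defect a ^ 2 * (1 - ‖z‖ ^ 2) := by
    have : ((‖j • a + bergmanSqrt a z‖ ^ 2 : ℝ) : ℂ) =
        ((‖j‖ ^ 2 - defect a ^ 2 * (1 - ‖z‖ ^ 2) : ℝ) : ℂ) := by
      have h1 : ∀ v : Z d, ((‖v‖ ^ 2 : ℝ) : ℂ) = inner ℂ v v := fun v => by
        rw [inner_self_eq_norm_sq_to_K]; norm_cast
      rw [h1, e2, ← h1, Complex.conj_mul']
      push_cast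
      ring
    exact_mod_cast this
  have hz1 := norm_lt_one_of_mem hz
  have hj0 : 0 < ‖j‖ := norm_pos_iff.2 hj
  have hlt : ‖j • a + bergmanSqrt a z‖ < ‖j‖ := by
    refine lt_of_pow_lt_pow_left₀ 2 hj0.le ?_
    rw [e3]
    have : 0 < defect a ^ 2 * (1 - ‖z‖ ^ 2) := by
      have : 0 < 1 - ‖z‖ ^ 2 := by nlinarith [norm_nonneg z]
      positivity
    linarith
  rw [mem_ball_zero_iff, e1, norm_smul, norm_inv, inv_mul_lt_iff₀ hj0, mul_one]
  exact hlt

/-- For `z' = transv (-a) z`, the denominator `1 + (z'|a)` equals `(1-‖a‖²)/(1-(z|a))`, and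
`B_{a,a}^{1/2} z'` is the same scalar times `z - a`. -/
theorem transv_transv_neg {d : ℕ} {a z : Z d} (ha : a ∈ D d) (hz : z ∈ D d) :
    transv a (transv (-a) z) = z := by
  have hj : 1 - inner ℂ a z ≠ 0 := by
    simpa [sub_eq_add_neg] using one_add_inner_ne_zero (neg_mem_D ha) hz
  have hs : (defect a : ℂ) ≠ 0 := by exact_mod_cast (defect_pos ha).ne'
  have e0 : transv (-a) z = -a + (1 - inner ℂ a z)⁻¹ • bergmanSqrt a z := by
    rw [transv, bergmanSqrt_neg_left, inner_neg_left, sub_eq_add_neg]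
  have e1 : 1 + inner ℂ a (transv (-a) z) = (defect a : ℂ) ^ 2 * (1 - inner ℂ a z)⁻¹ := by
    rw [e0, inner_add_right, inner_neg_right, inner_smul_right, inner_bergmanSqrt_right_self ha,
      inner_self_eq_defect ha]
    field_simp
    ring
  have e2 : bergmanSqrt a (transv (-a) z) =
      ((defect a : ℂ) ^ 2 * (1 - inner ℂ a z)⁻¹) • (z - a) := by
    have : bergmanSqrt a (transv (-a) z) =
        -bergmanSqrt a a + (1 - inner ℂ a z)⁻¹ • bergmanSqrt a (bergmanSqrt a z) := by
      rw [e0, ← bergmanSqrtL_apply, map_add, map_neg, map_smul]; rfl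
    rw [this, bergmanSqrt_self ha, bergmanSqrt_bergmanSqrt a z ha, bergman_self_apply ha]
    have h1 : (1 : ℂ) = (1 - inner ℂ a z)⁻¹ * (1 - inner ℂ a z) := (inv_mul_cancel₀ hj).symm
    match_scalars
    · field_simp; ring
    · ring
  rw [transv, e1, e2, smul_smul, inv_mul_cancel₀ (mul_ne_zero (pow_ne_zero 2 hs) (inv_ne_zero hj)),
    one_smul]
  abel

theorem transv_zero {d : ℕ} (a : Z d) : transv a 0 = a := by
  have : bergmanSqrt a 0 = 0 := (bergmanSqrtL a).map_zero
  simp [transv, this]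

theorem hasFDerivAt_transv {d : ℕ} {a z : Z d} (hj : 1 + inner ℂ a z ≠ 0) :
    HasFDerivAt (transv a) ((1 + inner ℂ a z)⁻¹ • (bergmanSqrtL a -
      ((1 + inner ℂ a z)⁻¹ • innerSL ℂ a).smulRight (bergmanSqrt a z))) z := by
  have h1 : HasFDerivAt (fun z : Z d => 1 + inner ℂ a z) (innerSL ℂ a) z :=
    (innerSL ℂ a).hasFDerivAt.const_add 1
  have h2 := (((hasDerivAt_inv hj).comp_hasFDerivAt z h1).smul
    (bergmanSqrtL a).hasFDerivAt).const_add a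
  refine h2.congr_fderiv ?_
  ext1 ζ
  simp
  match_scalars
  · ring
  · field_simp

theorem differentiableOn_transv {d : ℕ} {a : Z d} (ha : a ∈ D d) :
    DifferentiableOn ℂ (transv a) (D d) := fun _ hz =>
  (hasFDerivAt_transv (one_add_inner_ne_zero ha hz)).differentiableAt.differentiableWithinAt

/-- A biholomorphic automorphism of the ball which fixes the origin is linear. -/
theorem eq_fderiv_of_mapsTo {d : ℕ} {h k : Z d → Z d} (hh : DifferentiableOn ℂ h (D d))
    (hk : DifferentiableOn ℂ k (D d)) (hm : Set.MapsTo h (D d) (D d))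
    (km : Set.MapsTo k (D d) (D d)) (h0 : h 0 = 0) (k0 : k 0 = 0)
    (hkh : ∀ z ∈ D d, k (h z) = z) :
    ∃ U : Z d →L[ℂ] Z d, (∀ z, ‖U z‖ = ‖z‖) ∧ ∀ z ∈ D d, h z = U z := by
  -- Schwarz's lemma, applied to `h` and to its left inverse `k`, shows that `h` preserves norms.
  have hle : ∀ {f : Z d → Z d}, DifferentiableOn ℂ f (D d) → Set.MapsTo f (D d) (D d) → f 0 = 0 →
      ∀ z ∈ D d, ‖f z‖ ≤ ‖z‖ := fun hf hm h0 z hz =>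
    Complex.norm_le_norm_of_mapsTo_ball hf
      (fun z hz => Metric.ball_subset_closedBall (hm hz)) h0 (norm_lt_one_of_mem hz)
  have hnorm : ∀ z ∈ D d, ‖h z‖ = ‖z‖ := fun z hz =>
    le_antisymm (hle hh hm h0 z hz) (by
      have := hle hk km k0 (h z) (hm hz)
      rwa [hkh z hz] at this)
  have h0D : (0 : Z d) ∈ D d := by simp
  have hunit : ∀ e : Z d, ‖e‖ = 1 → ∀ t : ℂ, ‖t‖ < 1 → h (t • e) = t • fderiv ℂ h 0 e := by
    intro e he
    have hmem : ∀ t : ℂ, ‖t‖ < 1 → t • e ∈ D d := fun t ht => by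
      simpa [norm_smul, he] using ht
    set f : ℂ → Z d := fun t => h (t • e) with hf
    have f0 : f 0 = 0 := by simp [hf, h0]
    have hfd : DifferentiableOn ℂ f (Metric.ball 0 1) :=
      hh.comp (by fun_prop) fun t ht => hmem t (by simpa using ht)
    have hfm : Set.MapsTo f (Metric.ball 0 1) (Metric.closedBall (f 0) 1) := by
      intro t ht
      rw [f0]
      exact Metric.ball_subset_closedBall (hm (hmem t (by simpa using ht)))
    have hhalf : ‖(1 / 2 : ℂ)‖ = 1 / 2 := by norm_num
    -- Norm preservation gives equality in Schwarz's lemma on the line through `e`, and this forces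
    -- `f` to be linear there. The point `1/2` is an arbitrary non-zero choice.
    have hds : ‖dslope f 0 (1 / 2)‖ = 1 / 1 := by
      rw [dslope_of_ne _ (by norm_num), slope_def_module, f0, sub_zero, sub_zero, norm_smul,
        norm_inv, hhalf, hf]
      simp only
      rw [hnorm _ (hmem _ (by rw [hhalf]; norm_num)), norm_smul, hhalf, he]
      norm_num
    have haff := Complex.affine_of_mapsTo_ball_of_norm_dslope_eq_div hfd hfm
      (by rw [mem_ball_zero_iff, hhalf]; norm_num) hds
    set C := dslope f 0 (1 / 2)
    have haff' : ∀ t : ℂ, ‖t‖ < 1 → f t = t • C := fun t ht => by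
      have := haff (show t ∈ Metric.ball (0 : ℂ) 1 by simpa using ht)
      simpa [f0] using this
    have hderiv1 : HasDerivAt f (fderiv ℂ h 0 e) 0 := by
      have h1 : HasDerivAt (fun t : ℂ => t • e) e 0 := by
        simpa using (hasDerivAt_id (0 : ℂ)).smul_const e
      have h2 : HasFDerivAt h (fderiv ℂ h 0) ((0 : ℂ) • e) := by
        simpa using (hh.differentiableAt (D_mem_nhds h0D)).hasFDerivAt
      exact h2.comp_hasDerivAt 0 h1
    have hderiv2 : HasDerivAt f C 0 := by
      have h1 : HasDerivAt (fun t : ℂ => t • C) C 0 := by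
        simpa using (hasDerivAt_id (0 : ℂ)).smul_const C
      refine h1.congr_of_eventuallyEq ?_
      filter_upwards [Metric.ball_mem_nhds (0 : ℂ) one_pos] with t ht
      exact haff' t (by simpa using ht)
    rw [hderiv1.unique hderiv2]
    exact haff'
  have hlin : ∀ z ∈ D d, h z = fderiv ℂ h 0 z := by
    intro z hz
    by_cases hz0 : z = 0
    · subst hz0; simp [h0]
    have hn : (‖z‖ : ℂ) ≠ 0 := by exact_mod_cast norm_ne_zero_iff.2 hz0
    have he : z = (‖z‖ : ℂ) • ((‖z‖ : ℂ)⁻¹ • z) := by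
      rw [smul_smul, mul_inv_cancel₀ hn, one_smul]
    have := hunit ((‖z‖ : ℂ)⁻¹ • z) (by
      rw [norm_smul, norm_inv, Complex.norm_real, norm_norm]
      exact inv_mul_cancel₀ (norm_ne_zero_iff.2 hz0)) (‖z‖ : ℂ)
      (by simpa using norm_lt_one_of_mem hz)
    rw [← map_smul, ← he] at this
    exact this
  refine ⟨fderiv ℂ h 0, fun z => ?_, hlin⟩
  set c : ℝ := (2 * (‖z‖ + 1))⁻¹ with hc
  have hc0 : 0 < c := by positivity
  have hcz : (c : ℂ) • z ∈ D d := by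
    rw [mem_ball_zero_iff, norm_smul, Complex.norm_real, Real.norm_of_nonneg hc0.le, hc,
      inv_mul_lt_iff₀ (by positivity)]
    linarith [norm_nonneg z]
  have h1 := hnorm _ hcz
  rw [hlin _ hcz, map_smul, norm_smul, norm_smul] at h1
  refine mul_left_cancel₀ ?_ h1
  simpa using hc0.ne'

/-- With `a = g(0)`, the map `transv (-a) ∘ g` fixes the origin, so it is the restriction of a
linear isometry. -/
theorem BallAut.exists_eq_transv {d : ℕ} (g : BallAut d) :
    ∃ a ∈ D d, ∃ U : Z d →L[ℂ] Z d, (∀ z, ‖U z‖ = ‖z‖) ∧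
      ∀ z ∈ D d, g.toFun z = transv a (U z) := by
  have h0D : (0 : Z d) ∈ D d := by simp
  set a := g.toFun 0 with ha'
  have ha : a ∈ D d := g.mapsTo h0D
  have htt : ∀ z ∈ D d, transv (-a) (transv a z) = z := fun z hz => by
    simpa using transv_transv_neg (neg_mem_D ha) hz
  have hta : transv (-a) a = 0 := by
    have := htt 0 h0D
    rwa [transv_zero] at this
  obtain ⟨U, hU, hUeq⟩ := eq_fderiv_of_mapsTo (h := transv (-a) ∘ g.toFun)
    (k := g.invFun ∘ transv a)
    ((differentiableOn_transv (neg_mem_D ha)).comp g.holo g.mapsTo)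
    (g.holo_inv.comp (differentiableOn_transv ha) fun z hz => transv_mem ha hz)
    (fun z hz => transv_mem (neg_mem_D ha) (g.mapsTo hz))
    (fun z hz => g.mapsTo_inv (transv_mem ha hz))
    hta (by
      simp only [Function.comp, transv_zero]
      exact g.left_inv h0D)
    (fun z hz => by
      simp only [Function.comp]
      rw [transv_transv_neg ha (g.mapsTo hz)]
      exact g.left_inv hz)
  refine ⟨a, ha, U, hU, fun z hz => ?_⟩
  rw [← hUeq z hz]
  exact (transv_transv_neg ha (g.mapsTo hz)).symm

/-- The denominator of the fractional linear map `z ↦ transv a (U z)`. -/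
def denom {d : ℕ} (a : Z d) (U : Z d →L[ℂ] Z d) (z : Z d) : ℂ := 1 + inner ℂ a (U z)

/-! ### Derivative, increments and Jacobian of an automorphism. -/

theorem isometry_mem {d : ℕ} {U : Z d →L[ℂ] Z d} (hU : ∀ z, ‖U z‖ = ‖z‖) {z : Z d}
    (hz : z ∈ D d) : U z ∈ D d := by
  rw [mem_ball_zero_iff, hU]; exact norm_lt_one_of_mem hz

theorem denom_ne_zero {d : ℕ} {a : Z d} {U : Z d →L[ℂ] Z d} (ha : a ∈ D d)
    (hU : ∀ z, ‖U z‖ = ‖z‖) {z : Z d} (hz : z ∈ D d) : denom a U z ≠ 0 :=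
  one_add_inner_ne_zero ha (isometry_mem hU hz)

theorem hasFDerivAt_of_eq_transv {d : ℕ} {f : Z d → Z d} {a : Z d} {U : Z d →L[ℂ] Z d}
    (ha : a ∈ D d) (hU : ∀ z, ‖U z‖ = ‖z‖) (hf : ∀ z ∈ D d, f z = transv a (U z)) {z : Z d}
    (hz : z ∈ D d) :
    HasFDerivAt f (((denom a U z)⁻¹ • (bergmanSqrtL a -
      ((denom a U z)⁻¹ • innerSL ℂ a).smulRight (bergmanSqrt a (U z)))).comp U) z := by
  refine HasFDerivAt.congr_of_eventuallyEq ?_ (Filter.eventuallyEq_of_mem (D_mem_nhds hz) hf)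
  exact (hasFDerivAt_transv (denom_ne_zero ha hU hz)).comp z U.hasFDerivAt

theorem fderiv_of_eq_transv {d : ℕ} {f : Z d → Z d} {a : Z d} {U : Z d →L[ℂ] Z d}
    (ha : a ∈ D d) (hU : ∀ z, ‖U z‖ = ‖z‖) (hf : ∀ z ∈ D d, f z = transv a (U z)) {z : Z d}
    (hz : z ∈ D d) (ζ : Z d) :
    fderiv ℂ f z ζ = (denom a U z)⁻¹ • bergmanSqrt a (U ζ) -
      ((denom a U z)⁻¹ ^ 2 * inner ℂ a (U ζ)) • bergmanSqrt a (U z) := by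
  rw [(hasFDerivAt_of_eq_transv ha hU hf hz).fderiv]
  simp
  module

theorem denom_add {d : ℕ} (a : Z d) (U : Z d →L[ℂ] Z d) (z ζ : Z d) :
    denom a U (z + ζ) = denom a U z + inner ℂ a (U ζ) := by
  simp [denom, add_assoc]

theorem sub_eq_smul_fderiv {d : ℕ} {f : Z d → Z d} {a : Z d} {U : Z d →L[ℂ] Z d}
    (ha : a ∈ D d) (hU : ∀ z, ‖U z‖ = ‖z‖) (hf : ∀ z ∈ D d, f z = transv a (U z)) {z ζ : Z d}
    (hz : z ∈ D d) (hzζ : z + ζ ∈ D d) :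
    f (z + ζ) - f z = (denom a U z / denom a U (z + ζ)) • fderiv ℂ f z ζ := by
  have h1 := denom_ne_zero ha hU hz
  have h2 := denom_ne_zero ha hU hzζ
  rw [hf _ hz, hf _ hzζ, fderiv_of_eq_transv ha hU hf hz]
  have e : ∀ w, transv a (U w) = a + (denom a U w)⁻¹ • bergmanSqrtL a (U w) := fun w => rfl
  rw [e, e, map_add, map_add]
  simp only [bergmanSqrtL_apply]
  have h3 : inner ℂ a (U ζ) = denom a U (z + ζ) - denom a U z := by rw [denom_add]; ring
  rw [h3]
  match_scalars
  · ring
  · field_simp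
    ring
  · field_simp

theorem fderiv_add_smul {d : ℕ} {f : Z d → Z d} {a : Z d} {U : Z d →L[ℂ] Z d}
    (ha : a ∈ D d) (hU : ∀ z, ‖U z‖ = ‖z‖) (hf : ∀ z ∈ D d, f z = transv a (U z)) {z ζ : Z d}
    {t : ℂ} (hz : z ∈ D d) (hzζ : z + t • ζ ∈ D d) :
    fderiv ℂ f (z + t • ζ) ζ =
      (denom a U z / denom a U (z + t • ζ)) ^ 2 • fderiv ℂ f z ζ := by
  have h1 := denom_ne_zero ha hU hz
  have h2 := denom_ne_zero ha hU hzζ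
  rw [fderiv_of_eq_transv ha hU hf hz, fderiv_of_eq_transv ha hU hf hzζ]
  have e : bergmanSqrt a (U (z + t • ζ)) = bergmanSqrt a (U z) + t • bergmanSqrt a (U ζ) := by
    rw [map_add, map_smul, ← bergmanSqrtL_apply, map_add, map_smul]; rfl
  have h3 : t * inner ℂ a (U ζ) = denom a U (z + t • ζ) - denom a U z := by
    rw [denom_add, map_smul, inner_smul_right]; ring
  rw [e]
  match_scalars
  · field_simp
    linear_combination (-1 : ℂ) * h3
  · field_simp

/-- The derivative is `j⁻¹ B_{a,a}^{1/2} T U` with `T` a transvection of determinant `j⁻¹`; the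
scalar contributes `j^{-d}`. -/
theorem det_fderiv_of_eq_transv {d : ℕ} {f : Z d → Z d} {a : Z d} {U : Z d →L[ℂ] Z d}
    (ha : a ∈ D d) (hU : ∀ z, ‖U z‖ = ‖z‖) (hf : ∀ z ∈ D d, f z = transv a (U z)) {z : Z d}
    (hz : z ∈ D d) :
    (fderiv ℂ f z).det * denom a U z ^ (d + 1) = (bergmanSqrtL a).det * U.det := by
  have h1 := denom_ne_zero ha hU hz
  have e : ((fderiv ℂ f z : Z d →L[ℂ] Z d) : Z d →ₗ[ℂ] Z d) =
      (denom a U z)⁻¹ • ((bergmanSqrtL a : Z d →ₗ[ℂ] Z d) ∘ₗ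
        LinearMap.transvection (-((denom a U z)⁻¹ • (innerSL ℂ a : Z d →ₗ[ℂ] ℂ))) (U z) ∘ₗ
        (U : Z d →ₗ[ℂ] Z d)) := by
    ext1 ζ
    simp only [ContinuousLinearMap.coe_coe, fderiv_of_eq_transv ha hU hf hz, LinearMap.smul_apply,
      LinearMap.comp_apply, LinearMap.transvection.apply, LinearMap.neg_apply, map_add, map_smul,
      bergmanSqrtL_apply, innerSL_apply_apply, smul_eq_mul]
    module
  rw [ContinuousLinearMap.det, e, LinearMap.det_smul, LinearMap.det_comp, LinearMap.det_comp,
    LinearMap.transvection.det, finrank_euclideanSpace_fin]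
  have h2 : 1 + (-((denom a U z)⁻¹ • (innerSL ℂ a : Z d →ₗ[ℂ] ℂ))) (U z) = (denom a U z)⁻¹ := by
    simp only [LinearMap.neg_apply, LinearMap.smul_apply, ContinuousLinearMap.coe_coe,
      innerSL_apply_apply, smul_eq_mul]
    have : inner ℂ a (U z) = denom a U z - 1 := by simp [denom]
    rw [this]
    field_simp
    ring
  rw [h2, ContinuousLinearMap.det, ContinuousLinearMap.det]
  have : (denom a U z)⁻¹ ^ d * (denom a U z)⁻¹ * denom a U z ^ (d + 1) = 1 := by
    rw [← pow_succ, ← mul_pow, inv_mul_cancel₀ h1, one_pow]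
  linear_combination (LinearMap.det (bergmanSqrtL a : Z d →ₗ[ℂ] Z d) *
    LinearMap.det (U : Z d →ₗ[ℂ] Z d)) * this

theorem hasFDerivAt_denom {d : ℕ} (a : Z d) (U : Z d →L[ℂ] Z d) (z : Z d) :
    HasFDerivAt (denom a U) ((innerSL ℂ a).comp U) z :=
  ((innerSL ℂ a).comp U).hasFDerivAt.const_add 1

/-- Logarithmic differentiation of the constant function `exp(L) j^{d+1}`. -/
theorem IsLogJacobian.fderiv_eq {d : ℕ} {g : BallAut d} {L : Z d → ℂ} (hL : IsLogJacobian g L)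
    {a : Z d} {U : Z d →L[ℂ] Z d} (ha : a ∈ D d) (hU : ∀ z, ‖U z‖ = ‖z‖)
    (hg : ∀ z ∈ D d, g.toFun z = transv a (U z)) {z : Z d} (hz : z ∈ D d) :
    fderiv ℂ L z = (-((d : ℂ) + 1) * (denom a U z)⁻¹) • (innerSL ℂ a).comp U := by
  have h1 := denom_ne_zero ha hU hz
  have hLd := (hL.holo.differentiableAt (D_mem_nhds hz)).hasFDerivAt
  have hconst : (fun w => Complex.exp (L w) * denom a U w ^ (d + 1)) =ᶠ[𝓝 z]
      fun _ => (bergmanSqrtL a).det * U.det := by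
    filter_upwards [D_mem_nhds hz] with w hw
    rw [hL.exp_eq w hw, det_fderiv_of_eq_transv ha hU hg hw]
  have hprod := (hLd.cexp.mul ((hasFDerivAt_denom a U z).pow (d + 1)))
  have h0 := hprod.unique ((hasFDerivAt_const _ z).congr_of_eventuallyEq hconst)
  ext ζ
  have h3 := congrArg (fun T : Z d →L[ℂ] ℂ => T ζ) h0
  simp at h3
  have he := Complex.exp_ne_zero (L z)
  have hp := pow_ne_zero d h1
  simp
  have h4 : (Complex.exp (L z) * denom a U z ^ d) *
      (fderiv ℂ L z ζ * denom a U z + ((d : ℂ) + 1) * inner ℂ a (U ζ)) = 0 := by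
    linear_combination h3
  have h5 := (mul_eq_zero.1 h4).resolve_left (mul_ne_zero he hp)
  field_simp
  linear_combination h5

/-! ### Intertwining on complex lines -/

theorem poch_succ (a : ℂ) (k : ℕ) : poch a (k + 1) = poch a k * (a + k) := by
  simp [poch, ascPochhammer_succ_eval]

theorem poch_zero (a : ℂ) : poch a 0 = 1 := by simp [poch]

theorem poch_add (a : ℂ) (m j : ℕ) : poch a (m + j) = poch a m * poch (a + m) j := by
  induction j with
  | zero => simp [poch_zero]
  | succ j ih => rw [← add_assoc, poch_succ, poch_succ, ih]; push_cast; ring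

theorem poch_succ_left (a : ℂ) (k : ℕ) : poch a (k + 1) = a * poch (a + 1) k := by
  have := poch_add a 1 k
  rw [add_comm, this, poch_succ, poch_zero]
  simp

theorem poch_ne_zero {x : ℝ} (hx : 0 < x) (k : ℕ) : poch (x : ℂ) k ≠ 0 := by
  induction k with
  | zero => simp [poch_zero]
  | succ k ih =>
    rw [poch_succ]
    refine mul_ne_zero ih ?_
    have : x + k ≠ 0 := by positivity
    exact_mod_cast this

/-- The coefficients of the derivatives of `(1 + r t)^(-μ) F(t / (1 + r t))`. -/
def lineCoeff (μ r : ℂ) (k m : ℕ) : ℂ := k.choose m * poch (μ + m) (k - m) * (-r) ^ (k - m)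

theorem lineCoeff_succ_zero (μ r : ℂ) (k : ℕ) :
    lineCoeff μ r (k + 1) 0 = -((μ + k) * r) * lineCoeff μ r k 0 := by
  simp only [lineCoeff, Nat.choose_zero_right, Nat.sub_zero, poch_succ, pow_succ]
  push_cast
  ring

theorem lineCoeff_succ_succ (μ r : ℂ) (k m : ℕ) (hm : m ≤ k) :
    lineCoeff μ r (k + 1) (m + 1) =
      -((μ + k + (m + 1 : ℕ)) * r) * lineCoeff μ r k (m + 1) + lineCoeff μ r k m := by
  rcases hm.eq_or_lt with rfl | hlt
  · simp [lineCoeff, poch_zero]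
  · obtain ⟨e, rfl⟩ : ∃ e, k = m + 1 + e := ⟨k - (m + 1), by omega⟩
    have e1 : m + 1 + e + 1 - (m + 1) = e + 1 := by omega
    have e2 : m + 1 + e - (m + 1) = e := by omega
    have e3 : m + 1 + e - m = e + 1 := by omega
    have hc := Nat.choose_succ_right_eq (m + 1 + e) m
    rw [e3] at hc
    have hc' : ((m + 1 + e).choose (m + 1) : ℂ) * (m + 1) = (m + 1 + e).choose m * (e + 1) := by
      exact_mod_cast hc
    simp only [lineCoeff, e1, e2, e3, Nat.choose_succ_succ]
    rw [poch_succ_left (μ + m), poch_succ, pow_succ]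
    push_cast
    rw [show μ + (m : ℂ) + 1 = μ + (m + 1) by ring]
    linear_combination (-(poch (μ + (↑m + 1)) e * (-r) ^ e * r)) * (-hc')

/-- Here `H` plays the role of `c (1+rt)^{-μ}`, but it enters only through its differential
equation, so no branch of the power is chosen. With `v = (1+rt)⁻¹` and `u = tv` one has `v' = -r v²`
and `u' = v²`; the term `H v^{k+m} F_m(u)` therefore has derivative `-(μ+k+m) r H v^{k+1+m} F_m(u) +
H v^{k+m+2} F_{m+1}(u)`, and `lineCoeff` obeys the matching recursion. -/
theorem line_derivatives {μ r : ℂ} {f F : ℕ → ℂ → ℂ} {H : ℂ → ℂ}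
    (hf : ∀ k, ∀ᶠ t in 𝓝 (0 : ℂ), HasDerivAt (f k) (f (k + 1) t) t)
    (hF : ∀ k, ∀ᶠ t in 𝓝 (0 : ℂ), HasDerivAt (F k) (F (k + 1) t) t)
    (hH : ∀ᶠ t in 𝓝 (0 : ℂ), HasDerivAt H (-(μ * r) * (1 + r * t)⁻¹ * H t) t)
    (h0 : ∀ᶠ t in 𝓝 (0 : ℂ), f 0 t = H t * F 0 (t * (1 + r * t)⁻¹)) (k : ℕ) :
    ∀ᶠ t in 𝓝 (0 : ℂ), f k t = ∑ m ∈ Finset.range (k + 1),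
      lineCoeff μ r k m * (H t * ((1 + r * t)⁻¹) ^ (k + m) * F m (t * (1 + r * t)⁻¹)) := by
  have hne : ∀ᶠ t in 𝓝 (0 : ℂ), 1 + r * t ≠ 0 :=
    ContinuousAt.eventually_ne (by fun_prop) (by simp)
  have hu : Filter.Tendsto (fun t : ℂ => t * (1 + r * t)⁻¹) (𝓝 0) (𝓝 0) := by
    have : ContinuousAt (fun t : ℂ => t * (1 + r * t)⁻¹) 0 :=
      continuousAt_id.mul (ContinuousAt.inv₀ (by fun_prop) (by simp))
    simpa [ContinuousAt] using this
  induction k with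
  | zero =>
    filter_upwards [h0] with t ht
    simp [lineCoeff, poch_zero, ht]
  | succ k ih =>
    have hFm : ∀ᶠ t in 𝓝 (0 : ℂ), ∀ m ∈ Finset.range (k + 1),
        HasDerivAt (F m) (F (m + 1) (t * (1 + r * t)⁻¹)) (t * (1 + r * t)⁻¹) :=
      (Filter.eventually_all_finset _).2 fun m _ => hu.eventually (hF m)
    filter_upwards [hf k, ih.eventually_nhds, hH, hne, hFm] with t h1 h2 h3 h4 h5
    have hv : HasDerivAt (fun t : ℂ => (1 + r * t)⁻¹) (-r * ((1 + r * t)⁻¹) ^ 2) t := by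
      have : HasDerivAt (fun t : ℂ => 1 + r * t) r t := by
        simpa using ((hasDerivAt_id t).const_mul r).const_add 1
      refine (this.fun_inv h4).congr_deriv ?_
      field_simp
    have hu' : HasDerivAt (fun t : ℂ => t * (1 + r * t)⁻¹) (((1 + r * t)⁻¹) ^ 2) t := by
      refine ((hasDerivAt_id t).mul hv).congr_deriv ?_
      simp only [id]
      field_simp
      ring
    have hterm : ∀ m ∈ Finset.range (k + 1), HasDerivAt
        (fun t => lineCoeff μ r k m * (H t * ((1 + r * t)⁻¹) ^ (k + m) * F m (t * (1 + r * t)⁻¹)))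
        (lineCoeff μ r k m * (-((μ + k + m) * r) *
          (H t * ((1 + r * t)⁻¹) ^ (k + 1 + m) * F m (t * (1 + r * t)⁻¹)) +
          (H t * ((1 + r * t)⁻¹) ^ (k + 1 + (m + 1)) * F (m + 1) (t * (1 + r * t)⁻¹)))) t := by
      intro m hm
      have hpow : HasDerivAt (fun t : ℂ => ((1 + r * t)⁻¹) ^ (k + m))
          (-((k + m : ℕ) * r) * ((1 + r * t)⁻¹) ^ (k + m + 1)) t := by
        refine (hv.pow (k + m)).congr_deriv ?_
        rcases Nat.eq_zero_or_pos (k + m) with h | h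
        · simp [h]
        · obtain ⟨e, he⟩ : ∃ e, k + m = e + 1 := ⟨k + m - 1, by omega⟩
          rw [he, Nat.add_sub_cancel]; ring
      have hFc := (h5 m hm).comp t hu'
      refine (((h3.mul hpow).mul hFc).const_mul (lineCoeff μ r k m)).congr_deriv ?_
      simp only [Function.comp, Pi.mul_apply]
      push_cast
      ring
    have hsum := HasDerivAt.fun_sum hterm
    rw [h1.unique (hsum.congr_of_eventuallyEq h2)]
    set X : ℕ → ℂ := fun m => H t * ((1 + r * t)⁻¹) ^ (k + 1 + m) * F m (t * (1 + r * t)⁻¹)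
      with hX
    change ∑ m ∈ Finset.range (k + 1), lineCoeff μ r k m * (-((μ + k + m) * r) * X m + X (m + 1)) =
      ∑ m ∈ Finset.range (k + 1 + 1), lineCoeff μ r (k + 1) m * X m
    -- The vanishing of this coefficient lets the sum over `m ≤ k` be extended by one term and
    -- reindexed by `m + 1`.
    have hlast : lineCoeff μ r k (k + 1) = 0 := by simp [lineCoeff]
    rw [Finset.sum_range_succ' (fun m => lineCoeff μ r (k + 1) m * X m)]
    have e1 : ∑ m ∈ Finset.range (k + 1), lineCoeff μ r (k + 1) (m + 1) * X (m + 1) =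
        ∑ m ∈ Finset.range (k + 1), -((μ + k + (m + 1 : ℕ)) * r) * lineCoeff μ r k (m + 1) *
          X (m + 1) + ∑ m ∈ Finset.range (k + 1), lineCoeff μ r k m * X (m + 1) := by
      rw [← Finset.sum_add_distrib]
      refine Finset.sum_congr rfl fun m hm => ?_
      rw [lineCoeff_succ_succ μ r k m (by simpa [Nat.lt_succ_iff] using hm)]
      ring
    have e2 := Finset.sum_range_succ'
      (fun m : ℕ => -((μ + k + m) * r) * lineCoeff μ r k m * X m) (k + 1)
    rw [Finset.sum_range_succ, hlast] at e2
    rw [e1, lineCoeff_succ_zero]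
    simp only [mul_add, Finset.sum_add_distrib]
    have e3 : ∑ m ∈ Finset.range (k + 1), lineCoeff μ r k m * (-((μ + k + m) * r) * X m) =
        ∑ m ∈ Finset.range (k + 1), -((μ + k + m) * r) * lineCoeff μ r k m * X m :=
      Finset.sum_congr rfl fun m _ => by ring
    rw [e3]
    push_cast at e2 ⊢
    linear_combination e2

/-- The identity that dictates the coefficients of the operator. Put `k = m + j`: the splittings
`(x)_k = (x)_m (x+m)_j` and `C(N,k) C(k,m) = C(N,m) C(N-m,j)` cancel the Pochhammer symbols, the
signs `(-1)^j` cancel in pairs, and what remains is the binomial expansion of `(1+r)^{N-m}`. -/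
theorem sum_lineCoeff {x : ℝ} (hx : 0 < x) (r : ℂ) (N : ℕ) (F : ℕ → ℂ) :
    ∑ k ∈ Finset.range (N + 1), (-1) ^ k / poch (x : ℂ) k * (N.choose k : ℂ) *
        ∑ m ∈ Finset.range (k + 1), lineCoeff x r k m * F m =
      ∑ m ∈ Finset.range (N + 1), (-1) ^ m / poch (x : ℂ) m * (N.choose m : ℂ) *
        ((1 + r) ^ (N - m) * F m) := by
  have h1 : ∀ k ∈ Finset.range (N + 1), ∑ m ∈ Finset.range (k + 1), lineCoeff x r k m * F m =
      ∑ m ∈ Finset.range (N + 1), lineCoeff x r k m * F m := by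
    intro k hk
    refine Finset.sum_subset (Finset.range_subset_range.2 (by simpa using hk)) fun m _ hm => ?_
    rw [Finset.mem_range, not_lt] at hm
    simp [lineCoeff, Nat.choose_eq_zero_of_lt hm]
  rw [Finset.sum_congr rfl fun k hk => by rw [h1 k hk, Finset.mul_sum], Finset.sum_comm]
  refine Finset.sum_congr rfl fun m hm => ?_
  have hmN : m ≤ N := by simpa [Nat.lt_succ_iff] using hm
  rw [add_comm 1 r, add_pow, Finset.sum_mul, Finset.mul_sum]
  have hsplit : N + 1 = m + (N - m + 1) := by omega
  rw [hsplit, Finset.sum_range_add, Finset.sum_eq_zero, zero_add]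
  · refine Finset.sum_congr rfl fun j hj => ?_
    have hjN : j ≤ N - m := by simpa [Nat.lt_succ_iff] using hj
    have hc : (N.choose (m + j) : ℂ) * ((m + j).choose m : ℂ) =
        N.choose m * (N - m).choose j := by
      have := Nat.choose_mul (n := N) (k := m + j) (s := m) (by omega)
      rw [Nat.add_sub_cancel_left] at this
      exact_mod_cast this
    have hp1 := poch_ne_zero hx m
    have hp2 : poch ((x : ℂ) + m) j ≠ 0 := by
      have := poch_ne_zero (x := x + m) (by positivity) j
      exact_mod_cast this
    rw [lineCoeff, Nat.add_sub_cancel_left, poch_add, pow_add, neg_pow r j]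
    have hs : ((-1 : ℂ) ^ j) * (-1) ^ j = 1 := by rw [← mul_pow]; simp
    field_simp
    linear_combination (r ^ j * F m * ((-1) ^ j * (-1) ^ j)) * hc +
      (r ^ j * F m * (N.choose m * (N - m).choose j)) * hs
  · intro k hk
    rw [Finset.mem_range] at hk
    simp [lineCoeff, Nat.choose_eq_zero_of_lt hk]

/-! ### Equivariance -/

section Equivariance

variable {d : ℕ} {g : BallAut d} {L : Z d → ℂ} {a : Z d} {U : Z d →L[ℂ] Z d}

theorem differentiableOn_fderiv_of_eq_transv {f : Z d → Z d} (ha : a ∈ D d)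
    (hU : ∀ z, ‖U z‖ = ‖z‖) (hf : ∀ z ∈ D d, f z = transv a (U z)) (ζ : Z d) :
    DifferentiableOn ℂ (fun z => fderiv ℂ f z ζ) (D d) := by
  have hinv : DifferentiableOn ℂ (fun z => (denom a U z)⁻¹) (D d) :=
    DifferentiableOn.fun_inv
      (fun z _ => (hasFDerivAt_denom a U z).differentiableAt.differentiableWithinAt)
      fun z hz => denom_ne_zero ha hU hz
  have hlin : Differentiable ℂ fun z => bergmanSqrt a (U z) :=
    ((bergmanSqrtL a).comp U).differentiable
  exact DifferentiableOn.congr ((hinv.smul_const _).sub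
    (((hinv.fun_pow 2).mul_const _).smul hlin.differentiableOn))
    fun z hz => fderiv_of_eq_transv ha hU hf hz ζ

theorem differentiableOn_littleAction (hL : IsLogJacobian g L) (ha : a ∈ D d)
    (hU : ∀ z, ‖U z‖ = ‖z‖) (hg : ∀ z ∈ D d, g.toFun z = transv a (U z)) (ν : ℝ) {l : ℕ}
    {Φ : Z d → Z d → ℂ} (hΦ : IsHolomorphicMap (homPoly d l) Φ) (ζ : Z d) :
    DifferentiableOn ℂ (fun z => littleAction ν g L Φ z ζ) (D d) := by
  obtain ⟨m, f, e, hf, he, hsum⟩ := hΦ.exists_sum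
  have hfd := differentiableOn_fderiv_of_eq_transv ha hU hg ζ
  refine DifferentiableOn.mul ((hL.holo.const_mul _).cexp) ?_
  refine DifferentiableOn.congr (f := fun z => ∑ j, f j (g.toFun z) * e j (fderiv ℂ g.toFun z ζ))
    (DifferentiableOn.fun_sum fun j _ => ?_) fun z hz => hsum _ (g.mapsTo hz) _
  obtain ⟨p, -, hp⟩ := he j
  rw [← hp]
  exact ((hf j).comp g.holo g.mapsTo).mul
    ((differentiable_polyFun p).differentiableOn.comp hfd fun _ _ => Set.mem_univ _)

/-- The quotient `exp(-L/(d+1)) / j` has zero derivative on the connected ball. Thus the chosen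
branch of `det(g')^{-1/p}` is a constant multiple of `j`, which an identity between `p`-th powers
alone would not give. -/
theorem exp_denom_const (hL : IsLogJacobian g L) (ha : a ∈ D d)
    (hU : ∀ z, ‖U z‖ = ‖z‖) (hg : ∀ z ∈ D d, g.toFun z = transv a (U z)) {z w : Z d}
    (hz : z ∈ D d) (hw : w ∈ D d) :
    Complex.exp (-((d : ℂ) + 1)⁻¹ * L z) * denom a U w =
      Complex.exp (-((d : ℂ) + 1)⁻¹ * L w) * denom a U z := by
  set G : Z d → ℂ := fun w => Complex.exp (-((d : ℂ) + 1)⁻¹ * L w) * (denom a U w)⁻¹ with hG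
  have hd1 : (d : ℂ) + 1 ≠ 0 := by exact_mod_cast d.succ_ne_zero
  have hder : ∀ w ∈ D d, HasFDerivAt G (0 : Z d →L[ℂ] ℂ) w := by
    intro w hw
    have h1 := denom_ne_zero ha hU hw
    have hLd := (hL.holo.differentiableAt (D_mem_nhds hw)).hasFDerivAt
    rw [hL.fderiv_eq ha hU hg hw] at hLd
    refine ((hLd.const_mul _).cexp.mul
      ((hasDerivAt_inv h1).comp_hasFDerivAt w (hasFDerivAt_denom a U w))).congr_fderiv ?_
    ext v
    simp
    field_simp
    ring
  have hconst : G z = G w :=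
    (isOpen_D d).is_const_of_fderiv_eq_zero (convex_ball _ _).isPreconnected
      (fun w hw => (hder w hw).differentiableAt.differentiableWithinAt)
      (fun w hw => (hder w hw).fderiv) hz hw
  have h1 := denom_ne_zero ha hU hz
  have h2 := denom_ne_zero ha hU hw
  simp only [hG] at hconst
  rwa [← div_eq_mul_inv, ← div_eq_mul_inv, div_eq_div_iff h1 h2] at hconst

/-- Both sides are expanded in `((η|∂̄)^m Φ)_{g(z)}(η)` with `η = g'(z)ζ` and compared term by term.
-/
theorem ballOp_equivariant {l n : ℕ} (hl : l ≤ n) {ν : ℝ} (hν : 0 < 2 * (l : ℝ) + ν)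
    (hL : IsLogJacobian g L) {Φ : Z d → Z d → ℂ} (hΦ : IsHolomorphicMap (homPoly d l) Φ)
    {z ζ : Z d} (hz : z ∈ D d) (hzζ : z + ζ ∈ D d) :
    ballOp ν l n (littleAction ν g L Φ) z ζ = bigAction ν n g L (ballOp ν l n Φ) z ζ := by
  obtain ⟨a, ha, U, hU, hg⟩ := g.exists_eq_transv
  have hj0 := denom_ne_zero ha hU hz
  have hj1 := denom_ne_zero ha hU hzζ
  set r : ℂ := inner ℂ a (U ζ) / denom a U z with hr
  set η := fderiv ℂ g.toFun z ζ with hη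
  have hd1 : (d : ℂ) + 1 ≠ 0 := by exact_mod_cast d.succ_ne_zero
  have hJ : ∀ t : ℂ, denom a U (z + t • ζ) = denom a U z * (1 + r * t) := fun t => by
    rw [denom_add, map_smul, inner_smul_right, hr]
    field_simp
  have hJ1 : denom a U (z + ζ) = denom a U z * (1 + r) := by simpa using hJ 1
  have hline : ∀ x v : Z d, x ∈ D d → ∀ᶠ t in 𝓝 (0 : ℂ), x + t • v ∈ D d := fun x v hx => by
    have hc : ContinuousAt (fun t : ℂ => x + t • v) 0 := by fun_prop
    exact hc.eventually (by
      simp only [zero_smul, add_zero]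
      exact D_mem_nhds hx)
  set f : ℕ → ℂ → ℂ := fun k t => (shiftD^[k] (littleAction ν g L Φ)) (z + t • ζ) ζ with hf
  set F : ℕ → ℂ → ℂ := fun k u => (shiftD^[k] Φ) (g.toFun z + u • η) η with hF
  -- The Jacobian accounts for `ν` in the exponent `2l + ν`. The remaining `2l` arises because
  -- `g'(z+tζ)ζ = (1+rt)⁻² η` is inserted into a polynomial homogeneous of degree `l`.
  set H : ℂ → ℂ := fun t => Complex.exp (((ν / genus d : ℝ) : ℂ) * L (z + t • ζ)) *
    ((1 + r * t)⁻¹) ^ (2 * l) with hH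
  have hne : ∀ᶠ t in 𝓝 (0 : ℂ), 1 + r * t ≠ 0 :=
    ContinuousAt.eventually_ne (by fun_prop) (by simp)
  have hf' : ∀ k, ∀ᶠ t in 𝓝 (0 : ℂ), HasDerivAt (f k) (f (k + 1) t) t := by
    intro k
    filter_upwards [hline z ζ hz] with t ht
    simp only [hf, shiftD_iterate, Function.iterate_succ_apply']
    exact hasDerivAt_comp_line (differentiableOn_dirD_iterate
      (differentiableOn_littleAction hL ha hU hg ν hΦ ζ) ζ k) z ζ t ht
  have hF' : ∀ k, ∀ᶠ u in 𝓝 (0 : ℂ), HasDerivAt (F k) (F (k + 1) u) u := by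
    intro k
    filter_upwards [hline (g.toFun z) η (g.mapsTo hz)] with t ht
    simp only [hF, shiftD_iterate, Function.iterate_succ_apply']
    exact hasDerivAt_comp_line (differentiableOn_dirD_iterate (hΦ.2 η) η k) _ η t ht
  have hH' : ∀ᶠ t in 𝓝 (0 : ℂ), HasDerivAt H
      (-(((2 * (l : ℝ) + ν : ℝ) : ℂ) * r) * (1 + r * t)⁻¹ * H t) t := by
    filter_upwards [hline z ζ hz, hne] with t ht h4
    have h1 : HasDerivAt (fun t : ℂ => L (z + t • ζ)) (-((d : ℂ) + 1) * r * (1 + r * t)⁻¹) t := by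
      refine (hasDerivAt_comp_line hL.holo z ζ t ht).congr_deriv ?_
      rw [dirD, hL.fderiv_eq ha hU hg ht, hJ]
      simp [hr]
      field_simp
    have hv : HasDerivAt (fun t : ℂ => (1 + r * t)⁻¹) (-r * ((1 + r * t)⁻¹) ^ 2) t := by
      have : HasDerivAt (fun t : ℂ => 1 + r * t) r t := by
        simpa using ((hasDerivAt_id t).const_mul r).const_add 1
      refine (this.fun_inv h4).congr_deriv ?_
      field_simp
    refine ((h1.const_mul ((ν / genus d : ℝ) : ℂ)).cexp.mul (hv.fun_pow (2 * l))).congr_deriv ?_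
    have hp : (2 * l : ℕ) * ((1 + r * t)⁻¹) ^ (2 * l - 1) * ((1 + r * t)⁻¹) =
        (2 * l : ℕ) * ((1 + r * t)⁻¹) ^ (2 * l) := by
      rcases Nat.eq_zero_or_pos l with h | h
      · simp [h]
      · rw [mul_assoc, ← pow_succ, Nat.sub_add_cancel (by omega)]
    have hg1 : ((ν / genus d : ℝ) : ℂ) * ((d : ℂ) + 1) = ν := by
      simp only [genus]; push_cast; field_simp
    simp only [hH]
    set E := Complex.exp (((ν / genus d : ℝ) : ℂ) * L (z + t • ζ))
    push_cast at hp hg1 ⊢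
    linear_combination (-E * r * (1 + r * t)⁻¹ ) * hp -
      (E * r * (1 + r * t)⁻¹ * ((1 + r * t)⁻¹) ^ (2 * l)) * hg1
  have h0 : ∀ᶠ t in 𝓝 (0 : ℂ), f 0 t = H t * F 0 (t * (1 + r * t)⁻¹) := by
    filter_upwards [hline z ζ hz, hne] with t ht h4
    simp only [hf, hF, hH, Function.iterate_zero, id, littleAction]
    have e1 : denom a U z / denom a U (z + t • ζ) = (1 + r * t)⁻¹ := by
      rw [hJ]; field_simp
    have e2 : fderiv ℂ g.toFun (z + t • ζ) ζ = ((1 + r * t)⁻¹) ^ 2 • η := by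
      rw [fderiv_add_smul ha hU hg hz ht, e1]
    have e3 : g.toFun (z + t • ζ) = g.toFun z + (t * (1 + r * t)⁻¹) • η := by
      rw [← sub_eq_iff_eq_add', sub_eq_smul_fderiv ha hU hg hz ht, e1, map_smul, smul_smul,
        mul_comm t]
    rw [e2, hΦ.comp_smul (g.mapsTo ht), ← pow_mul, e3]
    ring
  have hk : ∀ k, (shiftD^[k] (littleAction ν g L Φ)) z ζ = ∑ m ∈ Finset.range (k + 1),
      lineCoeff ((2 * (l : ℝ) + ν : ℝ) : ℂ) r k m *
        (Complex.exp (((ν / genus d : ℝ) : ℂ) * L z) * (shiftD^[m] Φ) (g.toFun z) η) := by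
    intro k
    have := (line_derivatives hf' hF' hH' h0 k).self_of_nhds
    simpa [hf, hF, hH] using this
  have hmu : ((2 * (l : ℝ) + ν : ℝ) : ℂ) = 2 * (l : ℂ) + ν := by push_cast; ring
  rw [← ballOpBinom_eq hl]
  unfold ballOpBinom bigAction
  simp only [hk, ← hmu]
  rw [sum_lineCoeff hν r (n - l), ← ballOpBinom_eq hl, ballOpBinom, ← hmu, Finset.mul_sum]
  refine Finset.sum_congr rfl fun m hm => ?_
  have hmn : m ≤ n - l := by simpa [Nat.lt_succ_iff] using hm
  have hr1 : 1 + r ≠ 0 := fun h => hj1 (by rw [hJ1, h, mul_zero])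
  have e1 : denom a U z / denom a U (z + ζ) = (1 + r)⁻¹ := by
    rw [hJ1]; field_simp
  rw [sub_eq_smul_fderiv ha hU hg hz hzζ, e1,
    (hΦ.shiftD_iterate m).comp_smul (g.mapsTo hz)]
  -- The quotient of the `n/p`-th powers of the Jacobians at `z` and `z+ζ` is `(j(z+ζ)/j(z))^n`.
  have e2 : Complex.exp ((((ν + n) / genus d : ℝ) : ℂ) * L z) *
      Complex.exp (((-(n : ℝ) / genus d : ℝ) : ℂ) * L (z + ζ)) =
      Complex.exp (((ν / genus d : ℝ) : ℂ) * L z) * (1 + r) ^ n := by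
    have e3 := exp_denom_const hL ha hU hg hzζ hz
    rw [hJ1] at e3
    have e4 : Complex.exp (-((d : ℂ) + 1)⁻¹ * L (z + ζ)) =
        Complex.exp (-((d : ℂ) + 1)⁻¹ * L z) * (1 + r) := by
      apply mul_right_cancel₀ hj0
      rw [e3]; ring
    have e5 : Complex.exp (((-(n : ℝ) / genus d : ℝ) : ℂ) * L (z + ζ)) =
        Complex.exp (-((d : ℂ) + 1)⁻¹ * L (z + ζ)) ^ n := by
      rw [← Complex.exp_nat_mul]
      congr 1
      simp only [genus]; push_cast; ring
    rw [e5, e4, mul_pow, ← mul_assoc, ← Complex.exp_nat_mul, ← Complex.exp_add]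
    congr 2
    simp only [genus]; push_cast; ring
  rw [e2]
  have e4 : (1 + r) ^ n = (1 + r) ^ (n - l - m) * (1 + r) ^ (l + m) := by
    rw [← pow_add]; congr 1; omega
  have e5 : (1 + r) ^ (l + m) * ((1 + r)⁻¹) ^ (l + m) = 1 := by
    rw [← mul_pow, mul_inv_cancel₀ hr1, one_pow]
  rw [e4]
  linear_combination (-((-1) ^ m / poch ((2 * (l : ℝ) + ν : ℝ) : ℂ) m * ((n - l).choose m : ℂ) *
    (1 + r) ^ (n - l - m) * Complex.exp (((ν / genus d : ℝ) : ℂ) * L z) *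
    (shiftD^[m] Φ) (g.toFun z) η)) * e5

end Equivariance

/-! ### Geometry of the ball -/

theorem norm_bergmanSqrt_le {d : ℕ} {x : Z d} (hx : x ∈ D d) (ζ : Z d) :
    ‖bergmanSqrt x ζ‖ ≤ defect x * ‖ζ‖ := by
  have hs := defect_pos hx
  have h1 : ∀ v : Z d, inner ℂ v v = ((‖v‖ ^ 2 : ℝ) : ℂ) := fun v => by
    rw [inner_self_eq_norm_sq_to_K]; norm_cast
  have h2 : inner ℂ x ζ * inner ℂ ζ x = ((‖inner ℂ x ζ‖ ^ 2 : ℝ) : ℂ) := by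
    rw [← inner_conj_symm ζ x, Complex.mul_conj, Complex.normSq_eq_norm_sq]
  have h3 := inner_bergmanSqrt_bergmanSqrt hx ζ ζ
  rw [h1, h1, h2] at h3
  have h4 : ‖bergmanSqrt x ζ‖ ^ 2 = defect x ^ 2 * (‖ζ‖ ^ 2 - ‖inner ℂ x ζ‖ ^ 2) := by
    exact_mod_cast h3
  refine (pow_le_pow_iff_left₀ (norm_nonneg _) (by positivity) two_ne_zero).1 ?_
  rw [h4, mul_pow]
  gcongr
  linarith [sq_nonneg ‖inner ℂ x ζ‖]

/-- The inverse of `B_{x,x}^{1/2}`. -/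
def bergmanSqrtInv {d : ℕ} (x η : Z d) : Z d :=
  (defect x : ℂ)⁻¹ • (η + (inner ℂ x η / (defect x * (1 + defect x))) • x)

theorem bergmanSqrt_bergmanSqrtInv {d : ℕ} {x : Z d} (hx : x ∈ D d) (η : Z d) :
    bergmanSqrt x (bergmanSqrtInv x η) = η := by
  have hs : (defect x : ℂ) ≠ 0 := by exact_mod_cast (defect_pos hx).ne'
  have h1 := one_add_defect_ne_zero x
  simp only [bergmanSqrt_eq, bergmanSqrtInv, inner_smul_right, inner_add_right,
    inner_self_eq_defect hx]
  match_scalars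
  · field_simp
  · field_simp
    ring

theorem bergmanSqrtInv_bergmanSqrt {d : ℕ} {x : Z d} (hx : x ∈ D d) (η : Z d) :
    bergmanSqrtInv x (bergmanSqrt x η) = η := by
  have hs : (defect x : ℂ) ≠ 0 := by exact_mod_cast (defect_pos hx).ne'
  have h1 := one_add_defect_ne_zero x
  rw [bergmanSqrtInv, inner_bergmanSqrt_right_self hx, bergmanSqrt_eq]
  match_scalars
  · field_simp
  · field_simp
    ring

theorem norm_bergmanSqrtInv_le {d : ℕ} {x : Z d} (hx : x ∈ D d) (η : Z d) :
    ‖bergmanSqrtInv x η‖ ≤ (defect x)⁻¹ * (‖η‖ + ‖inner ℂ x η‖ / defect x) := by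
  have hs := defect_pos hx
  rw [bergmanSqrtInv, norm_smul, norm_inv, Complex.norm_real, Real.norm_of_nonneg hs.le]
  gcongr
  refine (norm_add_le _ _).trans ?_
  gcongr
  rw [norm_smul, norm_div, norm_mul, Complex.norm_real, Real.norm_of_nonneg hs.le]
  have h1 : ‖(1 + (defect x : ℂ))‖ = 1 + defect x := by
    rw [← Complex.ofReal_one, ← Complex.ofReal_add, Complex.norm_real,
      Real.norm_of_nonneg (by positivity)]
  rw [h1, div_mul_eq_mul_div, div_le_div_iff₀ (by positivity) hs]
  have := norm_lt_one_of_mem hx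
  have h2 : ‖inner ℂ x η‖ * ‖x‖ ≤ ‖inner ℂ x η‖ * (1 + defect x) := by gcongr; linarith
  nlinarith

/-- Two points of the ball at bounded hyperbolic distance. -/
structure Near {d : ℕ} (x y : Z d) : Prop where
  left_le : defect x ≤ 2 * defect y
  right_le : defect y ≤ 2 * defect x
  dist_le_left : ‖y - x‖ ≤ defect x

/-- The inverse root at `y` may stretch by `(defect y)⁻²` in the direction of `y`, so that component
must be quadratically small. It is: `(B_{x,x}^{1/2}ζ|x) = (defect x)² (ζ|x)`, while replacing `x` by
`y` costs `‖y-x‖ ‖B_{x,x}^{1/2}ζ‖ ≤ (defect x)² ‖ζ‖`. With a defect ratio of at most two the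
constant is `2 + 2·2² = 10`. -/
theorem Near.norm_bergmanSqrtInv_bergmanSqrt_le {d : ℕ} {x y : Z d} (hx : x ∈ D d) (hy : y ∈ D d)
    (h : Near x y) (ζ : Z d) : ‖bergmanSqrtInv y (bergmanSqrt x ζ)‖ ≤ 10 * ‖ζ‖ := by
  have hsx := defect_pos hx
  have hsy := defect_pos hy
  refine (norm_bergmanSqrtInv_le hy _).trans ?_
  have h1 := norm_bergmanSqrt_le hx ζ
  have h2 : ‖inner ℂ y (bergmanSqrt x ζ)‖ ≤ 2 * defect x ^ 2 * ‖ζ‖ := by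
    have e : y = x + (y - x) := by abel
    rw [e, inner_add_left, inner_bergmanSqrt_right_self hx]
    have h3 : ‖(defect x : ℂ) ^ 2 * inner ℂ x ζ‖ ≤ defect x ^ 2 * ‖ζ‖ := by
      rw [norm_mul, norm_pow, Complex.norm_real, Real.norm_of_nonneg hsx.le]
      gcongr
      refine (norm_inner_le_norm x ζ).trans ?_
      nlinarith [norm_lt_one_of_mem hx, norm_nonneg ζ]
    have h4 : ‖inner ℂ (y - x) (bergmanSqrt x ζ)‖ ≤ defect x * (defect x * ‖ζ‖) :=
      (norm_inner_le_norm _ _).trans (mul_le_mul h.dist_le_left h1 (norm_nonneg _) hsx.le)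
    refine (norm_add_le _ _).trans ?_
    nlinarith
  have hr : defect x / defect y ≤ 2 := by rw [div_le_iff₀ hsy]; exact h.left_le
  have hr0 : 0 ≤ defect x / defect y := by positivity
  calc (defect y)⁻¹ * (‖bergmanSqrt x ζ‖ + ‖inner ℂ y (bergmanSqrt x ζ)‖ / defect y)
      ≤ (defect y)⁻¹ * (defect x * ‖ζ‖ + 2 * defect x ^ 2 * ‖ζ‖ / defect y) := by gcongr
    _ = (defect x / defect y + 2 * (defect x / defect y) ^ 2) * ‖ζ‖ := by field_simp
    _ ≤ 10 * ‖ζ‖ := by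
      gcongr
      nlinarith

/-- Expanding the square, `1 - ‖x + B_{x,x}^{1/2}w‖²` differs from `(defect x)²` by at most `(2‖w‖ +
‖w‖²)(defect x)²`. Below, `1 - 1/2 - 1/16 = 7/16` exceeds `1/4`, which gives the factor two for the
defects. -/
theorem near_add_bergmanSqrt {d : ℕ} {x w : Z d} (hx : x ∈ D d) (hw : ‖w‖ < 1 / 4) :
    x + bergmanSqrt x w ∈ D d ∧ Near x (x + bergmanSqrt x w) := by
  have hs := defect_pos hx
  have hA := norm_bergmanSqrt_le hx w
  have hre : |(inner ℂ x (bergmanSqrt x w)).re| ≤ defect x ^ 2 * ‖w‖ := by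
    refine (Complex.abs_re_le_norm _).trans ?_
    rw [inner_bergmanSqrt_right_self hx, norm_mul, norm_pow, Complex.norm_real,
      Real.norm_of_nonneg hs.le]
    gcongr
    refine (norm_inner_le_norm x w).trans ?_
    nlinarith [norm_lt_one_of_mem hx, norm_nonneg w]
  have hns : ‖x + bergmanSqrt x w‖ ^ 2 =
      ‖x‖ ^ 2 + 2 * (inner ℂ x (bergmanSqrt x w)).re + ‖bergmanSqrt x w‖ ^ 2 :=
    norm_add_sq (𝕜 := ℂ) x (bergmanSqrt x w)
  have hA2 : ‖bergmanSqrt x w‖ ^ 2 ≤ defect x ^ 2 * ‖w‖ ^ 2 := by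
    rw [← mul_pow]; gcongr
  have hsq := defect_sq hx
  have hs2 : 0 < defect x ^ 2 := by positivity
  obtain ⟨hr1, hr2⟩ := abs_le.1 hre
  have hw2 : ‖w‖ ^ 2 ≤ 1 / 16 := by nlinarith [norm_nonneg w]
  have hlow : (7 / 16) * defect x ^ 2 ≤ 1 - ‖x + bergmanSqrt x w‖ ^ 2 := by nlinarith
  have hup : 1 - ‖x + bergmanSqrt x w‖ ^ 2 ≤ 4 * defect x ^ 2 := by
    nlinarith [sq_nonneg ‖bergmanSqrt x w‖]
  have hy : x + bergmanSqrt x w ∈ D d := by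
    rw [mem_ball_zero_iff]
    nlinarith [norm_nonneg (x + bergmanSqrt x w)]
  rw [← defect_sq hy] at hlow hup
  have hsy := defect_pos hy
  have h1 : defect x ≤ 2 * defect (x + bergmanSqrt x w) := by nlinarith
  refine ⟨hy, h1, by nlinarith, ?_⟩
  rw [add_sub_cancel_left]
  nlinarith

/-- With `s = defect x`, the operator is `s` times a transvection of determinant `1 - (1-s²)/(1+s) =
s`. -/
theorem det_bergmanSqrtL {d : ℕ} {x : Z d} (hx : x ∈ D d) :
    LinearMap.det (bergmanSqrtL x : Z d →ₗ[ℂ] Z d) = (defect x : ℂ) ^ (d + 1) := by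
  have e : (bergmanSqrtL x : Z d →ₗ[ℂ] Z d) = (defect x : ℂ) •
      LinearMap.transvection (-((1 + (defect x : ℂ))⁻¹ • (innerSL ℂ x : Z d →ₗ[ℂ] ℂ))) x := by
    ext1 ζ
    simp only [ContinuousLinearMap.coe_coe, bergmanSqrtL_apply, bergmanSqrt_eq,
      LinearMap.smul_apply, LinearMap.transvection.apply, LinearMap.neg_apply,
      innerSL_apply_apply, smul_eq_mul]
    module
  rw [e, LinearMap.det_smul, LinearMap.transvection.det, finrank_euclideanSpace_fin, pow_succ]
  congr 1
  have h1 := one_add_defect_ne_zero x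
  simp only [LinearMap.neg_apply, LinearMap.smul_apply, ContinuousLinearMap.coe_coe,
      innerSL_apply_apply, smul_eq_mul, inner_self_eq_defect hx]
  field_simp
  ring

theorem det_real_bergmanSqrtL {d : ℕ} {x : Z d} (hx : x ∈ D d) :
    |((bergmanSqrtL x).restrictScalars ℝ).det| = defect x ^ (2 * (d + 1)) := by
  have hs := defect_pos hx
  have : ((bergmanSqrtL x).restrictScalars ℝ).det =
      LinearMap.det ((bergmanSqrtL x : Z d →ₗ[ℂ] Z d).restrictScalars ℝ) := rfl
  rw [this, LinearMap.det_restrictScalars, det_bergmanSqrtL hx, Algebra.norm_complex_apply,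
    map_pow, Complex.normSq_ofReal, abs_of_nonneg (by positivity)]
  ring

theorem lintegral_comp_bergmanSqrt {d : ℕ} {x : Z d} (hx : x ∈ D d) {S : Set (Z d)}
    (hS : MeasurableSet S) (h : Z d → ENNReal) :
    ∫⁻ y in (fun w => x + bergmanSqrt x w) '' S, h y =
      ENNReal.ofReal (defect x ^ (2 * (d + 1))) * ∫⁻ w in S, h (x + bergmanSqrt x w) := by
  rw [lintegral_image_eq_lintegral_abs_det_fderiv_mul volume hS
    (f' := fun _ => (bergmanSqrtL x).restrictScalars ℝ), det_real_bergmanSqrtL hx,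
    lintegral_const_mul' _ _ ENNReal.ofReal_ne_top]
  · intro w _
    exact ((((bergmanSqrtL x).restrictScalars ℝ).hasFDerivAt).const_add x).hasFDerivWithinAt
  · intro v _ w _ hvw
    have := congrArg (bergmanSqrtInv x) (add_left_cancel hvw)
    rwa [bergmanSqrtInv_bergmanSqrt hx, bergmanSqrtInv_bergmanSqrt hx] at this

/-! ### The sub-mean value property -/

theorem measurePreserving_smul_circle {d : ℕ} {c : ℂ} (hc : ‖c‖ = 1) :
    MeasurePreserving (fun v : Z d => c • v) := by
  have hc0 : c ≠ 0 := by rintro rfl; simp at hc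
  let e : Z d ≃ₗᵢ[ℝ] Z d :=
    { (LinearEquiv.smulOfNeZero ℂ (Z d) c hc0).restrictScalars ℝ with
      norm_map' := fun v => by
        change ‖c • v‖ = ‖v‖
        rw [norm_smul, hc, one_mul] }
  exact e.measurePreserving

/-- The mean value property of the holomorphic function `g²`. -/
theorem enorm_sq_mul_le_circle {g : ℂ → ℂ} (hg : DiffContOnCl ℂ g (Metric.ball 0 1)) :
    ENNReal.ofReal (2 * Real.pi) * ‖g 0‖ₑ ^ 2 ≤
      ∫⁻ θ in Set.Ioc 0 (2 * Real.pi), ‖g (circleMap 0 1 θ)‖ₑ ^ 2 := by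
  have hg2 : DiffContOnCl ℂ (fun t => g t ^ 2) (Metric.ball 0 |(1 : ℝ)|) := by
    rw [abs_one]
    simpa [pow_two] using hg.smul hg
  have h := hg2.circleAverage
  rw [Real.circleAverage_def] at h
  have hpi : (0 : ℝ) < 2 * Real.pi := by positivity
  have h1 : ∫ θ in (0 : ℝ)..2 * Real.pi, g (circleMap 0 1 θ) ^ 2 = (2 * Real.pi : ℝ) • g 0 ^ 2 := by
    rw [← h, smul_smul, mul_inv_cancel₀ hpi.ne', one_smul]
  rw [intervalIntegral.integral_of_le hpi.le] at h1
  have h2 := enorm_integral_le_lintegral_enorm (μ := volume.restrict (Set.Ioc 0 (2 * Real.pi)))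
    (fun θ : ℝ => g (circleMap 0 1 θ) ^ 2)
  rw [h1, enorm_smul, Real.enorm_of_nonneg hpi.le] at h2
  simpa [enorm_pow] using h2

/-- Apply the circle estimate to `t ↦ f(w + tv)` for each `v` in the ball and integrate over `v`.
After Tonelli, invariance of Lebesgue measure under unimodular scalars makes the inner integral
independent of the angle, and `2π` cancels. -/
theorem enorm_sq_mul_volume_le {d : ℕ} {f : Z d → ℂ} {w : Z d} {R : ℝ}
    (hf : DifferentiableOn ℂ f (Metric.ball w R)) :
    ‖f w‖ₑ ^ 2 * volume (Metric.ball (0 : Z d) R) ≤ ∫⁻ v in Metric.ball w R, ‖f v‖ₑ ^ 2 := by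
  set B : Set (Z d) := Metric.ball 0 R with hB
  set G : Z d → ENNReal := B.indicator fun v => ‖f (w + v)‖ₑ ^ 2 with hG
  have hfB : DifferentiableOn ℂ (fun v => f (w + v)) B :=
    hf.comp (by fun_prop) fun v hv => by simpa [hB] using hv
  have hGm : Measurable G := by
    have hc : ContinuousOn (fun v => ‖f (w + v)‖ₑ ^ 2) B :=
      (ENNReal.continuous_pow 2).comp_continuousOn hfB.continuousOn.enorm
    classical
    rw [hG, ← Set.piecewise_eq_indicator]
    exact hc.measurable_piecewise continuousOn_const Metric.isOpen_ball.measurableSet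
  have hGint : ∫⁻ v, G v = ∫⁻ v in Metric.ball w R, ‖f v‖ₑ ^ 2 := by
    rw [hG, lintegral_indicator Metric.isOpen_ball.measurableSet]
    have hmp : MeasurePreserving (fun v : Z d => w + v) := measurePreserving_add_left volume w
    rw [← hmp.setLIntegral_comp_preimage_emb (measurableEmbedding_addLeft w)
      (fun v => ‖f v‖ₑ ^ 2) (Metric.ball w R)]
    congr 2
    ext v
    simp
  have hpi : (0 : ℝ) < 2 * Real.pi := by positivity
  have hpt : ∀ v : Z d, B.indicator (fun _ => ENNReal.ofReal (2 * Real.pi) * ‖f w‖ₑ ^ 2) v ≤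
      ∫⁻ θ in Set.Ioc 0 (2 * Real.pi), G (circleMap 0 1 θ • v) := by
    intro v
    by_cases hv : v ∈ B
    · rw [Set.indicator_of_mem hv]
      have hmem : ∀ t : ℂ, ‖t‖ ≤ 1 → t • v ∈ B := fun t ht => by
        rw [hB, mem_ball_zero_iff] at hv ⊢
        rw [norm_smul]
        nlinarith [norm_nonneg v]
      have hd : DifferentiableOn ℂ (fun t : ℂ => f (w + t • v)) (Metric.closedBall 0 1) :=
        hfB.comp (by fun_prop) fun t ht => hmem t (by simpa using ht)
      have hdc : DiffContOnCl ℂ (fun t : ℂ => f (w + t • v)) (Metric.ball 0 1) := by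
        refine ⟨hd.mono Metric.ball_subset_closedBall, ?_⟩
        rw [closure_ball _ one_ne_zero]
        exact hd.continuousOn
      have h := enorm_sq_mul_le_circle hdc
      simp only [zero_smul, add_zero] at h
      refine h.trans (le_of_eq ?_)
      refine lintegral_congr fun θ => ?_
      rw [hG, Set.indicator_of_mem (hmem _ (by simp))]
    · rw [Set.indicator_of_notMem hv]; exact zero_le
  have hint := lintegral_mono (μ := volume) hpt
  rw [lintegral_indicator Metric.isOpen_ball.measurableSet, setLIntegral_const,
    lintegral_lintegral_swap] at hint
  · have hrot : ∀ θ : ℝ, ∫⁻ v : Z d, G (circleMap 0 1 θ • v) = ∫⁻ v, G v := fun θ =>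
      (measurePreserving_smul_circle (by simp)).lintegral_comp hGm
    simp only [hrot, lintegral_const, Measure.restrict_apply MeasurableSet.univ, Set.univ_inter,
      Real.volume_Ioc, sub_zero] at hint
    rw [mul_assoc, mul_comm (∫⁻ v, G v),
      ENNReal.mul_le_mul_iff_right (by simpa using hpi) ENNReal.ofReal_ne_top, hGint] at hint
    exact hint
  · refine Measurable.aemeasurable (hGm.comp ?_)
    have : Continuous fun p : Z d × ℝ => circleMap 0 1 p.2 • p.1 :=
      ((continuous_circleMap 0 1).comp continuous_snd).smul continuous_fst
    exact this.measurable

/-! ### Cauchy estimates -/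

/-- Cauchy's estimate on the circle of radius `1/16` bounds the derivative by one value of `f`, at a
maximum point. The ball of radius `1/8` about that point lies in the ball of radius `1/4`, where the
sub-mean value property applies. -/
theorem enorm_iteratedDeriv_sq_le {d : ℕ} (k : ℕ) {f : Z d → ℂ} {ζ : Z d} (hζ : ‖ζ‖ ≤ 1)
    (hf : DifferentiableOn ℂ f (Metric.ball 0 (1 / 4))) :
    ‖iteratedDeriv k (fun t : ℂ => f (t • ζ)) 0‖ₑ ^ 2 *
      volume (Metric.ball (0 : Z d) (1 / 8)) ≤
      ENNReal.ofReal (k.factorial * 16 ^ k) ^ 2 *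
        ∫⁻ w in Metric.ball (0 : Z d) (1 / 4), ‖f w‖ₑ ^ 2 := by
  have hmem : ∀ t : ℂ, ‖t‖ ≤ 1 / 16 → ‖t • ζ‖ ≤ 1 / 16 := fun t ht => by
    rw [norm_smul]
    nlinarith [norm_nonneg ζ, norm_nonneg t]
  have hd : DifferentiableOn ℂ (fun t : ℂ => f (t • ζ)) (Metric.closedBall 0 (1 / 16)) :=
    hf.comp (by fun_prop) fun t ht => by
      have := hmem t (by simpa using ht)
      rw [mem_ball_zero_iff]; linarith
  have hdc : DiffContOnCl ℂ (fun t : ℂ => f (t • ζ)) (Metric.ball 0 (1 / 16)) := by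
    refine ⟨hd.mono Metric.ball_subset_closedBall, ?_⟩
    rw [closure_ball _ (by norm_num)]
    exact hd.continuousOn
  obtain ⟨t₀, ht₀, hmax⟩ := (isCompact_sphere (0 : ℂ) (1 / 16)).exists_isMaxOn
    (NormedSpace.sphere_nonempty.2 (by norm_num))
    (hd.continuousOn.norm.mono Metric.sphere_subset_closedBall)
  have hc := Complex.norm_iteratedDeriv_le_of_forall_mem_sphere_norm_le k (by norm_num) hdc
    fun z hz => hmax hz
  have hc' : ‖iteratedDeriv k (fun t : ℂ => f (t • ζ)) 0‖ₑ ≤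
      ENNReal.ofReal (k.factorial * 16 ^ k) * ‖f (t₀ • ζ)‖ₑ := by
    rw [← ofReal_norm, ← ofReal_norm, ← ENNReal.ofReal_mul (by positivity)]
    refine ENNReal.ofReal_le_ofReal (hc.trans (le_of_eq ?_))
    simp only [one_div, inv_pow, div_inv_eq_mul]
    ring
  have hsub : Metric.ball (t₀ • ζ) (1 / 8) ⊆ Metric.ball (0 : Z d) (1 / 4) := by
    apply Metric.ball_subset_ball'
    have := hmem t₀ (by simpa using (mem_sphere_zero_iff_norm.1 ht₀).le)
    rw [dist_zero_right]; linarith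
  calc _ ≤ (ENNReal.ofReal (k.factorial * 16 ^ k) * ‖f (t₀ • ζ)‖ₑ) ^ 2 *
        volume (Metric.ball (0 : Z d) (1 / 8)) := by gcongr
    _ = ENNReal.ofReal (k.factorial * 16 ^ k) ^ 2 * (‖f (t₀ • ζ)‖ₑ ^ 2 *
        volume (Metric.ball (0 : Z d) (1 / 8))) := by ring
    _ ≤ _ := by
      gcongr
      exact (enorm_sq_mul_volume_le (hf.mono hsub)).trans (lintegral_mono_set hsub)

theorem iteratedDeriv_comp_line {d : ℕ} {f : Z d → ℂ} (hf : DifferentiableOn ℂ f (D d))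
    (z ζ : Z d) (k : ℕ) : ∀ t : ℂ, z + t • ζ ∈ D d →
      iteratedDeriv k (fun t : ℂ => f (z + t • ζ)) t = (dirD ζ)^[k] f (z + t • ζ) := by
  induction k with
  | zero => intro t _; simp
  | succ k ih =>
    intro t ht
    have hc : Continuous fun t : ℂ => z + t • ζ := by fun_prop
    have hnear : ∀ᶠ s in 𝓝 t, z + s • ζ ∈ D d := hc.continuousAt.eventually (D_mem_nhds ht)
    rw [iteratedDeriv_succ, Filter.EventuallyEq.deriv_eq (hnear.mono ih),
      Function.iterate_succ_apply']
    exact (hasDerivAt_comp_line (differentiableOn_dirD_iterate hf ζ k) z ζ t ht).deriv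

/-- In the chart `w ↦ x + B_{x,x}^{1/2}w`, the `k`-th derivative at `0` along `ζ` of `Φ` evaluated
at the fixed vector `η = B_{x,x}^{1/2}ζ` is the left-hand quantity. Working in the chart makes the
constant independent of `x`. -/
theorem exists_enorm_shiftD_sq_le (d k : ℕ) : ∃ C : ENNReal, C ≠ ⊤ ∧
    ∀ (V : Submodule ℂ (Z d → ℂ)) (Φ : Z d → Z d → ℂ), IsHolomorphicMap V Φ →
      ∀ x ∈ D d, ∀ ζ : Z d, ‖ζ‖ ≤ 1 →
        ‖(shiftD^[k] Φ) x (bergmanSqrt x ζ)‖ₑ ^ 2 ≤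
          C * ∫⁻ w in Metric.ball (0 : Z d) (1 / 4),
            ‖Φ (x + bergmanSqrt x w) (bergmanSqrt x ζ)‖ₑ ^ 2 := by
  have hv : volume (Metric.ball (0 : Z d) (1 / 8)) ≠ 0 :=
    (Metric.measure_ball_pos _ _ (by norm_num)).ne'
  have hv' : volume (Metric.ball (0 : Z d) (1 / 8)) ≠ ⊤ := measure_ball_lt_top.ne
  refine ⟨ENNReal.ofReal (k.factorial * 16 ^ k) ^ 2 / volume (Metric.ball (0 : Z d) (1 / 8)),
    ENNReal.div_ne_top (ENNReal.pow_ne_top ENNReal.ofReal_ne_top) hv, fun V Φ hΦ x hx ζ hζ => ?_⟩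
  set η := bergmanSqrt x ζ with hη
  have hf : DifferentiableOn ℂ (fun w => Φ (x + bergmanSqrt x w) η) (Metric.ball 0 (1 / 4)) := by
    have h1 : Differentiable ℂ fun w => x + bergmanSqrt x w :=
      (bergmanSqrtL x).differentiable.const_add x
    exact (hΦ.2 η).comp h1.differentiableOn fun w hw =>
      (near_add_bergmanSqrt hx (by simpa using hw)).1
  have h := enorm_iteratedDeriv_sq_le k hζ hf
  have h2 := iteratedDeriv_comp_line (hΦ.2 η) x η k 0 (by simpa using hx)
  simp only [bergmanSqrt_smul, ← hη] at h
  rw [h2] at h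
  simp only [zero_smul, add_zero] at h
  rw [shiftD_iterate, ← ENNReal.mul_div_right_comm, ENNReal.le_div_iff_mul_le (Or.inl hv)
    (Or.inl hv')]
  exact h

/-! ### Lower bound for the Fischer-Fock norm -/

/-- The matrix of `B_{x,x}^{1/2}`. -/
def bergmanSqrtMatrix {d : ℕ} (x : Z d) : Matrix (Fin d) (Fin d) ℂ :=
  Matrix.of fun i j => bergmanSqrt x (EuclideanSpace.single j 1) i

theorem bergmanSqrtMatrix_mulVec {d : ℕ} (x ζ : Z d) :
    (bergmanSqrtMatrix x).mulVec (fun i => ζ i) = fun i => bergmanSqrt x ζ i := by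
  have h : ζ = ∑ i : Fin d, ζ i • EuclideanSpace.single i (1 : ℂ) := by
    ext j
    simp [Finset.sum_apply, Pi.single_apply]
  funext i
  have h2 : bergmanSqrt x ζ = ∑ j, ζ j • bergmanSqrt x (EuclideanSpace.single j 1) := by
    conv_lhs => rw [h]
    rw [← bergmanSqrtL_apply, map_sum]
    simp only [map_smul, bergmanSqrtL_apply]
  rw [h2]
  simp [Matrix.mulVec, dotProduct, bergmanSqrtMatrix, mul_comm]

theorem bergmanSqrtMatrix_conjTranspose {d : ℕ} (x : Z d) :
    (bergmanSqrtMatrix x).conjTranspose = bergmanSqrtMatrix x := by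
  ext i j
  have h := inner_bergmanSqrt_left x (EuclideanSpace.single i 1) (EuclideanSpace.single j 1)
  rw [EuclideanSpace.inner_single_left] at h
  rw [← inner_conj_symm, EuclideanSpace.inner_single_left] at h
  simpa [bergmanSqrtMatrix, Matrix.conjTranspose_apply] using h

theorem polyFun_linSubst_bergmanSqrtMatrix {d : ℕ} (x : Z d) (p : MvPolynomial (Fin d) ℂ)
    (ζ : Z d) : polyFun d (linSubst (bergmanSqrtMatrix x) p) ζ = polyFun d p (bergmanSqrt x ζ) := by
  rw [polyFun_apply, eval_linSubst, bergmanSqrtMatrix_mulVec, polyFun_apply]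

/-- Composition with `B_{x,x}^{1/2}` is self-adjoint for the Fischer-Fock form, since its matrix is
Hermitian. The little density is thereby a squared norm. -/
theorem fischer_comp_bergman {d : ℕ} {x : Z d} (hx : x ∈ D d) (p : MvPolynomial (Fin d) ℂ) :
    fischer (polyFun d p) (fun ω => polyFun d p (bergman x x ω)) =
      fischer (fun ω => polyFun d p (bergmanSqrt x ω))
        (fun ω => polyFun d p (bergmanSqrt x ω)) := by
  set M := bergmanSqrtMatrix x
  have h1 : (fun ω => polyFun d p (bergman x x ω)) = polyFun d (linSubst M (linSubst M p)) := by
    funext ω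
    rw [polyFun_linSubst_bergmanSqrtMatrix, polyFun_linSubst_bergmanSqrtMatrix,
      bergmanSqrt_bergmanSqrt x ω hx]
  have h2 : (fun ω => polyFun d p (bergmanSqrt x ω)) = polyFun d (linSubst M p) := by
    funext ω; rw [polyFun_linSubst_bergmanSqrtMatrix]
  rw [h1, h2, ← fischerForm_apply, fischerForm_linSubst, bergmanSqrtMatrix_conjTranspose]
  rfl

theorem fischer_self_eq {d : ℕ} (φ : Z d → ℂ) :
    fischer φ φ = ((∫ ω : Z d, Real.exp (-‖ω‖ ^ 2) / Real.pi ^ d * ‖φ ω‖ ^ 2 : ℝ) : ℂ) := by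
  rw [← integral_complex_ofReal, fischer]
  congr 1
  funext ω
  rw [Complex.conj_mul']
  push_cast
  rfl

/-- The sub-mean value property on the unit ball about `ζ`, where the Gaussian weight is at least
`exp(-11²)/π^d`. The radius `10` is the constant of `Near.norm_bergmanSqrtInv_bergmanSqrt_le`; the
bound does not depend on the degree. -/
theorem exists_enorm_sq_le_fischer (d : ℕ) : ∃ C : ENNReal, C ≠ ⊤ ∧
    ∀ p : MvPolynomial (Fin d) ℂ, ∀ ζ : Z d, ‖ζ‖ ≤ 10 →
      ‖polyFun d p ζ‖ₑ ^ 2 ≤ C * ENNReal.ofReal (fischer (polyFun d p) (polyFun d p)).re := by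
  have hv : volume (Metric.ball (0 : Z d) 1) ≠ 0 :=
    (Metric.measure_ball_pos _ _ (by norm_num)).ne'
  have hv' : volume (Metric.ball (0 : Z d) 1) ≠ ⊤ := measure_ball_lt_top.ne
  refine ⟨ENNReal.ofReal (Real.exp (11 ^ 2) * Real.pi ^ d) / volume (Metric.ball (0 : Z d) 1),
    ENNReal.div_ne_top (by simp) hv, fun p ζ hζ => ?_⟩
  rw [← ENNReal.mul_div_right_comm, ENNReal.le_div_iff_mul_le (Or.inl hv) (Or.inl hv')]
  refine (enorm_sq_mul_volume_le (differentiable_polyFun p).differentiableOn).trans ?_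
  rw [fischer_self_eq, Complex.ofReal_re]
  have hint : Integrable fun ω : Z d => Real.exp (-‖ω‖ ^ 2) / Real.pi ^ d * ‖polyFun d p ω‖ ^ 2 := by
    refine (integrable_fischer p p).norm.congr (Filter.Eventually.of_forall fun ω => ?_)
    simp only [norm_mul, Complex.norm_conj, Complex.norm_real]
    rw [Real.norm_of_nonneg (by positivity)]
    ring
  rw [ofReal_integral_eq_lintegral_ofReal hint
    (Filter.Eventually.of_forall fun ω => by positivity),
    ← lintegral_const_mul' _ _ ENNReal.ofReal_ne_top]
  refine (setLIntegral_mono' Metric.isOpen_ball.measurableSet fun ω hω => ?_).trans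
    (setLIntegral_le_lintegral (Metric.ball ζ 1) _)
  rw [← ENNReal.ofReal_mul (by positivity), ← ofReal_norm,
    ← ENNReal.ofReal_pow (norm_nonneg _)]
  refine ENNReal.ofReal_le_ofReal ?_
  have hω' : ‖ω‖ ≤ 11 := by
    rw [mem_ball_iff_norm] at hω
    have := norm_le_norm_add_norm_sub' ω ζ
    linarith
  have hexp : 1 ≤ Real.exp (11 ^ 2) * Real.exp (-‖ω‖ ^ 2) := by
    rw [← Real.exp_add]
    exact Real.one_le_exp (by nlinarith [norm_nonneg ω])
  have hpi := Real.pi_pos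
  calc ‖polyFun d p ω‖ ^ 2 = 1 * ‖polyFun d p ω‖ ^ 2 := (one_mul _).symm
    _ ≤ (Real.exp (11 ^ 2) * Real.exp (-‖ω‖ ^ 2)) * ‖polyFun d p ω‖ ^ 2 := by gcongr
    _ = _ := by field_simp

/-! ### The transported operator -/

theorem homPoly_comp_bergmanSqrt {d k : ℕ} {φ : Z d → ℂ} (hφ : φ ∈ homPoly d k) (x : Z d) :
    (fun ζ => φ (bergmanSqrt x ζ)) ∈ homPoly d k := by
  obtain ⟨p, hp, rfl⟩ := hφ
  refine ⟨linSubst (bergmanSqrtMatrix x) p, ?_,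
    funext fun ζ => polyFun_linSubst_bergmanSqrtMatrix x p ζ⟩
  have h := MvPolynomial.IsHomogeneous.aeval (n := 1)
    ((MvPolynomial.mem_homogeneousSubmodule _ _).1 hp)
    (fun i => ∑ j, MvPolynomial.C (bergmanSqrtMatrix x i j) * MvPolynomial.X j)
    (fun i => MvPolynomial.IsHomogeneous.sum _ _ _ fun j _ =>
      MvPolynomial.isHomogeneous_C_mul_X _ _)
  rw [one_mul] at h
  exact h

theorem one_mem_polyLE (d n : ℕ) : (1 : Z d → ℂ) ∈ polyLE d n :=
  ⟨1, by simp [MvPolynomial.mem_restrictTotalDegree], by ext; simp [polyFun_apply]⟩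

theorem one_add_inner_pow_mem {d : ℕ} (x : Z d) (k : ℕ) :
    (fun ζ : Z d => (1 + inner ℂ x ζ) ^ k) ∈ polyLE d k := by
  induction k with
  | zero => simp only [pow_zero]; exact one_mem_polyLE d 0
  | succ k ih =>
    have h1 : (fun ζ : Z d => 1 + inner ℂ x ζ) ∈ polyLE d 1 := by
      have e : (fun ζ : Z d => 1 + inner ℂ x ζ) =
          (1 : Z d → ℂ) + ∑ i, starRingEnd ℂ (x i) • fun ζ : Z d => ζ i := by
        funext ζ
        simp [PiLp.inner_apply, mul_comm]
      rw [e]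
      exact Submodule.add_mem _ (one_mem_polyLE d 1) (Submodule.sum_mem _ fun i _ =>
        Submodule.smul_mem _ _ (homPoly_le_polyLE le_rfl (coord_mem_homPoly i)))
    exact polyLE_mul ih h1

/-- The polynomial `ζ ↦ Δ_{ζ,-x}^n (I_l Φ)_x(B_{x,x}^{1/2} ζ^{-x})`. -/
def transportedOp {d : ℕ} (ν : ℝ) (l n : ℕ) (Φ : Z d → Z d → ℂ) (x ζ : Z d) : ℂ :=
  ∑ k ∈ Finset.range (n - l + 1),
    poch ((l : ℂ) - n) k / poch (2 * (l : ℂ) + ν) k / (k.factorial : ℂ) *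
      ((1 + inner ℂ x ζ) ^ (n - l - k) * (shiftD^[k] Φ) x (bergmanSqrt x ζ))

section Transport

variable {d l n : ℕ} {ν : ℝ} {Φ : Z d → Z d → ℂ}

theorem transportedOp_mem (hl : l ≤ n) (hΦ : IsHolomorphicMap (homPoly d l) Φ) {x : Z d}
    (hx : x ∈ D d) : transportedOp ν l n Φ x ∈ polyLE d n := by
  have e : transportedOp ν l n Φ x = ∑ k ∈ Finset.range (n - l + 1),
      (poch ((l : ℂ) - n) k / poch (2 * (l : ℂ) + ν) k / (k.factorial : ℂ)) •
        ((fun ζ : Z d => (1 + inner ℂ x ζ) ^ (n - l - k)) *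
          fun ζ => (shiftD^[k] Φ) x (bergmanSqrt x ζ)) := by
    funext ζ; simp [transportedOp]
  rw [e]
  refine Submodule.sum_mem _ fun k hk => Submodule.smul_mem _ _ ?_
  have hk' : k ≤ n - l := by simpa [Nat.lt_succ_iff] using hk
  exact polyLE_mono (by omega) (polyLE_mul (one_add_inner_pow_mem x _)
    (homPoly_le_polyLE le_rfl (homPoly_comp_bergmanSqrt ((hΦ.shiftD_iterate k).1 x hx) x)))

theorem continuousOn_transportedOp (hΦ : IsHolomorphicMap (homPoly d l) Φ) (ζ : Z d) :
    ContinuousOn (fun x => transportedOp ν l n Φ x ζ) (D d) := by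
  unfold transportedOp
  have hdef : Continuous fun x : Z d => defect x := by unfold defect; fun_prop
  have hA : Continuous fun x : Z d => bergmanSqrt x ζ := by
    simp only [bergmanSqrt_eq]
    have h2 : Continuous fun x : Z d => inner ℂ x ζ / (1 + (defect x : ℂ)) :=
      (continuous_id.inner continuous_const).div (by fun_prop) one_add_defect_ne_zero
    exact (Complex.continuous_ofReal.comp hdef).smul
      (continuous_const.sub (h2.smul continuous_id))
  refine continuousOn_finsetSum _ fun k _ => ContinuousOn.mul continuousOn_const
    (ContinuousOn.mul ?_ ?_)
  · exact ((continuous_const.add (continuous_id.inner continuous_const)).pow _).continuousOn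
  · exact (hΦ.shiftD_iterate k).continuousOn.comp (continuousOn_id.prodMk hA.continuousOn)
      fun x hx => ⟨hx, trivial⟩

/-- By homogeneity of degree `l + k`, the quasi-inverse contributes `(1+(ζ|x))^{-l-k}`, absorbed by
the factor of power `n`; the result is a polynomial, hence the continuous extension. -/
theorem transport_ballOp (hl : l ≤ n) (hΦ : IsHolomorphicMap (homPoly d l) Φ) {x : Z d}
    (hx : x ∈ D d) : transport n x (ballOp ν l n Φ x) = transportedOp ν l n Φ x := by
  have hq : ∀ ζ : Z d, quasiDet ζ (-x) = 1 + inner ℂ x ζ := fun ζ => by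
    simp [quasiDet, sp, inner_neg_left]
  have hcont : Continuous (transportedOp ν l n Φ x) := by
    obtain ⟨p, -, hp⟩ := transportedOp_mem (ν := ν) hl hΦ hx
    rw [← hp]; exact (differentiable_polyFun p).continuous
  funext ζ
  refine extendFrom_eq ?_ ?_
  · -- the complement of an affine hyperplane is dense
    by_cases h : quasiDet ζ (-x) ≠ 0
    · exact subset_closure h
    rw [not_not, hq] at h
    have h' : inner ℂ x ζ = -1 := eq_neg_of_add_eq_zero_right h
    -- When `(ζ|x) = -1`, the quasi-determinant at `ζ + tζ` is `-t`, so the hyperplane is left at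
    -- once.
    have hc : Filter.Tendsto (fun t : ℂ => ζ + t • ζ) (𝓝[≠] 0) (𝓝 ζ) := by
      have : Continuous fun t : ℂ => ζ + t • ζ := by fun_prop
      simpa using (this.tendsto 0).mono_left nhdsWithin_le_nhds
    refine mem_closure_of_tendsto hc ?_
    filter_upwards [self_mem_nhdsWithin] with t ht
    rw [hq, inner_add_right, inner_smul_right, h']
    simpa using ht
  · refine ((hcont.tendsto ζ).mono_left nhdsWithin_le_nhds).congr' ?_
    filter_upwards [self_mem_nhdsWithin] with w hw
    replace hw : quasiDet w (-x) ≠ 0 := hw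
    rw [hq] at hw
    rw [hq, quasiInv, hq, bergmanSqrt_smul, ballOp, transportedOp, Finset.mul_sum]
    refine Finset.sum_congr rfl fun k hk => ?_
    have hk' : k ≤ n - l := by simpa [Nat.lt_succ_iff] using hk
    rw [(hΦ.shiftD_iterate k).comp_smul hx]
    have e4 : (1 + inner ℂ x w) ^ n = (1 + inner ℂ x w) ^ (n - l - k) *
        (1 + inner ℂ x w) ^ (l + k) := by
      rw [← pow_add]; congr 1; omega
    have e5 : (1 + inner ℂ x w) ^ (l + k) * ((1 + inner ℂ x w)⁻¹) ^ (l + k) = 1 := by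
      rw [← mul_pow, mul_inv_cancel₀ hw, one_pow]
    rw [e4]
    linear_combination (-(poch ((l : ℂ) - n) k / poch (2 * (l : ℂ) + ν) k / (k.factorial : ℂ) *
      ((1 + inner ℂ x w) ^ (n - l - k) * (shiftD^[k] Φ) x (bergmanSqrt x w)))) * e5

end Transport

/-! ### Bounds for the integrands -/

/-- Interpolation reduces the form to point values. The nodes can be taken in the ball, where the
Cauchy estimates with `‖ζ‖ ≤ 1` are available. -/
theorem exists_inner_bound {d n : ℕ} (H : (Z d → ℂ) →ₗ⋆[ℂ] (Z d → ℂ) →ₗ[ℂ] ℂ) :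
    ∃ (m : ℕ) (ζ : Fin m → Z d) (K : Fin m → Fin m → ℂ), (∀ i, ζ i ∈ D d) ∧
      ∀ q ∈ polyLE d n, H q q = ∑ i, ∑ j, starRingEnd ℂ (q (ζ i)) * q (ζ j) * K i j := by
  obtain ⟨m, ζ, e, hζ, -, hrep⟩ := exists_interpolation (D d) (polyLE d n)
    fun v hv h => eq_zero_of_eqOn_ball hv h
  refine ⟨m, ζ, fun i j => H (e i) (e j), hζ, fun q hq => ?_⟩
  conv_lhs => rw [hrep q hq]
  simp only [map_sum, LinearMap.sum_apply, map_smulₛₗ, LinearMap.smul_apply, smul_eq_mul,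
    RingHom.id_apply, Finset.mul_sum]
  rw [Finset.sum_comm]
  refine Finset.sum_congr rfl fun i _ => Finset.sum_congr rfl fun j _ => ?_
  ring

theorem enorm_sum_sq_le {ι : Type*} (s : Finset ι) (f : ι → ℂ) :
    ‖∑ i ∈ s, f i‖ₑ ^ 2 ≤ s.card * ∑ i ∈ s, ‖f i‖ₑ ^ 2 := by
  have h1 : ‖∑ i ∈ s, f i‖ ^ 2 ≤ s.card * ∑ i ∈ s, ‖f i‖ ^ 2 :=
    (pow_le_pow_left₀ (norm_nonneg _) (norm_sum_le s f) 2).trans sq_sum_le_card_mul_sum_sq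
  have h2 := ENNReal.ofReal_le_ofReal h1
  rw [ENNReal.ofReal_mul (by positivity), ENNReal.ofReal_sum_of_nonneg fun i _ => by positivity,
    ENNReal.ofReal_natCast, ENNReal.ofReal_pow (norm_nonneg _), ofReal_norm] at h2
  simpa only [ENNReal.ofReal_pow (norm_nonneg _), ofReal_norm] using h2

theorem enorm_mul_le_sum_sq {m : ℕ} (q : Fin m → ℂ) (i j : Fin m) :
    ‖q i‖ₑ * ‖q j‖ₑ ≤ ∑ k, ‖q k‖ₑ ^ 2 := by
  wlog h : ‖q i‖ₑ ≤ ‖q j‖ₑ generalizing i j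
  · rw [mul_comm]; exact this j i (not_le.1 h).le
  calc ‖q i‖ₑ * ‖q j‖ₑ ≤ ‖q j‖ₑ ^ 2 := by rw [sq]; gcongr
    _ ≤ _ := Finset.single_le_sum (f := fun k => ‖q k‖ₑ ^ 2) (fun _ _ => zero_le)
      (Finset.mem_univ j)

theorem enorm_form_le {m : ℕ} (K : Fin m → Fin m → ℂ) (q : Fin m → ℂ) :
    ‖∑ i, ∑ j, starRingEnd ℂ (q i) * q j * K i j‖ₑ ≤
      (∑ i, ∑ j, ‖K i j‖ₑ) * ∑ k, ‖q k‖ₑ ^ 2 := by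
  refine (enorm_sum_le _ _).trans ?_
  rw [Finset.sum_mul]
  refine Finset.sum_le_sum fun i _ => (enorm_sum_le _ _).trans ?_
  rw [Finset.sum_mul]
  refine Finset.sum_le_sum fun j _ => ?_
  rw [enorm_mul, enorm_mul, RCLike.enorm_conj, mul_comm]
  gcongr
  exact enorm_mul_le_sum_sq q i j

theorem weight_eq {d : ℕ} {x : Z d} (hx : x ∈ D d) (ν : ℝ) :
    weight ν x = (((defect x ^ 2) ^ (ν - genus d) : ℝ) : ℂ) := by
  rw [weight, defect_sq hx]

theorem Near.rpow_le {d : ℕ} {x y : Z d} (hx : x ∈ D d) (hy : y ∈ D d) (h : Near x y) (e : ℝ) :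
    (defect x ^ 2) ^ e ≤ 4 ^ |e| * (defect y ^ 2) ^ e := by
  have hsx := defect_pos hx
  have hsy := defect_pos hy
  have h1 : (defect x ^ 2) ≤ 4 * defect y ^ 2 := by nlinarith [h.left_le]
  have h2 : (defect y ^ 2) ≤ 4 * defect x ^ 2 := by nlinarith [h.right_le]
  rcases le_or_gt 0 e with he | he
  · rw [abs_of_nonneg he, ← Real.mul_rpow (by norm_num) (by positivity)]
    exact Real.rpow_le_rpow (by positivity) h1 he
  · rw [abs_of_neg he, Real.rpow_neg (by norm_num), inv_mul_eq_div, le_div_iff₀ (by positivity),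
      ← Real.mul_rpow (by positivity) (by norm_num)]
    exact Real.rpow_le_rpow_of_nonpos (by positivity) (by linarith) he.le

/-- The squared norm density of the little space. -/
def littleDensity {d : ℕ} (ν : ℝ) (Φ : Z d → Z d → ℂ) (y : Z d) : ℝ :=
  (littleIntegrand ν Φ Φ y).re

section Density

variable {d l n : ℕ} {ν : ℝ} {Φ : Z d → Z d → ℂ}

theorem littleIntegrand_eq (hΦ : IsHolomorphicMap (homPoly d l) Φ) {y : Z d} (hy : y ∈ D d) :
    littleIntegrand ν Φ Φ y = (((defect y ^ 2) ^ (ν - genus d) *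
      (fischer (fun ω => Φ y (bergmanSqrt y ω)) (fun ω => Φ y (bergmanSqrt y ω))).re : ℝ) : ℂ) := by
  obtain ⟨p, -, hp⟩ := hΦ.1 y hy
  rw [littleIntegrand, weight_eq hy, ← hp, fischer_comp_bergman hy, fischer_self_eq,
    Complex.ofReal_re]
  push_cast
  rfl

theorem littleDensity_nonneg (hΦ : IsHolomorphicMap (homPoly d l) Φ) {y : Z d} (hy : y ∈ D d) :
    0 ≤ littleDensity ν Φ y := by
  rw [littleDensity, littleIntegrand_eq hΦ hy, Complex.ofReal_re, fischer_self_eq,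
    Complex.ofReal_re]
  have := defect_pos hy
  refine mul_nonneg (by positivity) (integral_nonneg fun ω => by positivity)

/-- Change of base point from `x` to `y = x + B_{x,x}^{1/2}w`: write `B_{x,x}^{1/2}ζ =
B_{y,y}^{1/2}ζ'` with `‖ζ'‖ ≤ 10`, bound the value at `ζ'` by the Fischer-Fock norm, and compare the
weights. -/
theorem exists_weight_mul_enorm_sq_le (d : ℕ) (ν : ℝ) : ∃ C : ENNReal, C ≠ ⊤ ∧
    ∀ (l : ℕ) (Φ : Z d → Z d → ℂ), IsHolomorphicMap (homPoly d l) Φ → ∀ x ∈ D d,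
      ∀ w ζ : Z d, ‖w‖ < 1 / 4 → ‖ζ‖ ≤ 1 →
        ENNReal.ofReal ((defect x ^ 2) ^ (ν - genus d)) *
          ‖Φ (x + bergmanSqrt x w) (bergmanSqrt x ζ)‖ₑ ^ 2 ≤
          C * ENNReal.ofReal (littleDensity ν Φ (x + bergmanSqrt x w)) := by
  obtain ⟨C, hC, hfis⟩ := exists_enorm_sq_le_fischer d
  refine ⟨ENNReal.ofReal (4 ^ |ν - genus d|) * C, ENNReal.mul_ne_top ENNReal.ofReal_ne_top hC,
    fun l Φ hΦ x hx w ζ hw hζ => ?_⟩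
  obtain ⟨hy, hnear⟩ := near_add_bergmanSqrt hx hw
  set y := x + bergmanSqrt x w
  have hsy := defect_pos hy
  set ζ' := bergmanSqrtInv y (bergmanSqrt x ζ) with hζ'
  have e : bergmanSqrt x ζ = bergmanSqrt y ζ' := (bergmanSqrt_bergmanSqrtInv hy _).symm
  have hn : ‖ζ'‖ ≤ 10 := (hnear.norm_bergmanSqrtInv_bergmanSqrt_le hx hy ζ).trans (by linarith)
  obtain ⟨p, -, hp⟩ := homPoly_comp_bergmanSqrt (hΦ.1 y hy) y
  have h1 := hfis p ζ' hn
  rw [hp] at h1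
  rw [e, littleDensity, littleIntegrand_eq hΦ hy, Complex.ofReal_re,
    ENNReal.ofReal_mul (by positivity)]
  calc _ ≤ ENNReal.ofReal (4 ^ |ν - genus d| * (defect y ^ 2) ^ (ν - genus d)) *
        (C * ENNReal.ofReal (fischer (fun ω => Φ y (bergmanSqrt y ω))
          (fun ω => Φ y (bergmanSqrt y ω))).re) := by
        gcongr
        exact hnear.rpow_le hx hy _
    _ = _ := by
        rw [ENNReal.ofReal_mul (by positivity)]
        ring

end Density

/-! ### Boundedness -/

theorem exists_weight_mul_transportedOp_le (d l n : ℕ) (ν : ℝ) : ∃ C : ENNReal, C ≠ ⊤ ∧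
    ∀ Φ : Z d → Z d → ℂ, IsHolomorphicMap (homPoly d l) Φ → ∀ x ∈ D d, ∀ ζ : Z d, ‖ζ‖ ≤ 1 →
      ENNReal.ofReal ((defect x ^ 2) ^ (ν - genus d)) * ‖transportedOp ν l n Φ x ζ‖ₑ ^ 2 ≤
        C * ∫⁻ w in Metric.ball (0 : Z d) (1 / 4),
          ENNReal.ofReal (littleDensity ν Φ (x + bergmanSqrt x w)) := by
  choose A hA hAle using exists_enorm_shiftD_sq_le d
  obtain ⟨B, hB, hBle⟩ := exists_weight_mul_enorm_sq_le d ν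
  set c : ℕ → ℂ := fun k =>
    poch ((l : ℂ) - n) k / poch (2 * (l : ℂ) + ν) k / (k.factorial : ℂ) with hc
  refine ⟨(n - l + 1 : ℕ) * ∑ k ∈ Finset.range (n - l + 1),
    ‖c k‖ₑ ^ 2 * ((2 ^ (n - l - k)) ^ 2 * (A k * B)), ?_, fun Φ hΦ x hx ζ hζ => ?_⟩
  · refine ENNReal.mul_ne_top (ENNReal.natCast_ne_top _) (ENNReal.sum_ne_top.2 fun k _ => ?_)
    exact ENNReal.mul_ne_top (ENNReal.pow_ne_top enorm_ne_top)
      (ENNReal.mul_ne_top (by simp) (ENNReal.mul_ne_top (hA k) hB))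
  set J := ∫⁻ w in Metric.ball (0 : Z d) (1 / 4),
    ENNReal.ofReal (littleDensity ν Φ (x + bergmanSqrt x w))
  set ω := ENNReal.ofReal ((defect x ^ 2) ^ (ν - genus d))
  have hω : ω ≠ ⊤ := ENNReal.ofReal_ne_top
  have h1 : ‖1 + inner ℂ x ζ‖ₑ ≤ 2 := by
    have h : ‖1 + inner ℂ x ζ‖ ≤ 2 := by
      refine (norm_add_le _ _).trans ?_
      have := norm_inner_le_norm (𝕜 := ℂ) x ζ
      rw [norm_one]
      nlinarith [norm_lt_one_of_mem hx, norm_nonneg x, norm_nonneg ζ]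
    rw [← ofReal_norm]
    exact (ENNReal.ofReal_le_ofReal h).trans (by simp)
  have h2 : ∀ k, ω * ‖(shiftD^[k] Φ) x (bergmanSqrt x ζ)‖ₑ ^ 2 ≤ A k * B * J := fun k =>
    calc _ ≤ ω * (A k * ∫⁻ w in Metric.ball (0 : Z d) (1 / 4),
          ‖Φ (x + bergmanSqrt x w) (bergmanSqrt x ζ)‖ₑ ^ 2) := by
          gcongr
          exact hAle k _ Φ hΦ x hx ζ hζ
      _ = A k * ∫⁻ w in Metric.ball (0 : Z d) (1 / 4),
          ω * ‖Φ (x + bergmanSqrt x w) (bergmanSqrt x ζ)‖ₑ ^ 2 := by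
          rw [lintegral_const_mul' _ _ hω]; ring
      _ ≤ A k * ∫⁻ w in Metric.ball (0 : Z d) (1 / 4),
          B * ENNReal.ofReal (littleDensity ν Φ (x + bergmanSqrt x w)) := by
          gcongr A k * ?_
          exact setLIntegral_mono' Metric.isOpen_ball.measurableSet fun w hw =>
            hBle l Φ hΦ x hx w ζ (by simpa using hw) hζ
      _ = _ := by rw [lintegral_const_mul' _ _ hB, mul_assoc]
  calc ω * ‖transportedOp ν l n Φ x ζ‖ₑ ^ 2
      ≤ ω * ((n - l + 1 : ℕ) * ∑ k ∈ Finset.range (n - l + 1),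
        ‖c k * ((1 + inner ℂ x ζ) ^ (n - l - k) *
          (shiftD^[k] Φ) x (bergmanSqrt x ζ))‖ₑ ^ 2) := by
        gcongr
        refine (enorm_sum_sq_le _ _).trans ?_
        rw [Finset.card_range]
    _ = (n - l + 1 : ℕ) * ∑ k ∈ Finset.range (n - l + 1),
        ‖c k‖ₑ ^ 2 * ((‖1 + inner ℂ x ζ‖ₑ ^ (n - l - k)) ^ 2 *
          (ω * ‖(shiftD^[k] Φ) x (bergmanSqrt x ζ)‖ₑ ^ 2)) := by
        rw [mul_left_comm, Finset.mul_sum]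
        congr 1
        refine Finset.sum_congr rfl fun k _ => ?_
        simp only [enorm_mul, enorm_pow]
        ring
    _ ≤ (n - l + 1 : ℕ) * ∑ k ∈ Finset.range (n - l + 1),
        ‖c k‖ₑ ^ 2 * ((2 ^ (n - l - k)) ^ 2 * (A k * B * J)) := by
        gcongr _ * ∑ k ∈ _, _ * (?_ * ?_) with k _
        · gcongr
        · exact h2 k
    _ = _ := by
        rw [mul_assoc, Finset.sum_mul]
        congr 1
        refine Finset.sum_congr rfl fun k _ => ?_
        ring

/-! ### Averaging over charts is bounded on `L¹`. -/

theorem measurable_defect {d : ℕ} : Measurable fun x : Z d => defect x := by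
  unfold defect; fun_prop

theorem measurable_bergmanSqrtInv_sub {d : ℕ} :
    Measurable fun p : Z d × Z d => bergmanSqrtInv p.1 (p.2 - p.1) := by
  have h1 : Measurable fun p : Z d × Z d => (defect p.1 : ℂ) :=
    Complex.measurable_ofReal.comp (measurable_defect.comp measurable_fst)
  have h2 : Measurable fun p : Z d × Z d => (inner ℂ p.1 (p.2 - p.1) : ℂ) :=
    (continuous_fst.inner (continuous_snd.sub continuous_fst)).measurable
  unfold bergmanSqrtInv
  exact h1.inv.smul ((measurable_snd.sub measurable_fst).add
    ((h2.div (h1.mul (measurable_const.add h1))).smul measurable_fst))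

theorem mem_image_add_bergmanSqrt {d : ℕ} {x : Z d} (hx : x ∈ D d) {S : Set (Z d)} {y : Z d} :
    y ∈ (fun w => x + bergmanSqrt x w) '' S ↔ bergmanSqrtInv x (y - x) ∈ S := by
  constructor
  · rintro ⟨w, hw, rfl⟩
    simpa [bergmanSqrtInv_bergmanSqrt hx] using hw
  · intro h
    exact ⟨_, h, by simp [bergmanSqrt_bergmanSqrtInv hx]⟩

/-- Approximate symmetry of the charts: if `y` has coordinate of norm below `1/4` in the chart at
`x`, then `x` has coordinate of norm at most `10/4 ≤ 3` in the linear chart at `y`. -/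
theorem near_of_norm_bergmanSqrtInv_lt {d : ℕ} {x y : Z d} (hx : x ∈ D d)
    (h : ‖bergmanSqrtInv x (y - x)‖ < 1 / 4) :
    y ∈ D d ∧ Near x y ∧ ‖bergmanSqrtInv y (x - y)‖ ≤ 3 := by
  have e : x + bergmanSqrt x (bergmanSqrtInv x (y - x)) = y := by
    rw [bergmanSqrt_bergmanSqrtInv hx, add_sub_cancel]
  obtain ⟨hy, hn⟩ := near_add_bergmanSqrt hx h
  rw [e] at hy hn
  refine ⟨hy, hn, ?_⟩
  have e2 : bergmanSqrt x ((-1 : ℂ) • bergmanSqrtInv x (y - x)) = x - y := by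
    rw [bergmanSqrt_smul, bergmanSqrt_bergmanSqrtInv hx]
    module
  rw [← e2]
  refine (hn.norm_bergmanSqrtInv_bergmanSqrt_le hx hy _).trans ?_
  rw [norm_smul]
  norm_num
  linarith

/-- The admissible `x` lie in the image of a ball of radius three under the chart at `y`. Its volume
is proportional to `(defect y)^{2(d+1)}`, which cancels the normalisation since the defects are
comparable. -/
theorem setLIntegral_near_le {d : ℕ} {y : Z d} (hy : y ∈ D d) :
    ∫⁻ x in D d, ENNReal.ofReal ((defect x ^ (2 * (d + 1)))⁻¹) *
      {p : Z d × Z d | ‖bergmanSqrtInv p.1 (p.2 - p.1)‖ < 1 / 4}.indicator 1 (x, y) ≤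
      ENNReal.ofReal (2 ^ (2 * (d + 1))) * volume (Metric.closedBall (0 : Z d) 3) := by
  set m := 2 * (d + 1)
  have hsy := defect_pos hy
  set R := (fun w => y + bergmanSqrt y w) '' Metric.closedBall 0 3 with hR
  calc _ ≤ ∫⁻ x in D d, R.indicator (fun _ => ENNReal.ofReal (2 ^ m * (defect y ^ m)⁻¹)) x := by
        refine setLIntegral_mono' Metric.isOpen_ball.measurableSet fun x hx => ?_
        have hsx := defect_pos hx
        by_cases h : ‖bergmanSqrtInv x (y - x)‖ < 1 / 4
        · obtain ⟨-, hn, h3⟩ := near_of_norm_bergmanSqrtInv_lt hx h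
          have hxR : x ∈ R := (mem_image_add_bergmanSqrt hy).2 (by simpa using h3)
          rw [Set.indicator_of_mem hxR, Set.indicator_of_mem (by exact h), Pi.one_apply, mul_one]
          refine ENNReal.ofReal_le_ofReal ?_
          rw [← div_eq_mul_inv, inv_le_comm₀ (by positivity) (by positivity), inv_div,
            div_le_iff₀ (by positivity), ← mul_pow, mul_comm]
          gcongr
          exact hn.right_le
        · rw [Set.indicator_of_notMem (by exact h), mul_zero]
          exact zero_le
    _ ≤ ∫⁻ x, R.indicator (fun _ => ENNReal.ofReal (2 ^ m * (defect y ^ m)⁻¹)) x :=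
        setLIntegral_le_lintegral _ _
    _ ≤ ∫⁻ x in R, ENNReal.ofReal (2 ^ m * (defect y ^ m)⁻¹) := lintegral_indicator_le _ _
    _ = _ := by
        rw [hR, lintegral_comp_bergmanSqrt hy Metric.isClosed_closedBall.measurableSet,
          setLIntegral_const, ← mul_assoc, ← ENNReal.ofReal_mul (by positivity)]
        congr 2
        rw [mul_left_comm, mul_inv_cancel₀ (by positivity), mul_one]

/-- Substituting `y = x + B_{x,x}^{1/2}w` turns the average into an integral operator with
non-negative kernel. By Tonelli only the integral of the kernel in `x`, for fixed `y`, has to be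
bounded. -/
theorem lintegral_lintegral_bergmanSqrt_le {d : ℕ} {W : Z d → ENNReal}
    (hW : AEMeasurable W (volume.restrict (D d))) :
    ∫⁻ x in D d, ∫⁻ w in Metric.ball (0 : Z d) (1 / 4), W (x + bergmanSqrt x w) ≤
      (ENNReal.ofReal (2 ^ (2 * (d + 1))) * volume (Metric.closedBall (0 : Z d) 3)) *
        ∫⁻ y in D d, W y := by
  set m := 2 * (d + 1)
  set N : Set (Z d × Z d) := {p | ‖bergmanSqrtInv p.1 (p.2 - p.1)‖ < 1 / 4} with hN
  have hNm : MeasurableSet N :=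
    measurableSet_lt measurable_bergmanSqrtInv_sub.norm measurable_const
  have hind : Measurable (N.indicator (1 : Z d × Z d → ENNReal)) := measurable_one.indicator hNm
  -- Tonelli is applied to a measurable representative; the images of the charts stay inside the
  -- ball, so replacing `W` is harmless.
  set W' := hW.mk W with hW'
  have hW'm : Measurable W' := hW.measurable_mk
  have hδm : Measurable fun x : Z d => ENNReal.ofReal ((defect x ^ m)⁻¹) :=
    (measurable_defect.pow_const m).inv.ennreal_ofReal
  have hinner : ∀ x ∈ D d, ∫⁻ w in Metric.ball (0 : Z d) (1 / 4), W (x + bergmanSqrt x w) =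
      ∫⁻ y in D d, ENNReal.ofReal ((defect x ^ m)⁻¹) * N.indicator 1 (x, y) * W' y := by
    intro x hx
    have hsx := defect_pos hx
    set E := (fun w => x + bergmanSqrt x w) '' Metric.ball 0 (1 / 4) with hE
    have hED : E ⊆ D d := by
      rintro _ ⟨w, hw, rfl⟩
      exact (near_add_bergmanSqrt hx (by simpa using hw)).1
    have hEN : ∀ y, y ∈ E ↔ (x, y) ∈ N := fun y => by
      rw [hE, mem_image_add_bergmanSqrt hx, mem_ball_zero_iff]; rfl
    have hEm : MeasurableSet E := by
      have : E = Prod.mk x ⁻¹' N := Set.ext hEN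
      rw [this]; exact measurable_prodMk_left hNm
    have h1 := lintegral_comp_bergmanSqrt hx (Metric.isOpen_ball (x := (0 : Z d))
      (ε := 1 / 4)).measurableSet W
    have h2 : ∫⁻ y in E, W y = ∫⁻ y in E, W' y :=
      lintegral_congr_ae (ae_mono (Measure.restrict_mono_set volume hED) hW.ae_eq_mk)
    calc _ = ENNReal.ofReal ((defect x ^ m)⁻¹) * ∫⁻ y in E, W y := by
          rw [hE, h1, ← mul_assoc, ← ENNReal.ofReal_mul (by positivity),
            inv_mul_cancel₀ (by positivity), ENNReal.ofReal_one, one_mul]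
      _ = ENNReal.ofReal ((defect x ^ m)⁻¹) * ∫⁻ y in D d, E.indicator W' y := by
          rw [h2, setLIntegral_indicator hEm, Set.inter_eq_left.2 hED]
      _ = _ := by
          rw [← lintegral_const_mul' _ _ ENNReal.ofReal_ne_top]
          refine lintegral_congr fun y => ?_
          rw [mul_assoc]
          congr 1
          by_cases h : y ∈ E
          · rw [Set.indicator_of_mem h, Set.indicator_of_mem ((hEN y).1 h), Pi.one_apply, one_mul]
          · rw [Set.indicator_of_notMem h, Set.indicator_of_notMem (fun h' => h ((hEN y).2 h')),
              zero_mul]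
  rw [setLIntegral_congr_fun Metric.isOpen_ball.measurableSet hinner, lintegral_lintegral_swap]
  · rw [lintegral_congr_ae hW.ae_eq_mk, ← lintegral_const_mul _ hW'm]
    refine setLIntegral_mono' Metric.isOpen_ball.measurableSet fun y hy => ?_
    rw [lintegral_mul_const]
    · gcongr
      exact setLIntegral_near_le hy
    · exact hδm.mul (hind.comp measurable_prodMk_right)
  · exact (((hδm.comp measurable_fst).mul hind).mul (hW'm.comp measurable_snd)).aemeasurable

section Bounded

variable {d l n : ℕ} {ν : ℝ} {Φ : Z d → Z d → ℂ}

theorem aestronglyMeasurable_bigIntegrand (hl : l ≤ n)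
    (H : (Z d → ℂ) →ₗ⋆[ℂ] (Z d → ℂ) →ₗ[ℂ] ℂ) (hΦ : IsHolomorphicMap (homPoly d l) Φ) :
    AEStronglyMeasurable (bigIntegrand ν n H (ballOp ν l n Φ) (ballOp ν l n Φ))
      (volume.restrict (D d)) := by
  obtain ⟨m, ζ, K, -, hK⟩ := exists_inner_bound (n := n) H
  have hc : ContinuousOn (fun x => weight ν x * ∑ i, ∑ j,
      starRingEnd ℂ (transportedOp ν l n Φ x (ζ i)) * transportedOp ν l n Φ x (ζ j) * K i j)
      (D d) := by
    refine ContinuousOn.mul ?_ (continuousOn_finsetSum _ fun i _ =>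
      continuousOn_finsetSum _ fun j _ => ((Complex.continuous_conj.comp_continuousOn
        (continuousOn_transportedOp hΦ _)).mul
        (continuousOn_transportedOp hΦ _)).mul continuousOn_const)
    refine Complex.continuous_ofReal.comp_continuousOn
      (ContinuousOn.rpow_const (by fun_prop) fun x hx => Or.inl ?_)
    have := defect_pos hx
    rw [← defect_sq hx]; positivity
  refine (hc.aestronglyMeasurable Metric.isOpen_ball.measurableSet).congr ?_
  refine (ae_restrict_iff' Metric.isOpen_ball.measurableSet).2 (Filter.Eventually.of_forall
    fun x hx => ?_)
  rw [bigIntegrand, transport_ballOp hl hΦ hx, hK _ (transportedOp_mem hl hΦ hx)]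

theorem MemLittle.ofReal_littleInner (h : MemLittle ν l Φ) :
    ∫⁻ y in D d, ENNReal.ofReal (littleDensity ν Φ y) =
      ENNReal.ofReal (littleInner ν Φ Φ).re := by
  rw [littleInner, ← RCLike.re_eq_complex_re, ← integral_re h.sq_int,
    ofReal_integral_eq_lintegral_ofReal h.sq_int.re]
  · rfl
  · exact (ae_restrict_iff' Metric.isOpen_ball.measurableSet).2 (Filter.Eventually.of_forall
      fun x hx => littleDensity_nonneg h.holo hx)

/-- The quantitative core: it yields both membership in the big space and boundedness. -/
theorem exists_lintegral_bigIntegrand_le (d l n : ℕ) (hl : l ≤ n) (ν : ℝ)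
    (H : (Z d → ℂ) →ₗ⋆[ℂ] (Z d → ℂ) →ₗ[ℂ] ℂ) : ∃ C : ENNReal, C ≠ ⊤ ∧
      ∀ Φ, MemLittle ν l Φ →
        ∫⁻ x in D d, ‖bigIntegrand ν n H (ballOp ν l n Φ) (ballOp ν l n Φ) x‖ₑ ≤
          C * ENNReal.ofReal (littleInner ν Φ Φ).re := by
  obtain ⟨m, ζ, K, hζ, hK⟩ := exists_inner_bound (n := n) H
  obtain ⟨A, hA, hAle⟩ := exists_weight_mul_transportedOp_le d l n ν
  set κ : ENNReal := (∑ i, ∑ j, ‖K i j‖ₑ) * (m * A) with hκ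
  have hκt : κ ≠ ⊤ := ENNReal.mul_ne_top
    (ENNReal.sum_ne_top.2 fun i _ => ENNReal.sum_ne_top.2 fun j _ => enorm_ne_top)
    (ENNReal.mul_ne_top (ENNReal.natCast_ne_top _) hA)
  refine ⟨κ * (ENNReal.ofReal (2 ^ (2 * (d + 1))) * volume (Metric.closedBall (0 : Z d) 3)),
    ENNReal.mul_ne_top hκt (ENNReal.mul_ne_top ENNReal.ofReal_ne_top
      measure_closedBall_lt_top.ne), fun Φ h => ?_⟩
  calc _ ≤ ∫⁻ x in D d, κ * ∫⁻ w in Metric.ball (0 : Z d) (1 / 4),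
        ENNReal.ofReal (littleDensity ν Φ (x + bergmanSqrt x w)) := by
        refine setLIntegral_mono' Metric.isOpen_ball.measurableSet fun x hx => ?_
        have hs := defect_pos hx
        rw [bigIntegrand, transport_ballOp hl h.holo hx, hK _ (transportedOp_mem hl h.holo hx),
          enorm_mul, weight_eq hx, ← ofReal_norm (((defect x ^ 2) ^ (ν - genus d) : ℝ) : ℂ),
          Complex.norm_real, Real.norm_of_nonneg (by positivity)]
        refine (mul_le_mul_right (enorm_form_le K _) _).trans ?_
        rw [mul_left_comm, Finset.mul_sum, hκ, mul_assoc]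
        gcongr
        refine (Finset.sum_le_card_nsmul _ _ _ fun i _ => hAle Φ h.holo x hx (ζ i)
          (norm_lt_one_of_mem (hζ i)).le).trans (le_of_eq ?_)
        rw [Finset.card_univ, Fintype.card_fin, nsmul_eq_mul, mul_assoc]
    _ ≤ κ * ((ENNReal.ofReal (2 ^ (2 * (d + 1))) * volume (Metric.closedBall (0 : Z d) 3)) *
        ∫⁻ y in D d, ENNReal.ofReal (littleDensity ν Φ y)) := by
        rw [lintegral_const_mul' _ _ hκt]
        gcongr
        exact lintegral_lintegral_bergmanSqrt_le
          (h.sq_int.aestronglyMeasurable.aemeasurable.re.ennreal_ofReal)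
    _ = _ := by rw [h.ofReal_littleInner, ← mul_assoc]

theorem memBig_ballOp (hl : l ≤ n) (H : (Z d → ℂ) →ₗ⋆[ℂ] (Z d → ℂ) →ₗ[ℂ] ℂ)
    (h : MemLittle ν l Φ) : MemBig ν n H (ballOp ν l n Φ) := by
  obtain ⟨C, hC, hle⟩ := exists_lintegral_bigIntegrand_le d l n hl ν H
  exact ⟨isHolomorphicMap_ballOp hl ν h.holo, aestronglyMeasurable_bigIntegrand hl H h.holo,
    (hle Φ h).trans_lt (ENNReal.mul_lt_top hC.lt_top ENNReal.ofReal_lt_top)⟩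

theorem exists_bigNorm_ballOp_le (hl : l ≤ n) (ν : ℝ)
    (H : (Z d → ℂ) →ₗ⋆[ℂ] (Z d → ℂ) →ₗ[ℂ] ℂ) : ∃ C : ℝ, ∀ Φ, MemLittle ν l Φ →
      bigNorm ν n H (ballOp ν l n Φ) ≤ C * littleNorm ν Φ := by
  obtain ⟨C, hC, hle⟩ := exists_lintegral_bigIntegrand_le d l n hl ν H
  refine ⟨Real.sqrt C.toReal, fun Φ h => ?_⟩
  have h0 : 0 ≤ (littleInner ν Φ Φ).re := by
    rw [littleInner, ← RCLike.re_eq_complex_re, ← integral_re h.sq_int]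
    exact setIntegral_nonneg Metric.isOpen_ball.measurableSet
      fun x hx => littleDensity_nonneg h.holo hx
  rw [bigNorm, littleNorm, ← Real.sqrt_mul ENNReal.toReal_nonneg]
  refine Real.sqrt_le_sqrt ((Complex.re_le_norm _).trans ?_)
  have h1 := (enorm_integral_le_lintegral_enorm _).trans (hle Φ h)
  have h2 := ENNReal.toReal_mono (ENNReal.mul_ne_top hC ENNReal.ofReal_ne_top) h1
  rwa [toReal_enorm, ENNReal.toReal_mul, ENNReal.toReal_ofReal h0] at h2

end Bounded

end BallBundle

end

theorem mainTheorem5 (d n l : ℕ) (hd : 1 ≤ d) (hl : l ≤ n) (ν : ℝ) (hν : (d : ℝ) < ν)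
    (H : (BallBundle.Z d → ℂ) →ₗ⋆[ℂ] (BallBundle.Z d → ℂ) →ₗ[ℂ] ℂ)
    (hH : BallBundle.IsInvariantInner d n H) :
    BallBundle.IsIntertwiner ν l n H (BallBundle.ballOp ν l n) ∧
    (∀ Φ : BallBundle.Z d → BallBundle.Z d → ℂ,
      BallBundle.IsHolomorphicMap (BallBundle.homPoly d l) Φ →
      ∀ z ∈ BallBundle.D d, ∀ ζ : BallBundle.Z d,
        BallBundle.ballOpBinom ν l n Φ z ζ = BallBundle.ballOp ν l n Φ z ζ ∧
        ∀ b : ℕ → Finset (MvPolynomial (Fin d) ℂ),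
          (∀ k, BallBundle.IsFischerBasis d k (b k)) →
          BallBundle.ballOpKernel ν l n b Φ z ζ = BallBundle.ballOp ν l n Φ z ζ) := by
  -- Positivity keeps the denominators `(2l+ν)_k` away from zero.
  have hpos : 0 < 2 * (l : ℝ) + ν := by
    have : (0 : ℝ) ≤ d := d.cast_nonneg
    have : (0 : ℝ) ≤ l := l.cast_nonneg
    linarith
  refine ⟨⟨fun Φ h => BallBundle.memBig_ballOp hl H h,
    fun Φ Ψ hΦ hΨ z hz => BallBundle.ballOp_add ν hΦ.holo hΨ.holo hz,
    fun c Φ _ z _ => BallBundle.ballOp_smul ν c Φ z,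
    BallBundle.exists_bigNorm_ballOp_le hl ν H,
    fun g L hL Φ hΦ z hz ζ hzζ =>
      BallBundle.ballOp_equivariant hl hpos hL hΦ.holo hz hzζ⟩, ?_⟩
  exact fun Φ hΦ z hz ζ => ⟨BallBundle.ballOpBinom_eq hl ν Φ z ζ,
    fun b hb => BallBundle.ballOpKernel_eq hd ν hΦ hz ζ hb⟩
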